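/- **Theorem (Duality of internal bialgebroids).** Let $(\mathcal M,\Box,U,\Sigma)$ be a symmetric monoidal category that has coequalizers, and suppose $\Box$ preserves coequalizers in each variable. (Coherence isomorphisms are suppressed below.) *Setting.* For a monoid $R$ in $\mathcal M$, the $R$-bimodules form a monoidal category ${}_R\mathcal M_R$ with unit $R$ and with product $M\otimes_R N$ the coequalizer $\sqcap(M,N):M\Box N\to M\otimes_R N$ of the two actions of $R$. A comonoid in ${}_R\mathcal M_R$ is written $(L,\gamma,\pi)$ (comultiplication, counit). Let $A$ and $R$ be monoids with multiplications $\mu$ and units $\eta$, and let $s:R\to A$, $t:R^{op}\to A$ be monoid morphisms with $\mu_A(s\Box t)=\mu_A\Sigma_{A,A}(s\Box t)$. Consider the $R$-bimodules (left action, right action) $$S=(A,\ \mu_A(s\Box A),\ \mu_A(A\Box s)),\quad L=(A,\ \mu_A(s\Box A),\ \mu_A\Sigma_{A,A}(A\Box t)),\quad K=(A,\ \mu_A\Sigma_{A,A}(t\Box A),\ \mu_A(A\Box s)).$$ $S$ is a monoid in ${}_R\mathcal M_R$ with unit $s$ and with the multiplication $\mu_S$ determined by $\mu_S\sqcap(S,S)=\mu_A$.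 *Left bialgebroid.* $(A,R,s,t,\gamma,\pi)$ is a left bialgebroid if $(L,\gamma,\pi)$ is a comonoid in ${}_R\mathcal M_R$ and $$\rho(\gamma\Box t\Box\eta_A)=\rho(\gamma\Box\eta_A\Box s),\quad \gamma\eta_A=\sqcap(L,L)(\eta_A\Box\eta_A),\quad \gamma\mu_A=\lambda(A\Box\gamma),\quad \pi\eta_A=\eta_R,$$ $$\pi\mu_A(A\Box s\pi)=\pi\mu_A=\pi\mu_A(A\Box t\pi),$$ where $\rho:(L\otimes_RL)\Box A\Box A\to L\otimes_RL$ and $\lambda:A\Box(L\otimes_RL)\to L\otimes_RL$ are determined by $\rho(\sqcap(L,L)\Box A\Box A)=\sqcap(L,L)\mu_{A\Box A}$ and, using the first axiom, $\lambda(A\Box\sqcap(L,L))=\rho(\gamma\Box A\Box A)$. *Right bialgebroid.* $(A,R,s,t,\gamma,\pi)$ is a right bialgebroid if $(K,\gamma,\pi)$ is a comonoid in ${}_R\mathcal M_R$ and $$\lambda'(\eta_A\Box t\Box\gamma)=\lambda'(s\Box\eta_A\Box\gamma),\quad \gamma\eta_A=\sqcap(K,K)(\eta_A\Box\eta_A),\quad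 \gamma\mu_A=\rho'(\gamma\Box A),\quad \pi\eta_A=\eta_R,$$ $$\pi\mu_A(s\pi\Box A)=\pi\mu_A=\pi\mu_A(t\pi\Box A),$$ where $\lambda':A\Box A\Box(K\otimes_RK)\to K\otimes_RK$ and $\rho':(K\otimes_RK)\Box A\to K\otimes_RK$ are determined by $\lambda'(A\Box A\Box\sqcap(K,K))=\sqcap(K,K)\mu_{A\Box A}$ and, using the first axiom, $\rho'(\sqcap(K,K)\Box A)=\lambda'(A\Box A\Box\gamma)$. *Entwining structures.* In a monoidal category with product $\otimes$, a left entwining structure is a monoid $(S,\mu,\eta)$, a comonoid $(L,\gamma,\pi)$ and $\psi:S\otimes L\to L\otimes S$ with $$\psi(\eta\otimes L)=L\otimes\eta,\qquad (\pi\otimes S)\psi=S\otimes\pi,$$ $$(L\otimes\mu)(\psi\otimes S)(S\otimes\psi)=\psi(\mu\otimes L),\qquad (\gamma\otimes S)\psi=(L\otimes\psi)(\psi\otimes L)(S\otimes\gamma).$$ A right entwining structure is a monoid $(L',\mu,\eta)$, a comonoid $(S',\gamma,\pi)$ and $\psi':S'\otimes L'\to L'\otimes S'$ with $$\psi'(S'\otimes\eta)=\eta\otimes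 S',\qquad (L'\otimes\pi)\psi'=\pi\otimes L',$$ $$(\psi'\otimes S')(S'\otimes\psi')(\gamma\otimes L')=(L'\otimes\gamma)\psi',\qquad \psi'(S'\otimes\mu)=(\mu\otimes S')(L'\otimes\psi')(\psi'\otimes L').$$ *Duals.* A right dual of $X$ is an object $X^r$ with an evaluation $\cup_X:X\otimes X^r\to 1$ and a coevaluation $\cap_X:1\to X^r\otimes X$ satisfying the triangle identities. The dual of $X\otimes Y$ is taken to be $Y^r\otimes X^r$, and $f^r:Y^r\to X^r$ denotes the transpose of $f:X\to Y$. The dual of a comonoid $(L,\gamma,\pi)$ is the monoid $(L^r,\gamma^r,\pi^r)$, and the dual of a monoid $(S,\mu,\eta)$ is the comonoid $(S^r,\mu^r,\eta^r)$. *Claim.* Let $(A,R,s,t,\gamma,\pi)$ be a left bialgebroid in $\mathcal M$, and suppose that the bimodules $S$ and $L$ have right duals $S^r$ and $L^r$ in ${}_R\mathcal M_R$. Then: 1. There is a bimodule morphism $\psi:S\otimes_RL\to L\otimes_RS$ (uniquely determined, as $\sqcap(S,L)$ is an epimorphism) with $\psi\sqcap(S,L)=\rho(\gamma\Box A\Box\eta_A)$,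 and $(S,L,\psi)$ is a left entwining structure in ${}_R\mathcal M_R$. (The objects of $\mathcal M$ underlying $L\otimes_RL$ and $L\otimes_RS$ coincide.) 2. Let $B$ be the object of $\mathcal M$ underlying $L^r$, with the monoid structure $\mu_B=\gamma^r\sqcap(L^r,L^r)$, $\eta_B=\pi^r\eta_R$. Then $$L^r=(B,\ \mu_B(\pi^r\Box B),\ \mu_B(B\Box\pi^r)).$$ 3. The map $\pi^r:R\to B$ is a monoid morphism, and there is a monoid morphism $q:R^{op}\to B$ with $\mu_B(\pi^r\Box q)=\mu_B\Sigma_{B,B}(\pi^r\Box q)$ such that, up to isomorphism of bimodules, $$S^r=(B,\ \mu_B\Sigma_{B,B}(q\Box B),\ \mu_B(B\Box\pi^r)),$$ where the isomorphism can be chosen so that the evaluations agree: $\cup_L\sqcap(L,L^r)=\cup_S\sqcap(S,S^r)$ as morphisms $A\Box B\to R$. 4. With $S^r$ in this form, the dual $(L^r,S^r,\psi^r)$, $\psi^r:S^r\otimes_RL^r\to L^r\otimes_RS^r$, is a right entwining structure in ${}_R\mathcal M_R$. The counit $s^r:B\to R$ of $S^r$ is an epimorphism in $\mathcal M$, and $$\psi^r\sqcap(S^r,L^r)=\lambda_N(\eta_B\Box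 B\Box\mu_S^r),$$ where $\lambda_N$ is the morphism determined by $\lambda_N(B\Box B\Box\sqcap(L^r,S^r))=\sqcap(L^r,S^r)\mu_{B\Box B}$. (The objects of $\mathcal M$ underlying $L^r\otimes_RS^r$ and $S^r\otimes_RS^r$ coincide.) 5. Equivalently, $(B,R,\pi^r,q,\mu_S^r,s^r)$ is a right bialgebroid in $\mathcal M$; that is, this also holds. -/

import Mathlib

open CategoryTheory MonoidalCategory Limits

universe v u

namespace InternalBialgebroid

section BimoduleTensor

set_option linter.unusedSectionVars false

variable {C : Type u} [Category.{v} C] [MonoidalCategory C] [HasCoequalizers C]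
variable {R : Mon C}

/-- The object `M ⊗_R N`, the coequalizer of the two actions of `R` on `M ⊗ N`. -/
noncomputable def tens (M N : Bimod R R) : C :=
  coequalizer (M.actRight ▷ N.X) ((α_ _ _ _).hom ≫ (M.X ◁ N.actLeft))

/-- The canonical projection `M ⊗ N ⟶ M ⊗_R N`. -/
noncomputable def proj (M N : Bimod R R) : M.X ⊗ N.X ⟶ tens M N :=
  coequalizer.π (M.actRight ▷ N.X) ((α_ _ _ _).hom ≫ (M.X ◁ N.actLeft))

theorem proj_condition (M N : Bimod R R) :
    M.actRight ▷ N.X ≫ proj M N = (α_ _ _ _).hom ≫ M.X ◁ N.actLeft ≫ proj M N := by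
  have := coequalizer.condition (M.actRight ▷ N.X) ((α_ _ _ _).hom ≫ (M.X ◁ N.actLeft))
  rw [Category.assoc] at this
  exact this

instance (M N : Bimod R R) : Epi (proj M N) :=
  inferInstanceAs (Epi (coequalizer.π (M.actRight ▷ N.X) ((α_ _ _ _).hom ≫ (M.X ◁ N.actLeft))))

/-- The morphism out of `M ⊗_R N` induced by an `R`-balanced morphism. -/
noncomputable def desc {M N : Bimod R R} {W : C} (k : M.X ⊗ N.X ⟶ W)
    (h : M.actRight ▷ N.X ≫ k = (α_ _ _ _).hom ≫ M.X ◁ N.actLeft ≫ k) : tens M N ⟶ W :=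
  coequalizer.desc k (by simpa only [Category.assoc] using h)

theorem proj_desc {M N : Bimod R R} {W : C} (k : M.X ⊗ N.X ⟶ W)
    (h : M.actRight ▷ N.X ≫ k = (α_ _ _ _).hom ≫ M.X ◁ N.actLeft ≫ k) :
    proj M N ≫ desc k h = k :=
  coequalizer.π_desc _ _

section Left

variable [∀ X : C, PreservesColimitsOfShape WalkingParallelPair (tensorLeft X)]

instance (Z : C) (M N : Bimod R R) : Epi (Z ◁ proj M N) :=
  inferInstanceAs (Epi ((tensorLeft Z).map (coequalizer.π _ _)))

/-- The morphism out of `Z ⊗ (M ⊗_R N)` induced by an `R`-balanced morphism. -/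
noncomputable def descL {M N : Bimod R R} {Z W : C} (k : Z ⊗ (M.X ⊗ N.X) ⟶ W)
    (h : Z ◁ (M.actRight ▷ N.X) ≫ k = Z ◁ (α_ _ _ _).hom ≫ Z ◁ (M.X ◁ N.actLeft) ≫ k) :
    Z ⊗ tens M N ⟶ W :=
  (PreservesCoequalizer.iso (tensorLeft Z) _ _).inv ≫
    coequalizer.desc (f := (tensorLeft Z).map (M.actRight ▷ N.X))
      (g := (tensorLeft Z).map ((α_ _ _ _).hom ≫ (M.X ◁ N.actLeft))) k
      (by
        change Z ◁ _ ≫ k = Z ◁ _ ≫ k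
        rw [MonoidalCategory.whiskerLeft_comp, Category.assoc, h])

theorem whiskerLeft_proj_descL {M N : Bimod R R} {Z W : C} (k : Z ⊗ (M.X ⊗ N.X) ⟶ W)
    (h : Z ◁ (M.actRight ▷ N.X) ≫ k = Z ◁ (α_ _ _ _).hom ≫ Z ◁ (M.X ◁ N.actLeft) ≫ k) :
    Z ◁ proj M N ≫ descL k h = k :=
  map_π_preserves_coequalizer_inv_desc (tensorLeft Z) _ _ k _

end Left

section Right

variable [∀ X : C, PreservesColimitsOfShape WalkingParallelPair (tensorRight X)]

instance (Z : C) (M N : Bimod R R) : Epi (proj M N ▷ Z) :=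
  inferInstanceAs (Epi ((tensorRight Z).map (coequalizer.π _ _)))

/-- The morphism out of `(M ⊗_R N) ⊗ Z` induced by an `R`-balanced morphism. -/
noncomputable def descR {M N : Bimod R R} {Z W : C} (k : (M.X ⊗ N.X) ⊗ Z ⟶ W)
    (h : (M.actRight ▷ N.X) ▷ Z ≫ k = (α_ _ _ _).hom ▷ Z ≫ (M.X ◁ N.actLeft) ▷ Z ≫ k) :
    tens M N ⊗ Z ⟶ W :=
  (PreservesCoequalizer.iso (tensorRight Z) _ _).inv ≫
    coequalizer.desc (f := (tensorRight Z).map (M.actRight ▷ N.X))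
      (g := (tensorRight Z).map ((α_ _ _ _).hom ≫ (M.X ◁ N.actLeft))) k
      (by
        change _ ▷ Z ≫ k = _ ▷ Z ≫ k
        rw [MonoidalCategory.comp_whiskerRight, Category.assoc, h])

theorem proj_whiskerRight_descR {M N : Bimod R R} {Z W : C} (k : (M.X ⊗ N.X) ⊗ Z ⟶ W)
    (h : (M.actRight ▷ N.X) ▷ Z ≫ k = (α_ _ _ _).hom ▷ Z ≫ (M.X ◁ N.actLeft) ▷ Z ≫ k) :
    proj M N ▷ Z ≫ descR k h = k :=
  map_π_preserves_coequalizer_inv_desc (tensorRight Z) _ _ k _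

end Right

variable [∀ X : C, PreservesColimitsOfShape WalkingParallelPair (tensorLeft X)]
variable [∀ X : C, PreservesColimitsOfShape WalkingParallelPair (tensorRight X)]


instance (Z W : C) (M N : Bimod R R) : Epi ((Z ◁ proj M N) ▷ W) :=
  inferInstanceAs (Epi ((tensorLeft Z ⋙ tensorRight W).map (coequalizer.π _ _)))

/-- The left action of `R` on `M ⊗_R N`. -/
noncomputable def tensActLeft (M N : Bimod R R) : R.X ⊗ tens M N ⟶ tens M N :=
  descL ((α_ _ _ _).inv ≫ M.actLeft ▷ N.X ≫ proj M N) (by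
    rw [associator_inv_naturality_middle_assoc, ← comp_whiskerRight_assoc,
      ← cancel_epi (R.X ◁ (α_ M.X R.X N.X).inv), ← cancel_epi (α_ _ _ _).hom]
    have h2 : R.X ◁ M.actRight ≫ M.actLeft = (α_ _ _ _).inv ≫ M.actLeft ▷ R.X ≫ M.actRight := by
      rw [M.middle_assoc, Iso.inv_hom_id_assoc]
    rw [h2]
    simp only [comp_whiskerRight, Category.assoc, proj_condition]
    rw [associator_inv_naturality_right_assoc, whisker_exchange_assoc]
    simp)

theorem proj_tensActLeft (M N : Bimod R R) :
    R.X ◁ proj M N ≫ tensActLeft M N = (α_ _ _ _).inv ≫ M.actLeft ▷ N.X ≫ proj M N :=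
  whiskerLeft_proj_descL _ _

/-- The right action of `R` on `M ⊗_R N`. -/
noncomputable def tensActRight (M N : Bimod R R) : tens M N ⊗ R.X ⟶ tens M N :=
  descR ((α_ _ _ _).hom ≫ M.X ◁ N.actRight ≫ proj M N) (by
    have h2 : N.actLeft ▷ R.X ≫ N.actRight = _ := N.middle_assoc
    rw [associator_naturality_left_assoc, ← whisker_exchange_assoc, proj_condition]
    rw [associator_naturality_middle_assoc, ← MonoidalCategory.whiskerLeft_comp_assoc, h2]
    simp)

theorem proj_tensActRight (M N : Bimod R R) :
    proj M N ▷ R.X ≫ tensActRight M N = (α_ _ _ _).hom ≫ M.X ◁ N.actRight ≫ proj M N :=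
  proj_whiskerRight_descR _ _

/-- The module tensor product of two `R`-bimodules. -/
noncomputable def tensBimod (M N : Bimod R R) : Bimod R R where
  X := tens M N
  actLeft := tensActLeft M N
  actRight := tensActRight M N
  one_actLeft := by
    rw [← cancel_epi (𝟙_ C ◁ proj M N), whisker_exchange_assoc, proj_tensActLeft,
      associator_inv_naturality_left_assoc, ← comp_whiskerRight_assoc, M.one_actLeft]
    simp
  left_assoc := by
    rw [← cancel_epi ((R.X ⊗ R.X) ◁ proj M N), whisker_exchange_assoc, proj_tensActLeft,
      associator_inv_naturality_left_assoc, ← comp_whiskerRight_assoc, M.left_assoc,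
      associator_naturality_right_assoc, ← MonoidalCategory.whiskerLeft_comp_assoc,
      proj_tensActLeft]
    simp [proj_tensActLeft]
  actRight_one := by
    rw [← cancel_epi (proj M N ▷ 𝟙_ C), ← whisker_exchange_assoc, proj_tensActRight,
      associator_naturality_right_assoc, ← MonoidalCategory.whiskerLeft_comp_assoc, N.actRight_one]
    simp
  right_assoc := by
    rw [← cancel_epi (proj M N ▷ (R.X ⊗ R.X)), ← whisker_exchange_assoc, proj_tensActRight,
      associator_naturality_right_assoc, ← MonoidalCategory.whiskerLeft_comp_assoc, N.right_assoc,
      associator_inv_naturality_left_assoc, ← MonoidalCategory.comp_whiskerRight_assoc,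
      proj_tensActRight]
    simp [proj_tensActRight]
  middle_assoc := by
    rw [← cancel_epi ((R.X ◁ proj M N) ▷ R.X), ← comp_whiskerRight_assoc, proj_tensActLeft,
      associator_naturality_middle_assoc, ← MonoidalCategory.whiskerLeft_comp_assoc,
      proj_tensActRight]
    simp only [Category.assoc, proj_tensActRight, proj_tensActLeft,
      MonoidalCategory.whiskerLeft_comp, comp_whiskerRight]
    rw [associator_inv_naturality_right_assoc, whisker_exchange_assoc]
    simp


/-- The canonical projection `M ⊗ N ⟶ M ⊗_R N` onto the module tensor product. -/
noncomputable def bπ (M N : Bimod R R) : M.X ⊗ N.X ⟶ (tensBimod M N).X := proj M N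

theorem bπ_condition (M N : Bimod R R) :
    M.actRight ▷ N.X ≫ bπ M N = (α_ _ _ _).hom ≫ M.X ◁ N.actLeft ≫ bπ M N :=
  proj_condition M N

theorem bπ_actLeft (M N : Bimod R R) :
    R.X ◁ bπ M N ≫ (tensBimod M N).actLeft = (α_ _ _ _).inv ≫ M.actLeft ▷ N.X ≫ bπ M N :=
  proj_tensActLeft M N

theorem bπ_actRight (M N : Bimod R R) :
    bπ M N ▷ R.X ≫ (tensBimod M N).actRight = (α_ _ _ _).hom ≫ M.X ◁ N.actRight ≫ bπ M N :=
  proj_tensActRight M N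

instance (M N : Bimod R R) : Epi (bπ M N) := inferInstanceAs (Epi (proj M N))

instance (Z : C) (M N : Bimod R R) : Epi (Z ◁ bπ M N) := inferInstanceAs (Epi (Z ◁ proj M N))

instance (Z : C) (M N : Bimod R R) : Epi (bπ M N ▷ Z) := inferInstanceAs (Epi (proj M N ▷ Z))

instance (Z W : C) (M N : Bimod R R) : Epi ((Z ◁ bπ M N) ▷ W) :=
  inferInstanceAs (Epi ((Z ◁ proj M N) ▷ W))

instance (Z W : C) (M N : Bimod R R) : Epi (Z ◁ (W ◁ bπ M N)) :=
  inferInstanceAs (Epi ((tensorLeft W ⋙ tensorLeft Z).map (coequalizer.π _ _)))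

instance (Z W : C) (M N : Bimod R R) : Epi ((bπ M N ▷ Z) ▷ W) :=
  inferInstanceAs (Epi ((tensorRight Z ⋙ tensorRight W).map (coequalizer.π _ _)))

instance (Z W : C) (M N : Bimod R R) : Epi (Z ◁ (bπ M N ▷ W)) :=
  inferInstanceAs (Epi ((tensorRight W ⋙ tensorLeft Z).map (coequalizer.π _ _)))

/-- The morphism out of `M ⊗_R N` induced by an `R`-balanced morphism. -/
noncomputable def bdesc {M N : Bimod R R} {W : C} (k : M.X ⊗ N.X ⟶ W)
    (h : M.actRight ▷ N.X ≫ k = (α_ _ _ _).hom ≫ M.X ◁ N.actLeft ≫ k) :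
    (tensBimod M N).X ⟶ W :=
  desc k h

theorem bπ_bdesc {M N : Bimod R R} {W : C} (k : M.X ⊗ N.X ⟶ W)
    (h : M.actRight ▷ N.X ≫ k = (α_ _ _ _).hom ≫ M.X ◁ N.actLeft ≫ k) :
    bπ M N ≫ bdesc k h = k :=
  proj_desc _ _

/-- The morphism out of `Z ⊗ (M ⊗_R N)` induced by an `R`-balanced morphism. -/
noncomputable def bdescL {M N : Bimod R R} {Z W : C} (k : Z ⊗ (M.X ⊗ N.X) ⟶ W)
    (h : Z ◁ (M.actRight ▷ N.X) ≫ k = Z ◁ (α_ _ _ _).hom ≫ Z ◁ (M.X ◁ N.actLeft) ≫ k) :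
    Z ⊗ (tensBimod M N).X ⟶ W :=
  descL k h

theorem bπ_bdescL {M N : Bimod R R} {Z W : C} (k : Z ⊗ (M.X ⊗ N.X) ⟶ W)
    (h : Z ◁ (M.actRight ▷ N.X) ≫ k = Z ◁ (α_ _ _ _).hom ≫ Z ◁ (M.X ◁ N.actLeft) ≫ k) :
    Z ◁ bπ M N ≫ bdescL k h = k :=
  whiskerLeft_proj_descL _ _

/-- The morphism out of `(M ⊗_R N) ⊗ Z` induced by an `R`-balanced morphism. -/
noncomputable def bdescR {M N : Bimod R R} {Z W : C} (k : (M.X ⊗ N.X) ⊗ Z ⟶ W)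
    (h : (M.actRight ▷ N.X) ▷ Z ≫ k = (α_ _ _ _).hom ▷ Z ≫ (M.X ◁ N.actLeft) ▷ Z ≫ k) :
    (tensBimod M N).X ⊗ Z ⟶ W :=
  descR k h

theorem bπ_bdescR {M N : Bimod R R} {Z W : C} (k : (M.X ⊗ N.X) ⊗ Z ⟶ W)
    (h : (M.actRight ▷ N.X) ▷ Z ≫ k = (α_ _ _ _).hom ▷ Z ≫ (M.X ◁ N.actLeft) ▷ Z ≫ k) :
    bπ M N ▷ Z ≫ bdescR k h = k :=
  proj_whiskerRight_descR _ _

/-- The module tensor product of two bimodule morphisms. -/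
noncomputable def tensMap {M M' N N' : Bimod R R} (f : M ⟶ M') (g : N ⟶ N') :
    (tensBimod M N).X ⟶ (tensBimod M' N').X :=
  bdesc ((f.hom ⊗ₘ g.hom) ≫ bπ M' N') (by
    have h1 := f.right_act_hom
    have h2 := g.left_act_hom
    rw [MonoidalCategory.tensorHom_def_assoc, ← comp_whiskerRight_assoc, h1,
      comp_whiskerRight_assoc, whisker_exchange_assoc, ← whisker_exchange_assoc M'.actRight,
      bπ_condition, ← MonoidalCategory.whiskerLeft_comp_assoc M'.X N.actLeft, h2]
    simp)

theorem bπ_tensMap {M M' N N' : Bimod R R} (f : M ⟶ M') (g : N ⟶ N') :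
    bπ M N ≫ tensMap f g = (f.hom ⊗ₘ g.hom) ≫ bπ M' N' :=
  bπ_bdesc _ _

/-- The module tensor product of two bimodule morphisms. -/
noncomputable def tensHom {M M' N N' : Bimod R R} (f : M ⟶ M') (g : N ⟶ N') :
    tensBimod M N ⟶ tensBimod M' N' where
  hom := tensMap f g
  left_act_hom := by
    have h1 : M.actLeft ≫ f.hom = R.X ◁ f.hom ≫ M'.actLeft := f.left_act_hom
    rw [← cancel_epi (R.X ◁ bπ M N), ← MonoidalCategory.whiskerLeft_comp_assoc, bπ_tensMap,
      MonoidalCategory.whiskerLeft_comp_assoc, bπ_actLeft, ← Category.assoc,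
      bπ_actLeft]
    simp only [Category.assoc, bπ_tensMap, MonoidalCategory.tensorHom_def]
    rw [← comp_whiskerRight_assoc, h1]
    simp only [MonoidalCategory.whiskerLeft_comp, comp_whiskerRight, Category.assoc]
    rw [associator_inv_naturality_right_assoc, whisker_exchange_assoc]
    simp
  right_act_hom := by
    have h1 : N.actRight ≫ g.hom = g.hom ▷ R.X ≫ N'.actRight := g.right_act_hom
    rw [← cancel_epi (bπ M N ▷ R.X), ← comp_whiskerRight_assoc, bπ_tensMap,
      comp_whiskerRight_assoc, bπ_actRight, ← Category.assoc,
      bπ_actRight]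
    simp only [Category.assoc, bπ_tensMap, MonoidalCategory.tensorHom_def']
    rw [← MonoidalCategory.whiskerLeft_comp_assoc, h1]
    simp only [MonoidalCategory.whiskerLeft_comp, comp_whiskerRight, Category.assoc]
    rw [associator_naturality_left_assoc, ← whisker_exchange_assoc]
    simp

/-- Auxiliary morphism for the associator. -/
noncomputable def assocHomAux (M N P : Bimod R R) :
    (tensBimod M N).X ⊗ P.X ⟶ (tensBimod M (tensBimod N P)).X :=
  bdescR ((α_ _ _ _).hom ≫ M.X ◁ bπ N P ≫ bπ M (tensBimod N P)) (by
    have e : M.actRight ▷ (N.X ⊗ P.X) ≫ M.X ◁ bπ N P ≫ bπ M (tensBimod N P) =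
        (α_ _ _ _).hom ≫ M.X ◁ (R.X ◁ bπ N P ≫ (tensBimod N P).actLeft)
          ≫ bπ M (tensBimod N P) := by
      rw [← whisker_exchange_assoc, bπ_condition]
      simp
    rw [associator_naturality_left_assoc, e, bπ_actLeft]
    simp)

theorem bπ_assocHomAux (M N P : Bimod R R) :
    bπ M N ▷ P.X ≫ assocHomAux M N P =
      (α_ _ _ _).hom ≫ M.X ◁ bπ N P ≫ bπ M (tensBimod N P) :=
  bπ_bdescR _ _

/-- Auxiliary morphism for the inverse of the associator. -/
noncomputable def assocInvAux (M N P : Bimod R R) :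
    M.X ⊗ (tensBimod N P).X ⟶ (tensBimod (tensBimod M N) P).X :=
  bdescL ((α_ _ _ _).inv ≫ bπ M N ▷ P.X ≫ bπ (tensBimod M N) P) (by
    have e : (M.X ⊗ N.X) ◁ P.actLeft ≫ bπ M N ▷ P.X ≫ bπ (tensBimod M N) P =
        (α_ _ _ _).inv ≫ (bπ M N ▷ R.X ≫ (tensBimod M N).actRight) ▷ P.X
          ≫ bπ (tensBimod M N) P := by
      rw [whisker_exchange_assoc, comp_whiskerRight_assoc, bπ_condition,
        associator_naturality_left_assoc]
      simp
    rw [associator_inv_naturality_right_assoc, e, bπ_actRight]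
    simp)

theorem bπ_assocInvAux (M N P : Bimod R R) :
    M.X ◁ bπ N P ≫ assocInvAux M N P =
      (α_ _ _ _).inv ≫ bπ M N ▷ P.X ≫ bπ (tensBimod M N) P :=
  bπ_bdescL _ _

/-- The underlying morphism of the associator of the module tensor product. -/
noncomputable def assocHom (M N P : Bimod R R) :
    (tensBimod (tensBimod M N) P).X ⟶ (tensBimod M (tensBimod N P)).X :=
  bdesc (assocHomAux M N P) (by
    have e : (M.X ⊗ N.X) ◁ P.actLeft ≫ bπ M N ▷ P.X ≫ assocHomAux M N P =
        (α_ _ _ _).hom ≫ M.X ◁ (N.X ◁ P.actLeft ≫ bπ N P) ≫ bπ M (tensBimod N P) := by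
      rw [bπ_assocHomAux]; simp
    rw [← cancel_epi ((bπ M N ▷ R.X) ▷ P.X), ← comp_whiskerRight_assoc, bπ_actRight,
      comp_whiskerRight_assoc, comp_whiskerRight_assoc, bπ_assocHomAux,
      associator_naturality_left_assoc, ← whisker_exchange_assoc, e,
      associator_naturality_middle_assoc, ← MonoidalCategory.whiskerLeft_comp_assoc,
      bπ_condition]
    simp)

/-- The underlying morphism of the inverse of the associator of the module tensor product. -/
noncomputable def assocInv (M N P : Bimod R R) :
    (tensBimod M (tensBimod N P)).X ⟶ (tensBimod (tensBimod M N) P).X :=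
  bdesc (assocInvAux M N P) (by
    have e : M.actRight ▷ (N.X ⊗ P.X) ≫ M.X ◁ bπ N P ≫ assocInvAux M N P =
        (α_ _ _ _).inv ≫ (M.actRight ▷ N.X ≫ bπ M N) ▷ P.X ≫ bπ (tensBimod M N) P := by
      rw [bπ_assocInvAux]; simp
    rw [← cancel_epi ((M.X ⊗ R.X) ◁ bπ N P), whisker_exchange_assoc, e,
      associator_naturality_right_assoc, ← MonoidalCategory.whiskerLeft_comp_assoc, bπ_actLeft,
      MonoidalCategory.whiskerLeft_comp_assoc, MonoidalCategory.whiskerLeft_comp_assoc,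
      bπ_assocInvAux, bπ_condition, associator_inv_naturality_middle_assoc]
    simp)

theorem bπ_assocHom (M N P : Bimod R R) :
    bπ M N ▷ P.X ≫ bπ (tensBimod M N) P ≫ assocHom M N P =
      (α_ _ _ _).hom ≫ M.X ◁ bπ N P ≫ bπ M (tensBimod N P) := by
  unfold assocHom
  rw [bπ_bdesc, bπ_assocHomAux]

theorem bπ_assocInv (M N P : Bimod R R) :
    M.X ◁ bπ N P ≫ bπ M (tensBimod N P) ≫ assocInv M N P =
      (α_ _ _ _).inv ≫ bπ M N ▷ P.X ≫ bπ (tensBimod M N) P := by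
  unfold assocInv
  rw [bπ_bdesc, bπ_assocInvAux]

theorem bπ_tensMap_assoc {M M' N N' : Bimod R R} (f : M ⟶ M') (g : N ⟶ N') {W : C}
    (k : (tensBimod M' N').X ⟶ W) :
    bπ M N ≫ tensMap f g ≫ k = (f.hom ⊗ₘ g.hom) ≫ bπ M' N' ≫ k := by
  rw [← Category.assoc, bπ_tensMap, Category.assoc]

theorem bπ_assocHom_assoc (M N P : Bimod R R) {W : C}
    (k : (tensBimod M (tensBimod N P)).X ⟶ W) :
    bπ M N ▷ P.X ≫ bπ (tensBimod M N) P ≫ assocHom M N P ≫ k =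
      (α_ _ _ _).hom ≫ M.X ◁ bπ N P ≫ bπ M (tensBimod N P) ≫ k := by
  have h := bπ_assocHom M N P =≫ k
  simpa only [Category.assoc] using h

theorem ext₃ {M N P : Bimod R R} {W : C} {f g : (tensBimod (tensBimod M N) P).X ⟶ W}
    (h : bπ M N ▷ P.X ≫ bπ (tensBimod M N) P ≫ f = bπ M N ▷ P.X ≫ bπ (tensBimod M N) P ≫ g) :
    f = g :=
  (cancel_epi _).1 ((cancel_epi _).1 h)

theorem ext₃' {M N P : Bimod R R} {W : C} {f g : (tensBimod M (tensBimod N P)).X ⟶ W}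
    (h : M.X ◁ bπ N P ≫ bπ M (tensBimod N P) ≫ f = M.X ◁ bπ N P ≫ bπ M (tensBimod N P) ≫ g) :
    f = g :=
  (cancel_epi _).1 ((cancel_epi _).1 h)

/-- The associator of the module tensor product. -/
noncomputable def assocIso (M N P : Bimod R R) :
    tensBimod (tensBimod M N) P ≅ tensBimod M (tensBimod N P) :=
  Bimod.isoOfIso
    { hom := assocHom M N P
      inv := assocInv M N P
      hom_inv_id := by
        apply ext₃
        have h := bπ_assocHom M N P
        have h' := bπ_assocInv M N P
        rw [← Category.assoc (bπ (tensBimod M N) P), ← Category.assoc, h]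
        simp only [Category.assoc]
        rw [h']
        simp
      inv_hom_id := by
        apply ext₃'
        have h := bπ_assocHom M N P
        have h' := bπ_assocInv M N P
        rw [← Category.assoc (bπ M (tensBimod N P)), ← Category.assoc, h']
        simp only [Category.assoc]
        rw [h]
        simp }
    (by
      have h := bπ_assocHom M N P
      dsimp only
      rw [← cancel_epi (R.X ◁ bπ (tensBimod M N) P), ← cancel_epi (R.X ◁ (bπ M N ▷ P.X)),
        ← Category.assoc (R.X ◁ bπ (tensBimod M N) P), bπ_actLeft,
        ← MonoidalCategory.whiskerLeft_comp_assoc, ← MonoidalCategory.whiskerLeft_comp_assoc,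
        Category.assoc (bπ M N ▷ P.X), h]
      simp only [Category.assoc, MonoidalCategory.whiskerLeft_comp]
      rw [bπ_actLeft, associator_inv_naturality_middle_assoc, ← comp_whiskerRight_assoc,
        bπ_actLeft, associator_inv_naturality_right_assoc, whisker_exchange_assoc]
      simp only [Category.assoc, comp_whiskerRight]
      rw [h]
      simp)
    (by
      have h := bπ_assocHom M N P
      dsimp only
      rw [← cancel_epi (bπ (tensBimod M N) P ▷ R.X), ← cancel_epi ((bπ M N ▷ P.X) ▷ R.X),
        ← Category.assoc (bπ (tensBimod M N) P ▷ R.X), bπ_actRight,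
        ← comp_whiskerRight_assoc, ← comp_whiskerRight_assoc, Category.assoc (bπ M N ▷ P.X), h]
      simp only [Category.assoc, comp_whiskerRight]
      rw [bπ_actRight, associator_naturality_middle_assoc,
        ← MonoidalCategory.whiskerLeft_comp_assoc,
        bπ_actRight, associator_naturality_left_assoc, ← whisker_exchange_assoc]
      simp only [Category.assoc, MonoidalCategory.whiskerLeft_comp]
      rw [h]
      simp)

/-- The canonical projection `R ⊗ M ⟶ R ⊗_R M`. -/
noncomputable def bπl (M : Bimod R R) : R.X ⊗ M.X ⟶ (tensBimod (Bimod.regular R) M).X :=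
  bπ (Bimod.regular R) M

/-- The canonical projection `M ⊗ R ⟶ M ⊗_R R`. -/
noncomputable def bπr (M : Bimod R R) : M.X ⊗ R.X ⟶ (tensBimod M (Bimod.regular R)).X :=
  bπ M (Bimod.regular R)

instance (M : Bimod R R) : Epi (bπl M) := inferInstanceAs (Epi (bπ _ _))

instance (M : Bimod R R) : Epi (bπr M) := inferInstanceAs (Epi (bπ _ _))

instance (Z : C) (M : Bimod R R) : Epi (Z ◁ bπl M) := inferInstanceAs (Epi (Z ◁ bπ _ _))

instance (Z : C) (M : Bimod R R) : Epi (Z ◁ bπr M) := inferInstanceAs (Epi (Z ◁ bπ _ _))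

instance (Z : C) (M : Bimod R R) : Epi (bπl M ▷ Z) := inferInstanceAs (Epi (bπ _ _ ▷ Z))

instance (Z : C) (M : Bimod R R) : Epi (bπr M ▷ Z) := inferInstanceAs (Epi (bπ _ _ ▷ Z))

theorem bπl_condition (M : Bimod R R) :
    MonObj.mul (X := R.X) ▷ M.X ≫ bπl M = (α_ _ _ _).hom ≫ R.X ◁ M.actLeft ≫ bπl M :=
  bπ_condition (Bimod.regular R) M

theorem bπr_condition (M : Bimod R R) :
    M.actRight ▷ R.X ≫ bπr M = (α_ _ _ _).hom ≫ M.X ◁ MonObj.mul (X := R.X) ≫ bπr M :=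
  bπ_condition M (Bimod.regular R)

/-- The left unitor of the module tensor product. -/
noncomputable def lunitHom (M : Bimod R R) : (tensBimod (Bimod.regular R) M).X ⟶ M.X :=
  bdesc M.actLeft M.left_assoc

theorem bπl_lunitHom (M : Bimod R R) : bπl M ≫ lunitHom M = M.actLeft :=
  bπ_bdesc _ _

/-- The right unitor of the module tensor product. -/
noncomputable def runitHom (M : Bimod R R) : (tensBimod M (Bimod.regular R)).X ⟶ M.X :=
  bdesc M.actRight (by
    have h : M.actRight ▷ R.X ≫ M.actRight =
        (α_ _ _ _).hom ≫ M.X ◁ MonObj.mul (X := R.X) ≫ M.actRight := by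
      rw [M.right_assoc, Iso.hom_inv_id_assoc]
    exact h)

theorem bπr_runitHom (M : Bimod R R) : bπr M ≫ runitHom M = M.actRight :=
  bπ_bdesc _ _

/-- The left unitor of the module tensor product. -/
noncomputable def lunitIso (M : Bimod R R) : tensBimod (Bimod.regular R) M ≅ M :=
  Bimod.isoOfIso
    { hom := lunitHom M
      inv := (λ_ M.X).inv ≫ MonObj.one (X := R.X) ▷ M.X ≫ bπl M
      hom_inv_id := by
        have h : R.X ◁ M.actLeft ≫ bπl M =
            (α_ _ _ _).inv ≫ MonObj.mul (X := R.X) ▷ M.X ≫ bπl M := by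
          rw [bπl_condition, Iso.inv_hom_id_assoc]
        rw [← cancel_epi (bπl M), ← Category.assoc, bπl_lunitHom, leftUnitor_inv_naturality_assoc,
          whisker_exchange_assoc, h, associator_inv_naturality_left_assoc,
          ← comp_whiskerRight_assoc, MonObj.one_mul]
        simp
      inv_hom_id := by
        simp only [Category.assoc]
        rw [bπl_lunitHom, M.one_actLeft]
        simp }
    (by
      dsimp only
      have h : R.X ◁ bπl M ≫ (tensBimod (Bimod.regular R) M).actLeft =
        (α_ _ _ _).inv ≫ MonObj.mul (X := R.X) ▷ M.X ≫ bπl M := bπ_actLeft (Bimod.regular R) M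
      rw [← cancel_epi (R.X ◁ bπl M), ← Category.assoc, h,
        ← MonoidalCategory.whiskerLeft_comp_assoc, bπl_lunitHom]
      simp only [Category.assoc]
      rw [bπl_lunitHom, M.left_assoc, Iso.inv_hom_id_assoc])
    (by
      dsimp only
      have h : bπl M ▷ R.X ≫ (tensBimod (Bimod.regular R) M).actRight =
        (α_ _ _ _).hom ≫ R.X ◁ M.actRight ≫ bπl M := bπ_actRight (Bimod.regular R) M
      rw [← cancel_epi (bπl M ▷ R.X), ← Category.assoc, h,
        ← comp_whiskerRight_assoc, bπl_lunitHom]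
      simp only [Category.assoc]
      rw [bπl_lunitHom, M.middle_assoc])

/-- The right unitor of the module tensor product. -/
noncomputable def runitIso (M : Bimod R R) : tensBimod M (Bimod.regular R) ≅ M :=
  Bimod.isoOfIso
    { hom := runitHom M
      inv := (ρ_ M.X).inv ≫ M.X ◁ MonObj.one (X := R.X) ≫ bπr M
      hom_inv_id := by
        rw [← cancel_epi (bπr M), ← Category.assoc, bπr_runitHom,
          rightUnitor_inv_naturality_assoc, ← whisker_exchange_assoc, bπr_condition,
          associator_naturality_right_assoc, ← MonoidalCategory.whiskerLeft_comp_assoc,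
          MonObj.mul_one]
        simp
      inv_hom_id := by
        simp only [Category.assoc]
        rw [bπr_runitHom, M.actRight_one]
        simp }
    (by
      dsimp only
      have h : R.X ◁ bπr M ≫ (tensBimod M (Bimod.regular R)).actLeft =
        (α_ _ _ _).inv ≫ M.actLeft ▷ R.X ≫ bπr M := bπ_actLeft M (Bimod.regular R)
      rw [← cancel_epi (R.X ◁ bπr M), ← Category.assoc, h,
        ← MonoidalCategory.whiskerLeft_comp_assoc, bπr_runitHom]
      simp only [Category.assoc]
      rw [bπr_runitHom, M.middle_assoc, Iso.inv_hom_id_assoc])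
    (by
      dsimp only
      have h : bπr M ▷ R.X ≫ (tensBimod M (Bimod.regular R)).actRight =
        (α_ _ _ _).hom ≫ M.X ◁ MonObj.mul (X := R.X) ≫ bπr M := bπ_actRight M (Bimod.regular R)
      rw [← cancel_epi (bπr M ▷ R.X), ← Category.assoc, h,
        ← comp_whiskerRight_assoc, bπr_runitHom]
      simp only [Category.assoc]
      rw [bπr_runitHom, M.right_assoc, Iso.hom_inv_id_assoc])

theorem hom_id (M : Bimod R R) : Bimod.Hom.hom (𝟙 M) = 𝟙 M.X := rfl

theorem hom_comp {M N P : Bimod R R} (f : M ⟶ N) (g : N ⟶ P) :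
    Bimod.Hom.hom (f ≫ g) = f.hom ≫ g.hom := rfl

theorem tensHom_id (M N : Bimod R R) : tensHom (𝟙 M) (𝟙 N) = 𝟙 (tensBimod M N) := by
  apply Bimod.hom_ext
  rw [← cancel_epi (bπ M N)]
  refine (bπ_tensMap _ _).trans ?_
  rw [hom_id, hom_id, hom_id, MonoidalCategory.id_tensorHom_id, Category.id_comp,
    Category.comp_id]

theorem tensHom_comp {M₁ M₂ M₃ N₁ N₂ N₃ : Bimod R R} (f₁ : M₁ ⟶ M₂) (g₁ : N₁ ⟶ N₂)
    (f₂ : M₂ ⟶ M₃) (g₂ : N₂ ⟶ N₃) :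
    tensHom f₁ g₁ ≫ tensHom f₂ g₂ = tensHom (f₁ ≫ f₂) (g₁ ≫ g₂) := by
  apply Bimod.hom_ext
  change tensMap f₁ g₁ ≫ tensMap f₂ g₂ = tensMap (f₁ ≫ f₂) (g₁ ≫ g₂)
  rw [← cancel_epi (bπ M₁ N₁), ← Category.assoc, bπ_tensMap, Category.assoc, bπ_tensMap,
    bπ_tensMap, hom_comp, hom_comp, ← MonoidalCategory.tensorHom_comp_tensorHom_assoc]

theorem assoc_natural {M₁ M₂ M₃ N₁ N₂ N₃ : Bimod R R} (f₁ : M₁ ⟶ N₁) (f₂ : M₂ ⟶ N₂)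
    (f₃ : M₃ ⟶ N₃) :
    tensHom (tensHom f₁ f₂) f₃ ≫ (assocIso N₁ N₂ N₃).hom =
      (assocIso M₁ M₂ M₃).hom ≫ tensHom f₁ (tensHom f₂ f₃) := by
  apply Bimod.hom_ext
  change tensMap (tensHom f₁ f₂) f₃ ≫ assocHom N₁ N₂ N₃ =
    assocHom M₁ M₂ M₃ ≫ tensMap f₁ (tensHom f₂ f₃)
  have e1 : (tensHom f₁ f₂).hom = tensMap f₁ f₂ := rfl
  have e2 : (tensHom f₂ f₃).hom = tensMap f₂ f₃ := rfl
  apply ext₃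
  rw [bπ_tensMap_assoc, bπ_assocHom_assoc, bπ_tensMap, e1, e2]
  have a1 : bπ M₁ M₂ ▷ M₃.X ≫ (tensMap f₁ f₂ ⊗ₘ f₃.hom) =
      ((f₁.hom ⊗ₘ f₂.hom) ⊗ₘ f₃.hom) ≫ bπ N₁ N₂ ▷ N₃.X := by
    rw [MonoidalCategory.tensorHom_def, ← comp_whiskerRight_assoc, bπ_tensMap,
      MonoidalCategory.tensorHom_def (f₁.hom ⊗ₘ f₂.hom) f₃.hom]
    simp only [comp_whiskerRight, Category.assoc, whisker_exchange]
  have a2 : M₁.X ◁ bπ M₂ M₃ ≫ (f₁.hom ⊗ₘ tensMap f₂ f₃) =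
      (f₁.hom ⊗ₘ (f₂.hom ⊗ₘ f₃.hom)) ≫ N₁.X ◁ bπ N₂ N₃ := by
    rw [MonoidalCategory.tensorHom_def', ← MonoidalCategory.whiskerLeft_comp_assoc, bπ_tensMap,
      MonoidalCategory.tensorHom_def' f₁.hom (f₂.hom ⊗ₘ f₃.hom)]
    simp only [MonoidalCategory.whiskerLeft_comp, Category.assoc, whisker_exchange,
      whisker_exchange_assoc]
  rw [← Category.assoc (bπ M₁ M₂ ▷ M₃.X), a1, ← Category.assoc (M₁.X ◁ bπ M₂ M₃), a2]
  simp only [Category.assoc]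
  rw [bπ_assocHom]
  simp

theorem lunit_natural {M N : Bimod R R} (f : M ⟶ N) :
    tensHom (𝟙 (Bimod.regular R)) f ≫ (lunitIso N).hom = (lunitIso M).hom ≫ f := by
  apply Bimod.hom_ext
  change tensMap _ f ≫ lunitHom N = lunitHom M ≫ f.hom
  have h : bπl M ≫ tensMap (𝟙 (Bimod.regular R)) f = (𝟙 R.X ⊗ₘ f.hom) ≫ bπl N :=
    bπ_tensMap (𝟙 (Bimod.regular R)) f
  rw [← cancel_epi (bπl M), ← Category.assoc, h, Category.assoc, bπl_lunitHom,
    ← Category.assoc (bπl M), bπl_lunitHom, MonoidalCategory.id_tensorHom]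
  exact f.left_act_hom.symm

theorem runit_natural {M N : Bimod R R} (f : M ⟶ N) :
    tensHom f (𝟙 (Bimod.regular R)) ≫ (runitIso N).hom = (runitIso M).hom ≫ f := by
  apply Bimod.hom_ext
  change tensMap f _ ≫ runitHom N = runitHom M ≫ f.hom
  have h : bπr M ≫ tensMap f (𝟙 (Bimod.regular R)) = (f.hom ⊗ₘ 𝟙 R.X) ≫ bπr N :=
    bπ_tensMap f (𝟙 (Bimod.regular R))
  rw [← cancel_epi (bπr M), ← Category.assoc, h, Category.assoc, bπr_runitHom,
    ← Category.assoc (bπr M), bπr_runitHom, MonoidalCategory.tensorHom_id]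
  exact f.right_act_hom.symm

theorem tens_pentagon (W X Y Z : Bimod R R) :
    tensHom (assocIso W X Y).hom (𝟙 Z) ≫ (assocIso W (tensBimod X Y) Z).hom ≫
        tensHom (𝟙 W) (assocIso X Y Z).hom =
      (assocIso (tensBimod W X) Y Z).hom ≫ (assocIso W X (tensBimod Y Z)).hom := by
  apply Bimod.hom_ext
  change tensMap (assocIso W X Y).hom (𝟙 Z) ≫ assocHom W (tensBimod X Y) Z ≫
      tensMap (𝟙 W) (assocIso X Y Z).hom =
    assocHom (tensBimod W X) Y Z ≫ assocHom W X (tensBimod Y Z)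
  have e1 : (assocIso W X Y).hom.hom = assocHom W X Y := rfl
  have e2 : (assocIso X Y Z).hom.hom = assocHom X Y Z := rfl
  have b1 : bπ W X ▷ Y.X ▷ Z.X ≫ bπ (tensBimod W X) Y ▷ Z.X ≫ assocHom W X Y ▷ Z.X =
      (α_ _ _ _).hom ▷ Z.X ≫ (W.X ◁ bπ X Y) ▷ Z.X ≫ bπ W (tensBimod X Y) ▷ Z.X := by
    simp only [← comp_whiskerRight]
    rw [bπ_assocHom]
  have b2 : W.X ◁ bπ X Y ▷ Z.X ≫ W.X ◁ bπ (tensBimod X Y) Z ≫ W.X ◁ assocHom X Y Z =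
      W.X ◁ (α_ _ _ _).hom ≫ W.X ◁ X.X ◁ bπ Y Z ≫ W.X ◁ bπ X (tensBimod Y Z) := by
    simp only [← MonoidalCategory.whiskerLeft_comp]
    rw [bπ_assocHom]
  apply ext₃
  rw [← cancel_epi ((bπ W X ▷ Y.X) ▷ Z.X), bπ_tensMap_assoc, e1, hom_id,
    MonoidalCategory.tensorHom_id]
  rw [← Category.assoc (bπ (tensBimod W X) Y ▷ Z.X), ← Category.assoc (bπ W X ▷ Y.X ▷ Z.X), b1]
  simp only [Category.assoc]
  rw [bπ_assocHom_assoc, bπ_tensMap, hom_id, e2, MonoidalCategory.id_tensorHom,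
    associator_naturality_middle_assoc]
  rw [← Category.assoc (W.X ◁ bπ (tensBimod X Y) Z), ← Category.assoc (W.X ◁ bπ X Y ▷ Z.X), b2]
  simp only [Category.assoc]
  rw [bπ_assocHom_assoc, associator_naturality_left_assoc, ← whisker_exchange_assoc,
    bπ_assocHom]
  simp

theorem tens_triangle (X Y : Bimod R R) :
    (assocIso X (Bimod.regular R) Y).hom ≫ tensHom (𝟙 X) (lunitIso Y).hom =
      tensHom (runitIso X).hom (𝟙 Y) := by
  apply Bimod.hom_ext
  change assocHom X (Bimod.regular R) Y ≫ tensMap (𝟙 X) (lunitIso Y).hom =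
    tensMap (runitIso X).hom (𝟙 Y)
  have e1 : (lunitIso Y).hom.hom = lunitHom Y := rfl
  have e2 : (runitIso X).hom.hom = runitHom X := rfl
  apply ext₃
  rw [bπ_assocHom_assoc, bπ_tensMap, bπ_tensMap, e1, e2, hom_id, hom_id,
    MonoidalCategory.id_tensorHom, MonoidalCategory.tensorHom_id,
    ← MonoidalCategory.whiskerLeft_comp_assoc, ← comp_whiskerRight_assoc]
  have l1 : bπ (Bimod.regular R) Y ≫ lunitHom Y = Y.actLeft := bπl_lunitHom Y
  have l2 : bπ X (Bimod.regular R) ≫ runitHom X = X.actRight := bπr_runitHom X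
  rw [l1, l2]
  exact (bπ_condition X Y).symm

noncomputable instance : MonoidalCategoryStruct (Bimod R R) where
  tensorObj M N := tensBimod M N
  tensorUnit := Bimod.regular R
  tensorHom f g := tensHom f g
  whiskerLeft M _ _ g := tensHom (𝟙 M) g
  whiskerRight f N := tensHom f (𝟙 N)
  associator M N P := assocIso M N P
  leftUnitor M := lunitIso M
  rightUnitor M := runitIso M

theorem bπ_tensorHom {M M' N N' : Bimod R R} (f : M ⟶ M') (g : N ⟶ N') :
    bπ M N ≫ (f ⊗ₘ g).hom = (f.hom ⊗ₘ g.hom) ≫ bπ M' N' := bπ_tensMap f g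

theorem bπ_associator (M N P : Bimod R R) :
    bπ M N ▷ P.X ≫ bπ (M ⊗ N) P ≫ (α_ M N P).hom.hom =
      (α_ _ _ _).hom ≫ M.X ◁ bπ N P ≫ bπ M (N ⊗ P) := bπ_assocHom M N P

theorem bπ_leftUnitor (M : Bimod R R) : bπ (𝟙_ _) M ≫ (λ_ M).hom.hom = M.actLeft :=
  bπl_lunitHom M

theorem bπ_rightUnitor (M : Bimod R R) : bπ M (𝟙_ _) ≫ (ρ_ M).hom.hom = M.actRight :=
  bπr_runitHom M

/-- The category of `R`-bimodules, with the module tensor product as monoidal product. -/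
noncomputable instance : MonoidalCategory (Bimod R R) :=
  MonoidalCategory.ofTensorHom
    (id_tensorHom_id := fun M N => tensHom_id M N)
    (id_tensorHom := by intros; rfl)
    (tensorHom_id := by intros; rfl)
    (tensorHom_comp_tensorHom := fun f₁ f₂ g₁ g₂ => tensHom_comp f₁ f₂ g₁ g₂)
    (associator_naturality := fun f₁ f₂ f₃ => assoc_natural f₁ f₂ f₃)
    (leftUnitor_naturality := fun f => lunit_natural f)
    (rightUnitor_naturality := fun f => runit_natural f)
    (pentagon := fun W X Y Z => tens_pentagon W X Y Z)
    (triangle := fun X Y => tens_triangle X Y)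

end BimoduleTensor

open MonObj ComonObj

section BaseMaps

variable {C : Type u} [Category.{v} C] [MonoidalCategory C] [SymmetricCategory C]

/-- The source and target maps underlying a (left or right) bialgebroid `A` over `R`: a monoid
morphism `s : R ⟶ A` and a monoid morphism `t : Rᵒᵖ ⟶ A` with commuting ranges. -/
structure BaseMaps (R A : Mon C) where
  /-- the source map -/
  s : R ⟶ A
  /-- the target map -/
  t : R.X ⟶ A.X
  one_t : η[R.X] ≫ t = η[A.X]
  mul_t : (β_ R.X R.X).hom ≫ μ[R.X] ≫ t = (t ⊗ₘ t) ≫ μ[A.X]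
  comm : (s.hom ⊗ₘ t) ≫ μ[A.X] = (s.hom ⊗ₘ t) ≫ (β_ A.X A.X).hom ≫ μ[A.X]

theorem opMul_assoc (X : C) [MonObj X] :
    ((β_ X X).hom ≫ μ) ▷ X ≫ (β_ X X).hom ≫ μ[X] =
      (α_ X X X).hom ≫ X ◁ ((β_ X X).hom ≫ μ) ≫ (β_ X X).hom ≫ μ := by
  rw [BraidedCategory.braiding_naturality_left_assoc,
    BraidedCategory.braiding_naturality_right_assoc]
  have h : X ◁ μ[X] ≫ μ = (α_ _ _ _).inv ≫ μ ▷ X ≫ μ := by simp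
  have y := BraidedCategory.yang_baxter X X X
  simp only [MonoidalCategory.whiskerLeft_comp, comp_whiskerRight, Category.assoc,
    BraidedCategory.braiding_tensor_left_hom, BraidedCategory.braiding_tensor_right_hom, h]
  have y' := y =≫ ((α_ X X X).inv ≫ μ ▷ X ≫ μ)
  simp only [Category.assoc] at y'
  rw [← cancel_epi (α_ X X X).inv]
  simpa using y'.symm

/-- The opposite of a monoid. -/
@[reducible]
def opMonObj (X : C) [MonObj X] : MonObj X where
  one := η[X]
  mul := (β_ X X).hom ≫ μ[X]
  one_mul := by simp
  mul_one := by simp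
  mul_assoc := opMul_assoc X

theorem mul₃ {X Y Z A : C} [MonObj A] (f : X ⟶ A) (g : Y ⟶ A) (h : Z ⟶ A) :
    (((f ⊗ₘ g) ≫ μ) ⊗ₘ h) ≫ μ = (α_ _ _ _).hom ≫ (f ⊗ₘ ((g ⊗ₘ h) ≫ μ)) ≫ μ := by
  have e1 : ((f ⊗ₘ g) ≫ μ) ⊗ₘ h = ((f ⊗ₘ g) ⊗ₘ h) ≫ μ ▷ A := by
    rw [tensorHom_comp_whiskerRight]
  have e2 : f ⊗ₘ ((g ⊗ₘ h) ≫ μ) = (f ⊗ₘ (g ⊗ₘ h)) ≫ A ◁ μ := by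
    rw [tensorHom_comp_whiskerLeft]
  rw [e1, e2, Category.assoc, MonObj.mul_assoc]
  simp

theorem mul₃op {X Y Z A : C} [MonObj A] (f : X ⟶ A) (g : Y ⟶ A) (h : Z ⟶ A) :
    (((f ⊗ₘ g) ≫ (β_ A A).hom ≫ μ) ⊗ₘ h) ≫ (β_ A A).hom ≫ μ =
      (α_ _ _ _).hom ≫ (f ⊗ₘ ((g ⊗ₘ h) ≫ (β_ A A).hom ≫ μ)) ≫ (β_ A A).hom ≫ μ :=
  letI := opMonObj A
  mul₃ f g h

theorem mul_mid {X Y Z A : C} [MonObj A] (f : X ⟶ A) (g : Y ⟶ A) (h : Z ⟶ A)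
    (c : (f ⊗ₘ h) ≫ μ = (f ⊗ₘ h) ≫ (β_ A A).hom ≫ μ) :
    (((f ⊗ₘ g) ≫ μ) ⊗ₘ h) ≫ (β_ A A).hom ≫ μ =
      (α_ _ _ _).hom ≫ (f ⊗ₘ ((g ⊗ₘ h) ≫ (β_ A A).hom ≫ μ)) ≫ μ := by
  have c' : (h ⊗ₘ f) ≫ μ = (β_ _ _).hom ≫ (f ⊗ₘ h) ≫ μ := by
    rw [c, ← BraidedCategory.braiding_naturality_assoc]
    simp
  rw [BraidedCategory.braiding_naturality_assoc, BraidedCategory.braiding_naturality_assoc]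
  have m1 := mul₃ h f g
  have m2 := mul₃ f h g
  rw [c'] at m1
  have m3 : (h ⊗ₘ ((f ⊗ₘ g) ≫ μ)) ≫ μ = (α_ _ _ _).inv ≫ (β_ _ _).hom ▷ Y ≫
      (α_ _ _ _).hom ≫ (f ⊗ₘ ((h ⊗ₘ g) ≫ μ)) ≫ μ := by
    rw [← m2, whiskerRight_comp_tensorHom_assoc, m1, Iso.inv_hom_id_assoc]
  rw [m3]
  simp only [BraidedCategory.braiding_tensor_left_hom, Category.assoc, Iso.hom_inv_id_assoc]
  rw [← comp_whiskerRight_assoc, SymmetricCategory.symmetry, id_whiskerRight, Category.id_comp,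
    Iso.inv_hom_id_assoc, whiskerLeft_comp_tensorHom_assoc]

namespace BaseMaps

variable {R A : Mon C} (b : BaseMaps R A)

theorem mul_t' : μ[R.X] ≫ b.t = (b.t ⊗ₘ b.t) ≫ (β_ A.X A.X).hom ≫ μ[A.X] := by
  rw [BraidedCategory.braiding_naturality_assoc, ← b.mul_t]
  simp

theorem comm' : (b.t ⊗ₘ b.s.hom) ≫ μ[A.X] = (b.t ⊗ₘ b.s.hom) ≫ (β_ A.X A.X).hom ≫ μ[A.X] := by
  rw [BraidedCategory.braiding_naturality_assoc, b.comm,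
    BraidedCategory.braiding_naturality_assoc]
  simp

/-- The bimodule `S`: `r · a · r' = s(r) a s(r')`. -/
def S : Bimod R R where
  X := A.X
  actLeft := b.s.hom ▷ A.X ≫ μ[A.X]
  actRight := A.X ◁ b.s.hom ≫ μ[A.X]
  one_actLeft := by
    rw [← comp_whiskerRight_assoc, IsMonHom.one_hom, MonObj.one_mul]
  left_assoc := by
    rw [← comp_whiskerRight_assoc, IsMonHom.mul_hom]
    simp only [← MonoidalCategory.tensorHom_id, ← MonoidalCategory.id_tensorHom, mul₃,
      MonoidalCategory.tensorHom_comp_tensorHom_assoc, Category.comp_id, Category.id_comp]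
  actRight_one := by
    rw [← MonoidalCategory.whiskerLeft_comp_assoc, IsMonHom.one_hom, MonObj.mul_one]
  right_assoc := by
    rw [← MonoidalCategory.whiskerLeft_comp_assoc, IsMonHom.mul_hom]
    simp only [← MonoidalCategory.tensorHom_id, ← MonoidalCategory.id_tensorHom, mul₃,
      MonoidalCategory.tensorHom_comp_tensorHom_assoc, Category.comp_id, Category.id_comp,
      Iso.inv_hom_id_assoc]
  middle_assoc := by
    simp only [← MonoidalCategory.tensorHom_id, ← MonoidalCategory.id_tensorHom, mul₃,
      MonoidalCategory.tensorHom_comp_tensorHom_assoc, Category.comp_id, Category.id_comp]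

/-- The bimodule `L`: `r · a · r' = s(r) t(r') a`. -/
def L : Bimod R R where
  X := A.X
  actLeft := b.s.hom ▷ A.X ≫ μ[A.X]
  actRight := A.X ◁ b.t ≫ (β_ A.X A.X).hom ≫ μ[A.X]
  one_actLeft := b.S.one_actLeft
  left_assoc := b.S.left_assoc
  actRight_one := by
    rw [← MonoidalCategory.whiskerLeft_comp_assoc, b.one_t]
    simp
  right_assoc := by
    rw [← MonoidalCategory.whiskerLeft_comp_assoc, b.mul_t']
    simp only [← MonoidalCategory.tensorHom_id, ← MonoidalCategory.id_tensorHom, mul₃op,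
      MonoidalCategory.tensorHom_comp_tensorHom_assoc, Category.comp_id, Category.id_comp,
      Iso.inv_hom_id_assoc]
  middle_assoc := by
    simp only [← MonoidalCategory.tensorHom_id, ← MonoidalCategory.id_tensorHom,
      MonoidalCategory.tensorHom_comp_tensorHom_assoc, Category.comp_id, Category.id_comp]
    rw [mul_mid _ _ _ b.comm]

/-- The bimodule `K`: `r · a · r' = a t(r) s(r')`. -/
def K : Bimod R R where
  X := A.X
  actLeft := b.t ▷ A.X ≫ (β_ A.X A.X).hom ≫ μ[A.X]
  actRight := A.X ◁ b.s.hom ≫ μ[A.X]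
  one_actLeft := by
    rw [← comp_whiskerRight_assoc, b.one_t]
    simp
  left_assoc := by
    rw [← comp_whiskerRight_assoc, b.mul_t']
    simp only [← MonoidalCategory.tensorHom_id, ← MonoidalCategory.id_tensorHom, mul₃op,
      MonoidalCategory.tensorHom_comp_tensorHom_assoc, Category.comp_id, Category.id_comp]
  actRight_one := b.S.actRight_one
  right_assoc := b.S.right_assoc
  middle_assoc := by
    simp only [← MonoidalCategory.tensorHom_id, ← MonoidalCategory.id_tensorHom,
      MonoidalCategory.tensorHom_comp_tensorHom_assoc, Category.comp_id, Category.id_comp]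
    have h := @mul_mid _ _ _ _ _ _ _ _ (opMonObj A.X) b.t (𝟙 A.X) b.s.hom
      (by
        change _ ≫ (β_ A.X A.X).hom ≫ μ[A.X] = _ ≫ (β_ A.X A.X).hom ≫ (β_ A.X A.X).hom ≫ μ[A.X]
        rw [SymmetricCategory.symmetry_assoc, ← b.comm'])
    have e : @MonObj.mul _ _ _ A.X (opMonObj A.X) = (β_ A.X A.X).hom ≫ μ[A.X] := rfl
    simp only [e, SymmetricCategory.symmetry_assoc] at h
    exact h

end BaseMaps
end BaseMaps

section Tensor

variable {C : Type u} [Category.{v} C] [MonoidalCategory C] [HasCoequalizers C]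
  [∀ X : C, PreservesColimitsOfShape WalkingParallelPair (tensorLeft X)]
  [∀ X : C, PreservesColimitsOfShape WalkingParallelPair (tensorRight X)]
  {R : Mon C}

/-- The canonical projection `M ⊗ N ⟶ M ⊗_R N`, the coequalizer of the two actions of `R`. -/
noncomputable def toTens (M N : Bimod R R) : M.X ⊗ N.X ⟶ (M ⊗ N).X := bπ M N

instance (M N : Bimod R R) : Epi (toTens M N) := inferInstanceAs (Epi (bπ M N))

instance (Z : C) (M N : Bimod R R) : Epi (Z ◁ toTens M N) := inferInstanceAs (Epi (Z ◁ bπ M N))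

instance (Z : C) (M N : Bimod R R) : Epi (toTens M N ▷ Z) := inferInstanceAs (Epi (bπ M N ▷ Z))

instance (Z W : C) (M N : Bimod R R) : Epi ((toTens M N ▷ Z) ▷ W) :=
  inferInstanceAs (Epi ((bπ M N ▷ Z) ▷ W))

instance (Z W : C) (M N : Bimod R R) : Epi (Z ◁ (W ◁ toTens M N)) :=
  inferInstanceAs (Epi (Z ◁ (W ◁ bπ M N)))

theorem toTens_condition (M N : Bimod R R) :
    M.actRight ▷ N.X ≫ toTens M N = (α_ _ _ _).hom ≫ M.X ◁ N.actLeft ≫ toTens M N :=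
  bπ_condition M N

theorem toTens_actLeft (M N : Bimod R R) :
    R.X ◁ toTens M N ≫ (M ⊗ N).actLeft = (α_ _ _ _).inv ≫ M.actLeft ▷ N.X ≫ toTens M N :=
  bπ_actLeft M N

theorem toTens_actRight (M N : Bimod R R) :
    toTens M N ▷ R.X ≫ (M ⊗ N).actRight = (α_ _ _ _).hom ≫ M.X ◁ N.actRight ≫ toTens M N :=
  bπ_actRight M N

theorem toTens_tensorHom {M M' N N' : Bimod R R} (f : M ⟶ M') (g : N ⟶ N') :
    toTens M N ≫ (f ⊗ₘ g).hom = (f.hom ⊗ₘ g.hom) ≫ toTens M' N' := bπ_tensMap f g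

theorem toTens_whiskerLeft (M : Bimod R R) {N N' : Bimod R R} (g : N ⟶ N') :
    toTens M N ≫ (M ◁ g).hom = M.X ◁ g.hom ≫ toTens M N' := by
  rw [← MonoidalCategory.id_tensorHom, toTens_tensorHom, hom_id, MonoidalCategory.id_tensorHom]

theorem toTens_whiskerRight {M M' : Bimod R R} (f : M ⟶ M') (N : Bimod R R) :
    toTens M N ≫ (f ▷ N).hom = f.hom ▷ N.X ≫ toTens M' N := by
  rw [← MonoidalCategory.tensorHom_id, toTens_tensorHom, hom_id, MonoidalCategory.tensorHom_id]

theorem toTens_associator (M N P : Bimod R R) :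
    toTens M N ▷ P.X ≫ toTens (M ⊗ N) P ≫ (α_ M N P).hom.hom =
      (α_ _ _ _).hom ≫ M.X ◁ toTens N P ≫ toTens M (N ⊗ P) := bπ_assocHom M N P

theorem toTens_leftUnitor (M : Bimod R R) : toTens (𝟙_ _) M ≫ (λ_ M).hom.hom = M.actLeft :=
  bπl_lunitHom M

theorem toTens_rightUnitor (M : Bimod R R) : toTens M (𝟙_ _) ≫ (ρ_ M).hom.hom = M.actRight :=
  bπr_runitHom M

/-- The morphism `R ⟶ M` in `C` underlying a bimodule morphism out of the unit bimodule `R`. -/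
def fromR {M : Bimod R R} (f : 𝟙_ (Bimod R R) ⟶ M) : R.X ⟶ M.X := f.hom

/-- The morphism `M ⟶ R` in `C` underlying a bimodule morphism into the unit bimodule `R`. -/
def toR {M : Bimod R R} (f : M ⟶ 𝟙_ (Bimod R R)) : M.X ⟶ R.X := f.hom

theorem one_mul_fromR (M : Bimod R R) [MonObj M] :
    fromR η[M] ▷ M.X ≫ toTens M M ≫ μ[M].hom = M.actLeft := by
  have e := toTens_whiskerRight η[M] M =≫ μ[M].hom
  rw [Category.assoc, Category.assoc, ← hom_comp, MonObj.one_mul, toTens_leftUnitor] at e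
  exact e.symm

theorem mul_one_fromR (M : Bimod R R) [MonObj M] :
    M.X ◁ fromR η[M] ≫ toTens M M ≫ μ[M].hom = M.actRight := by
  have e := toTens_whiskerLeft M η[M] =≫ μ[M].hom
  rw [Category.assoc, Category.assoc, ← hom_comp, MonObj.mul_one, toTens_rightUnitor] at e
  exact e.symm

/-- The monoid `(M, μ ∘ ⊓(M, M), η ∘ η_R)` in `C` underlying a monoid `M` in the category of
`R`-bimodules. -/
noncomputable def forgetMon (M : Bimod R R) [MonObj M] : Mon C where
  X := M.X
  mon :=
    { one := η[R.X] ≫ fromR η[M]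
      mul := toTens M M ≫ μ[M].hom
      one_mul := by
        rw [comp_whiskerRight, Category.assoc, one_mul_fromR, M.one_actLeft]
      mul_one := by
        rw [MonoidalCategory.whiskerLeft_comp, Category.assoc, mul_one_fromR, M.actRight_one]
      mul_assoc := by
        have h : (μ[M] ▷ M ≫ μ[M]).hom = ((α_ M M M).hom ≫ M ◁ μ[M] ≫ μ[M]).hom := by
          rw [MonObj.mul_assoc]
        have h2 := (toTens M M ▷ M.X ≫ toTens (M ⊗ M) M) ≫= h
        simp only [hom_comp, Category.assoc] at h2
        rw [← Category.assoc (toTens (M ⊗ M) M), toTens_whiskerRight] at h2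
        have h3 := toTens_associator M M M =≫ ((M ◁ μ[M]).hom ≫ μ[M].hom)
        simp only [Category.assoc] at h3
        rw [h3, ← Category.assoc (toTens M (M ⊗ M)), toTens_whiskerLeft] at h2
        simpa using h2 }

end Tensor

section Actions

variable {C : Type u} [Category.{v} C] [MonoidalCategory C] [SymmetricCategory C]
  [HasCoequalizers C]
  [∀ X : C, PreservesColimitsOfShape WalkingParallelPair (tensorLeft X)]
  [∀ X : C, PreservesColimitsOfShape WalkingParallelPair (tensorRight X)]
  {R : Mon C}

/-- For `f : M ⊗ Y ⟶ M'` and `g : N ⊗ Z ⟶ N'` compatible with the inner actions of `R`, the unique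
morphism `(M ⊗_R N) ⊗ (Y ⊗ Z) ⟶ M' ⊗_R N'` induced by `f ⊗ g`. -/
noncomputable def tensActR {M N M' N' : Bimod R R} {Y Z : C} (f : M.X ⊗ Y ⟶ M'.X)
    (g : N.X ⊗ Z ⟶ N'.X)
    (hf : M.actRight ▷ Y ≫ f =
      (α_ _ _ _).hom ≫ M.X ◁ (β_ R.X Y).hom ≫ (α_ _ _ _).inv ≫ f ▷ R.X ≫ M'.actRight)
    (hg : N.actLeft ▷ Z ≫ g = (α_ _ _ _).hom ≫ R.X ◁ g ≫ N'.actLeft) :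
    (M ⊗ N).X ⊗ (Y ⊗ Z) ⟶ (M' ⊗ N').X :=
  bdescR (tensorμ M.X N.X Y Z ≫ (f ⊗ₘ g) ≫ toTens M' N') (by
    have c := toTens_condition M' N'
    have n1 := tensorμ_natural_left M.actRight (𝟙 N.X) Y Z
    have n2 := tensorμ_natural_left (𝟙 M.X) N.actLeft Y Z
    rw [MonoidalCategory.tensorHom_id] at n1
    rw [MonoidalCategory.id_tensorHom] at n2
    rw [← Category.assoc, n1, ← Category.assoc ((M.X ◁ N.actLeft) ▷ _), n2]
    simp only [Category.assoc, MonoidalCategory.tensorHom_comp_tensorHom_assoc, id_whiskerRight,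
      Category.id_comp]
    rw [hf, hg]
    have e1 : ((α_ _ _ _).hom ≫ M.X ◁ (β_ R.X Y).hom ≫ (α_ _ _ _).inv ≫ f ▷ R.X ≫
        M'.actRight) ⊗ₘ g = ((α_ _ _ _).hom ≫ M.X ◁ (β_ R.X Y).hom ≫ (α_ _ _ _).inv) ▷ (N.X ⊗ Z) ≫
          (f ▷ R.X ⊗ₘ g) ≫ M'.actRight ▷ N'.X := by
      rw [tensorHom_comp_whiskerRight, whiskerRight_comp_tensorHom]
      simp only [Category.assoc]
    have e2 : f ⊗ₘ ((α_ _ _ _).hom ≫ R.X ◁ g ≫ N'.actLeft) =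
        (M.X ⊗ Y) ◁ (α_ _ _ _).hom ≫ (f ⊗ₘ R.X ◁ g) ≫ M'.X ◁ N'.actLeft := by
      rw [tensorHom_comp_whiskerLeft, whiskerLeft_comp_tensorHom]
    have e3 : (f ▷ R.X ⊗ₘ g) ≫ (α_ _ _ _).hom = (α_ _ _ _).hom ≫ (f ⊗ₘ R.X ◁ g) := by
      rw [← MonoidalCategory.tensorHom_id, ← MonoidalCategory.id_tensorHom,
        associator_naturality]
    have e4 : tensorμ (M.X ⊗ R.X) N.X Y Z ≫
        ((α_ _ _ _).hom ≫ M.X ◁ (β_ R.X Y).hom ≫ (α_ _ _ _).inv) ▷ (N.X ⊗ Z) ≫ (α_ _ _ _).hom =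
        (α_ _ _ _).hom ▷ (Y ⊗ Z) ≫ tensorμ M.X (R.X ⊗ N.X) Y Z ≫
          (M.X ⊗ Y) ◁ (α_ _ _ _).hom := by
      simp only [tensorμ, BraidedCategory.braiding_tensor_left_hom]
      simp only [comp_whiskerRight, MonoidalCategory.whiskerLeft_comp, Category.assoc,
        MonoidalCategory.tensor_whiskerLeft, MonoidalCategory.whiskerRight_tensor]
      monoidal
    rw [e1, e2]
    simp only [Category.assoc]
    rw [c, ← Category.assoc (_ ⊗ₘ _) (α_ _ _ _).hom, e3]
    have e5 := e4 =≫ ((f ⊗ₘ R.X ◁ g) ≫ M'.X ◁ N'.actLeft ≫ toTens M' N')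
    simp only [Category.assoc] at e5 ⊢
    exact e5)

theorem toTens_tensActR {M N M' N' : Bimod R R} {Y Z : C} (f : M.X ⊗ Y ⟶ M'.X)
    (g : N.X ⊗ Z ⟶ N'.X)
    (hf : M.actRight ▷ Y ≫ f =
      (α_ _ _ _).hom ≫ M.X ◁ (β_ R.X Y).hom ≫ (α_ _ _ _).inv ≫ f ▷ R.X ≫ M'.actRight)
    (hg : N.actLeft ▷ Z ≫ g = (α_ _ _ _).hom ≫ R.X ◁ g ≫ N'.actLeft) :
    toTens M N ▷ (Y ⊗ Z) ≫ tensActR f g hf hg =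
      tensorμ M.X N.X Y Z ≫ (f ⊗ₘ g) ≫ toTens M' N' :=
  bπ_bdescR _ _

/-- For `f : Y ⊗ M ⟶ M'` and `g : Z ⊗ N ⟶ N'` compatible with the inner actions of `R`, the unique
morphism `(Y ⊗ Z) ⊗ (M ⊗_R N) ⟶ M' ⊗_R N'` induced by `f ⊗ g`. -/
noncomputable def tensActL {M N M' N' : Bimod R R} {Y Z : C} (f : Y ⊗ M.X ⟶ M'.X)
    (g : Z ⊗ N.X ⟶ N'.X)
    (hf : Y ◁ M.actRight ≫ f = (α_ _ _ _).inv ≫ f ▷ R.X ≫ M'.actRight)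
    (hg : Z ◁ N.actLeft ≫ g =
      (α_ _ _ _).inv ≫ (β_ Z R.X).hom ▷ N.X ≫ (α_ _ _ _).hom ≫ R.X ◁ g ≫ N'.actLeft) :
    (Y ⊗ Z) ⊗ (M ⊗ N).X ⟶ (M' ⊗ N').X :=
  bdescL (tensorμ Y Z M.X N.X ≫ (f ⊗ₘ g) ≫ toTens M' N') (by
    have c := toTens_condition M' N'
    have n1 := tensorμ_natural_right Y Z M.actRight (𝟙 N.X)
    have n2 := tensorμ_natural_right Y Z (𝟙 M.X) N.actLeft
    rw [MonoidalCategory.tensorHom_id] at n1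
    rw [MonoidalCategory.id_tensorHom] at n2
    rw [← Category.assoc, n1, ← Category.assoc (_ ◁ (M.X ◁ N.actLeft)), n2]
    simp only [Category.assoc, MonoidalCategory.tensorHom_comp_tensorHom_assoc,
      MonoidalCategory.whiskerLeft_id, Category.id_comp]
    rw [hf, hg]
    have e1 : ((α_ _ _ _).inv ≫ f ▷ R.X ≫ M'.actRight) ⊗ₘ g =
        (α_ _ _ _).inv ▷ (Z ⊗ N.X) ≫ (f ▷ R.X ⊗ₘ g) ≫ M'.actRight ▷ N'.X := by
      rw [tensorHom_comp_whiskerRight, whiskerRight_comp_tensorHom]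
    have e2 : f ⊗ₘ ((α_ _ _ _).inv ≫ (β_ Z R.X).hom ▷ N.X ≫ (α_ _ _ _).hom ≫ R.X ◁ g ≫
        N'.actLeft) = (Y ⊗ M.X) ◁ ((α_ _ _ _).inv ≫ (β_ Z R.X).hom ▷ N.X ≫ (α_ _ _ _).hom) ≫
          (f ⊗ₘ R.X ◁ g) ≫ M'.X ◁ N'.actLeft := by
      rw [tensorHom_comp_whiskerLeft, whiskerLeft_comp_tensorHom]
      simp only [Category.assoc]
    have e3 : (f ▷ R.X ⊗ₘ g) ≫ (α_ _ _ _).hom = (α_ _ _ _).hom ≫ (f ⊗ₘ R.X ◁ g) := by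
      rw [← MonoidalCategory.tensorHom_id, ← MonoidalCategory.id_tensorHom,
        associator_naturality]
    have e4 : tensorμ Y Z (M.X ⊗ R.X) N.X ≫ (α_ _ _ _).inv ▷ (Z ⊗ N.X) ≫ (α_ _ _ _).hom =
        (Y ⊗ Z) ◁ (α_ _ _ _).hom ≫ tensorμ Y Z M.X (R.X ⊗ N.X) ≫
          (Y ⊗ M.X) ◁ ((α_ _ _ _).inv ≫ (β_ Z R.X).hom ▷ N.X ≫ (α_ _ _ _).hom) := by
      simp only [tensorμ, BraidedCategory.braiding_tensor_right_hom]
      simp only [comp_whiskerRight, MonoidalCategory.whiskerLeft_comp, Category.assoc,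
        MonoidalCategory.tensor_whiskerLeft, MonoidalCategory.whiskerRight_tensor]
      monoidal
    rw [e1, e2]
    simp only [Category.assoc]
    rw [c, ← Category.assoc (_ ⊗ₘ _) (α_ _ _ _).hom, e3]
    have e5 := e4 =≫ ((f ⊗ₘ R.X ◁ g) ≫ M'.X ◁ N'.actLeft ≫ toTens M' N')
    simp only [Category.assoc] at e5 ⊢
    exact e5)

theorem toTens_tensActL {M N M' N' : Bimod R R} {Y Z : C} (f : Y ⊗ M.X ⟶ M'.X)
    (g : Z ⊗ N.X ⟶ N'.X)
    (hf : Y ◁ M.actRight ≫ f = (α_ _ _ _).inv ≫ f ▷ R.X ≫ M'.actRight)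
    (hg : Z ◁ N.actLeft ≫ g =
      (α_ _ _ _).inv ≫ (β_ Z R.X).hom ▷ N.X ≫ (α_ _ _ _).hom ≫ R.X ◁ g ≫ N'.actLeft) :
    (Y ⊗ Z) ◁ toTens M N ≫ tensActL f g hf hg =
      tensorμ Y Z M.X N.X ≫ (f ⊗ₘ g) ≫ toTens M' N' :=
  bπ_bdescL _ _

end Actions

section Bialgebroid

variable {C : Type u} [Category.{v} C] [MonoidalCategory C]

theorem mul_assoc' (X : C) [MonObj X] :
    μ[X] ▷ X ≫ μ[X] = (α_ _ _ _).hom ≫ X ◁ μ[X] ≫ μ[X] := MonObj.mul_assoc X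

variable [SymmetricCategory C]

namespace BaseMaps

variable {R A : Mon C} (b : BaseMaps R A)

theorem S_actLeft : b.S.actLeft = b.s.hom ▷ A.X ≫ μ[A.X] := rfl
theorem S_actRight : b.S.actRight = A.X ◁ b.s.hom ≫ μ[A.X] := rfl
theorem L_actLeft : b.L.actLeft = b.s.hom ▷ A.X ≫ μ[A.X] := rfl
theorem L_actRight : b.L.actRight = A.X ◁ b.t ≫ (β_ A.X A.X).hom ≫ μ[A.X] := rfl
theorem K_actLeft : b.K.actLeft = b.t ▷ A.X ≫ (β_ A.X A.X).hom ≫ μ[A.X] := rfl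
theorem K_actRight : b.K.actRight = A.X ◁ b.s.hom ≫ μ[A.X] := rfl

theorem S_mul_left : (R.X ◁ μ[A.X]) ≫ b.s.hom ▷ A.X ≫ μ[A.X] =
    (α_ _ _ _).inv ≫ (b.s.hom ▷ A.X ≫ μ[A.X]) ▷ A.X ≫ μ[A.X] := by
  rw [comp_whiskerRight, Category.assoc, mul_assoc', whisker_exchange_assoc]
  simp

theorem S_mul_right : (μ[A.X] ▷ R.X) ≫ A.X ◁ b.s.hom ≫ μ[A.X] =
    (α_ _ _ _).hom ≫ A.X ◁ (A.X ◁ b.s.hom ≫ μ[A.X]) ≫ μ[A.X] := by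
  rw [← whisker_exchange_assoc, mul_assoc']
  simp

theorem S_mul_mid : (A.X ◁ b.s.hom ≫ μ[A.X]) ▷ A.X ≫ μ[A.X] =
    (α_ _ _ _).hom ≫ A.X ◁ (b.s.hom ▷ A.X ≫ μ[A.X]) ≫ μ[A.X] := by
  rw [comp_whiskerRight, Category.assoc, mul_assoc']
  simp

theorem S_mul_left' : (b.s.hom ▷ A.X ≫ μ[A.X]) ▷ A.X ≫ μ[A.X] =
    (α_ _ _ _).hom ≫ R.X ◁ μ[A.X] ≫ b.s.hom ▷ A.X ≫ μ[A.X] := by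
  rw [S_mul_left, Iso.hom_inv_id_assoc]

theorem S_mul_right' : A.X ◁ (A.X ◁ b.s.hom ≫ μ[A.X]) ≫ μ[A.X] =
    (α_ _ _ _).inv ≫ μ[A.X] ▷ R.X ≫ A.X ◁ b.s.hom ≫ μ[A.X] := by
  rw [S_mul_right, Iso.inv_hom_id_assoc]

theorem L_mul_right : (A.X ◁ b.t ≫ (β_ A.X A.X).hom ≫ μ[A.X]) ▷ A.X ≫ μ[A.X] =
    (α_ _ _ _).hom ≫ A.X ◁ (β_ R.X A.X).hom ≫ (α_ _ _ _).inv ≫ μ[A.X] ▷ R.X ≫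
      A.X ◁ b.t ≫ (β_ A.X A.X).hom ≫ μ[A.X] := by
  rw [BraidedCategory.braiding_naturality_right_assoc,
    BraidedCategory.braiding_naturality_left_assoc, BraidedCategory.braiding_tensor_left_hom]
  simp only [Category.assoc, Iso.inv_hom_id_assoc]
  rw [← MonoidalCategory.whiskerLeft_comp_assoc A.X (β_ R.X A.X).hom,
    SymmetricCategory.symmetry, MonoidalCategory.whiskerLeft_id, Category.id_comp,
    Iso.hom_inv_id_assoc, whisker_exchange_assoc]
  simp

theorem K_mul_left : A.X ◁ (b.t ▷ A.X ≫ (β_ A.X A.X).hom ≫ μ[A.X]) ≫ μ[A.X] =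
    (α_ _ _ _).inv ≫ (β_ A.X R.X).hom ▷ A.X ≫ (α_ _ _ _).hom ≫ R.X ◁ μ[A.X] ≫
      b.t ▷ A.X ≫ (β_ A.X A.X).hom ≫ μ[A.X] := by
  rw [BraidedCategory.braiding_naturality_left_assoc,
    BraidedCategory.braiding_naturality_right_assoc, BraidedCategory.braiding_tensor_right_hom]
  simp only [Category.assoc, Iso.hom_inv_id_assoc]
  rw [← comp_whiskerRight_assoc (β_ A.X R.X).hom,
    SymmetricCategory.symmetry, id_whiskerRight, Category.id_comp,
    Iso.inv_hom_id_assoc, ← whisker_exchange_assoc]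
  simp

variable [HasCoequalizers C]
  [∀ X : C, PreservesColimitsOfShape WalkingParallelPair (tensorLeft X)]
  [∀ X : C, PreservesColimitsOfShape WalkingParallelPair (tensorRight X)]

/-- The unit of the monoid `S`. -/
def unitS : 𝟙_ (Bimod R R) ⟶ b.S where
  hom := b.s.hom
  left_act_hom := by
    change μ[R.X] ≫ b.s.hom = R.X ◁ b.s.hom ≫ b.s.hom ▷ A.X ≫ μ[A.X]
    rw [IsMonHom.mul_hom, MonoidalCategory.tensorHom_def', Category.assoc]
  right_act_hom := by
    change μ[R.X] ≫ b.s.hom = b.s.hom ▷ R.X ≫ A.X ◁ b.s.hom ≫ μ[A.X]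
    rw [IsMonHom.mul_hom, MonoidalCategory.tensorHom_def, Category.assoc]

/-- The morphism `S ⊗_R S ⟶ S` in `C` induced by the multiplication of `A`. -/
noncomputable def mulSHom : (b.S ⊗ b.S).X ⟶ b.S.X :=
  bdesc (M := b.S) (N := b.S) μ[A.X] b.S_mul_mid

theorem toTens_mulSHom : toTens b.S b.S ≫ b.mulSHom = μ[A.X] := bπ_bdesc _ _

/-- The multiplication of the monoid `S`. -/
noncomputable def mulS : b.S ⊗ b.S ⟶ b.S where
  hom := b.mulSHom
  left_act_hom := by
    have h := b.S_mul_left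
    rw [← cancel_epi (R.X ◁ toTens b.S b.S), ← Category.assoc, toTens_actLeft,
      ← MonoidalCategory.whiskerLeft_comp_assoc, toTens_mulSHom]
    simp only [Category.assoc]
    rw [toTens_mulSHom]
    exact h.symm
  right_act_hom := by
    have h := b.S_mul_right
    rw [← cancel_epi (toTens b.S b.S ▷ R.X), ← Category.assoc, toTens_actRight,
      ← comp_whiskerRight_assoc, toTens_mulSHom]
    simp only [Category.assoc]
    rw [toTens_mulSHom]
    exact h.symm

theorem toTens_mulS : toTens b.S b.S ≫ b.mulS.hom = μ[A.X] := b.toTens_mulSHom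

/-- The monoid `S` in the category of `R`-bimodules, with multiplication induced by that of `A` and
unit `s`. -/
noncomputable instance : MonObj b.S where
  one := b.unitS
  mul := b.mulS
  one_mul := by
    apply Bimod.hom_ext
    rw [← cancel_epi (toTens (𝟙_ (Bimod R R)) b.S), hom_comp, ← Category.assoc,
      toTens_whiskerRight, Category.assoc, toTens_mulS, toTens_leftUnitor]
    rfl
  mul_one := by
    apply Bimod.hom_ext
    rw [← cancel_epi (toTens b.S (𝟙_ (Bimod R R))), hom_comp, ← Category.assoc,
      toTens_whiskerLeft, Category.assoc, toTens_mulS, toTens_rightUnitor]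
    rfl
  mul_assoc := by
    let m : b.S.X ⊗ b.S.X ⟶ b.S.X := μ[A.X]
    have e : toTens b.S b.S ≫ b.mulS.hom = m := b.toTens_mulS
    apply Bimod.hom_ext
    rw [hom_comp, hom_comp, hom_comp, ← cancel_epi (toTens (b.S ⊗ b.S) b.S),
      ← cancel_epi (toTens b.S b.S ▷ b.S.X), ← Category.assoc (toTens (b.S ⊗ b.S) b.S),
      toTens_whiskerRight, Category.assoc, e, ← comp_whiskerRight_assoc, e]
    have h := toTens_associator b.S b.S b.S =≫ ((b.S ◁ b.mulS).hom ≫ b.mulS.hom)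
    simp only [Category.assoc] at h
    rw [h, ← Category.assoc (toTens b.S (b.S ⊗ b.S)), toTens_whiskerLeft, Category.assoc,
      e, ← MonoidalCategory.whiskerLeft_comp_assoc, e]
    exact mul_assoc' A.X

/-- The right action of `A ⊗ A` on `L ⊗_R L` by factorwise multiplication. -/
noncomputable def rhoLL : (b.L ⊗ b.L).X ⊗ (A.X ⊗ A.X) ⟶ (b.L ⊗ b.L).X :=
  tensActR (M := b.L) (N := b.L) (M' := b.L) (N' := b.L) μ[A.X] μ[A.X] b.L_mul_right b.S_mul_left'

/-- The morphism `rhoLL`, regarded as a morphism into `L ⊗_R S`; the objects of `C` underlying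
`L ⊗_R L` and `L ⊗_R S` are coequalizers of the same pair. -/
noncomputable def rhoLS : (b.L ⊗ b.L).X ⊗ (A.X ⊗ A.X) ⟶ (b.L ⊗ b.S).X :=
  tensActR (M := b.L) (N := b.L) (M' := b.L) (N' := b.S) μ[A.X] μ[A.X] b.L_mul_right b.S_mul_left'

/-- The left action of `A ⊗ A` on `K ⊗_R K` by factorwise multiplication. -/
noncomputable def lamKK : (A.X ⊗ A.X) ⊗ (b.K ⊗ b.K).X ⟶ (b.K ⊗ b.K).X :=
  tensActL (M := b.K) (N := b.K) (M' := b.K) (N' := b.K) μ[A.X] μ[A.X] b.S_mul_right' b.K_mul_left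

/-- The projection `A ⊗ A ⟶ L ⊗_R L`. -/
noncomputable def piLL : A.X ⊗ A.X ⟶ (b.L ⊗ b.L).X := toTens b.L b.L

/-- The projection `A ⊗ A ⟶ K ⊗_R K`. -/
noncomputable def piKK : A.X ⊗ A.X ⟶ (b.K ⊗ b.K).X := toTens b.K b.K

instance (Z W : C) : Epi ((b.piLL ▷ Z) ▷ W) := inferInstanceAs (Epi ((toTens _ _ ▷ Z) ▷ W))

instance (Z W : C) : Epi (Z ◁ W ◁ b.piKK) := inferInstanceAs (Epi (Z ◁ W ◁ toTens _ _))

theorem piLL_rhoLL : b.piLL ▷ (A.X ⊗ A.X) ≫ b.rhoLL = μ[A.X ⊗ A.X] ≫ b.piLL := by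
  rw [MonObj.tensorObj.mul_def, Category.assoc]
  exact toTens_tensActR (M := b.L) (N := b.L) (M' := b.L) (N' := b.L) _ _ _ _

theorem piKK_lamKK : (A.X ⊗ A.X) ◁ b.piKK ≫ b.lamKK = μ[A.X ⊗ A.X] ≫ b.piKK := by
  rw [MonObj.tensorObj.mul_def, Category.assoc]
  exact toTens_tensActL (M := b.K) (N := b.K) (M' := b.K) (N' := b.K) _ _ _ _

theorem rhoLL_assoc : b.rhoLL ▷ (A.X ⊗ A.X) ≫ b.rhoLL =
    (α_ _ _ _).hom ≫ (b.L ⊗ b.L).X ◁ μ[A.X ⊗ A.X] ≫ b.rhoLL := by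
  rw [← cancel_epi ((b.piLL ▷ (A.X ⊗ A.X)) ▷ (A.X ⊗ A.X)), ← comp_whiskerRight_assoc,
    piLL_rhoLL, comp_whiskerRight_assoc, piLL_rhoLL, associator_naturality_left_assoc,
    ← whisker_exchange_assoc, piLL_rhoLL, ← Category.assoc, mul_assoc']
  simp only [Category.assoc]

theorem lamKK_assoc : (A.X ⊗ A.X) ◁ b.lamKK ≫ b.lamKK =
    (α_ _ _ _).inv ≫ μ[A.X ⊗ A.X] ▷ (b.K ⊗ b.K).X ≫ b.lamKK := by
  rw [← cancel_epi ((A.X ⊗ A.X) ◁ (A.X ⊗ A.X) ◁ b.piKK),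
    ← MonoidalCategory.whiskerLeft_comp_assoc,
    piKK_lamKK, MonoidalCategory.whiskerLeft_comp_assoc, piKK_lamKK,
    associator_inv_naturality_right_assoc,
    whisker_exchange_assoc, piKK_lamKK, ← Category.assoc, ← Category.assoc _ μ[A.X ⊗ A.X],
    mul_assoc']
  simp

end BaseMaps
end Bialgebroid

section Insert

variable {C : Type u} [Category.{v} C] [MonoidalCategory C] [SymmetricCategory C]

theorem insert_left_left {X A : C} [MonObj A] (f : X ⟶ A) :
    ((ρ_ X).inv ≫ (f ⊗ₘ η[A])) ▷ (A ⊗ A) ≫ μ[A ⊗ A] =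
      (α_ _ _ _).inv ≫ (f ▷ A ≫ μ[A]) ▷ A := by
  rw [MonObj.tensorObj.mul_def, comp_whiskerRight, Category.assoc,
    ← Category.assoc ((f ⊗ₘ η) ▷ (A ⊗ A)), tensorμ_natural_left, Category.assoc,
    MonoidalCategory.tensorHom_comp_tensorHom, MonObj.one_mul, tensorμ,
    braiding_tensorUnit_left, MonoidalCategory.tensorHom_def']
  simp only [comp_whiskerRight, MonoidalCategory.whiskerLeft_comp, Category.assoc,
        MonoidalCategory.tensor_whiskerLeft, MonoidalCategory.whiskerRight_tensor]
  monoidal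

theorem insert_left_right {X A : C} [MonObj A] (f : X ⟶ A) :
    ((λ_ X).inv ≫ (η[A] ⊗ₘ f)) ▷ (A ⊗ A) ≫ μ[A ⊗ A] =
      (α_ _ _ _).inv ≫ (β_ X A).hom ▷ A ≫ (α_ _ _ _).hom ≫ A ◁ (f ▷ A ≫ μ[A]) := by
  rw [MonObj.tensorObj.mul_def, comp_whiskerRight, Category.assoc,
    ← Category.assoc ((η ⊗ₘ f) ▷ (A ⊗ A)), tensorμ_natural_left, Category.assoc,
    MonoidalCategory.tensorHom_comp_tensorHom, MonObj.one_mul, tensorμ,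
    MonoidalCategory.tensorHom_def]
  simp only [comp_whiskerRight, MonoidalCategory.whiskerLeft_comp, Category.assoc,
        MonoidalCategory.tensor_whiskerLeft, MonoidalCategory.whiskerRight_tensor]
  monoidal

theorem insert_right_left {X A : C} [MonObj A] (f : X ⟶ A) :
    (A ⊗ A) ◁ ((ρ_ X).inv ≫ (f ⊗ₘ η[A])) ≫ μ[A ⊗ A] =
      (α_ _ _ _).hom ≫ A ◁ (β_ A X).hom ≫ (α_ _ _ _).inv ≫ (A ◁ f ≫ μ[A]) ▷ A := by
  rw [MonObj.tensorObj.mul_def, MonoidalCategory.whiskerLeft_comp, Category.assoc,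
    ← Category.assoc ((A ⊗ A) ◁ (f ⊗ₘ η)), tensorμ_natural_right, Category.assoc,
    MonoidalCategory.tensorHom_comp_tensorHom, MonObj.mul_one, tensorμ,
    MonoidalCategory.tensorHom_def']
  simp only [comp_whiskerRight, MonoidalCategory.whiskerLeft_comp, Category.assoc,
        MonoidalCategory.tensor_whiskerLeft, MonoidalCategory.whiskerRight_tensor]
  monoidal

theorem insert_right_right {X A : C} [MonObj A] (f : X ⟶ A) :
    (A ⊗ A) ◁ ((λ_ X).inv ≫ (η[A] ⊗ₘ f)) ≫ μ[A ⊗ A] =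
      (α_ _ _ _).hom ≫ A ◁ (A ◁ f ≫ μ[A]) := by
  rw [MonObj.tensorObj.mul_def, MonoidalCategory.whiskerLeft_comp, Category.assoc,
    ← Category.assoc ((A ⊗ A) ◁ (η ⊗ₘ f)), tensorμ_natural_right, Category.assoc,
    MonoidalCategory.tensorHom_comp_tensorHom, MonObj.mul_one, tensorμ,
    braiding_tensorUnit_right, MonoidalCategory.tensorHom_def]
  simp only [comp_whiskerRight, MonoidalCategory.whiskerLeft_comp, Category.assoc,
        MonoidalCategory.tensor_whiskerLeft, MonoidalCategory.whiskerRight_tensor]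
  monoidal

end Insert

section Axioms

variable {C : Type u} [Category.{v} C] [MonoidalCategory C] [SymmetricCategory C]
  [HasCoequalizers C]
  [∀ X : C, PreservesColimitsOfShape WalkingParallelPair (tensorLeft X)]
  [∀ X : C, PreservesColimitsOfShape WalkingParallelPair (tensorRight X)]

namespace BaseMaps

variable {R A : Mon C} (b : BaseMaps R A)

/-- The comultiplication of the comonoid `L`, as a morphism of `C`. -/
noncomputable def comulL [ComonObj b.L] : A.X ⟶ (b.L ⊗ b.L).X := Δ[b.L].hom

/-- The counit of the comonoid `L`, as a morphism of `C`. -/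
noncomputable def counitL [ComonObj b.L] : A.X ⟶ R.X := toR ε[b.L]

/-- The comultiplication of the comonoid `K`, as a morphism of `C`. -/
noncomputable def comulK [ComonObj b.K] : A.X ⟶ (b.K ⊗ b.K).X := Δ[b.K].hom

/-- The counit of the comonoid `K`, as a morphism of `C`. -/
noncomputable def counitK [ComonObj b.K] : A.X ⟶ R.X := toR ε[b.K]

/-- The condition `a₁ t(r) ⊗ a₂ = a₁ ⊗ a₂ s(r)` on the comultiplication of `L`. -/
def LeftTakeuchi [ComonObj b.L] : Prop :=
  (b.comulL ⊗ₘ ((ρ_ R.X).inv ≫ (b.t ⊗ₘ η[A.X]))) ≫ b.rhoLL =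
    (b.comulL ⊗ₘ ((λ_ R.X).inv ≫ (η[A.X] ⊗ₘ b.s.hom))) ≫ b.rhoLL

/-- The condition `a₁ ⊗ t(r) a₂ = s(r) a₁ ⊗ a₂` on the comultiplication of `K`. -/
def RightTakeuchi [ComonObj b.K] : Prop :=
  (((λ_ R.X).inv ≫ (η[A.X] ⊗ₘ b.t)) ⊗ₘ b.comulK) ≫ b.lamKK =
    (((ρ_ R.X).inv ≫ (b.s.hom ⊗ₘ η[A.X])) ⊗ₘ b.comulK) ≫ b.lamKK

variable {b}

theorem lamM_aux [ComonObj b.L] (u : R.X ⟶ A.X ⊗ A.X) :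
    A.X ◁ (u ▷ (A.X ⊗ A.X) ≫ μ[A.X ⊗ A.X]) ≫ b.comulL ▷ (A.X ⊗ A.X) ≫ b.rhoLL =
      (α_ _ _ _).inv ≫ ((b.comulL ⊗ₘ u) ≫ b.rhoLL) ▷ (A.X ⊗ A.X) ≫ b.rhoLL := by
  rw [comp_whiskerRight, Category.assoc, b.rhoLL_assoc, whisker_exchange_assoc]
  simp [MonoidalCategory.tensorHom_def]

/-- The left action of `A` on `L ⊗_R L`, `a · (x ⊗ y) = a₁ x ⊗ a₂ y`; it is well defined by the
Takeuchi condition. -/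
noncomputable def lamM [ComonObj b.L] (h : b.LeftTakeuchi) :
    A.X ⊗ (b.L ⊗ b.L).X ⟶ (b.L ⊗ b.L).X :=
  bdescL (M := b.L) (N := b.L) (b.comulL ▷ (A.X ⊗ A.X) ≫ b.rhoLL) (by
    have e1 : (A.X ◁ b.t ≫ (β_ A.X A.X).hom ≫ μ[A.X]) ▷ A.X =
        (β_ A.X R.X).hom ▷ A.X ≫ (α_ _ _ _).hom ≫
          ((ρ_ R.X).inv ≫ (b.t ⊗ₘ η[A.X])) ▷ (A.X ⊗ A.X) ≫ μ[A.X ⊗ A.X] := by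
      rw [insert_left_left, BraidedCategory.braiding_naturality_right_assoc]
      simp
    have e2 : (α_ _ _ _).hom ≫ A.X ◁ (b.s.hom ▷ A.X ≫ μ[A.X]) =
        (β_ A.X R.X).hom ▷ A.X ≫ (α_ _ _ _).hom ≫
          ((λ_ R.X).inv ≫ (η[A.X] ⊗ₘ b.s.hom)) ▷ (A.X ⊗ A.X) ≫ μ[A.X ⊗ A.X] := by
      rw [insert_left_right, Iso.hom_inv_id_assoc, ← comp_whiskerRight_assoc,
        SymmetricCategory.symmetry, id_whiskerRight, Category.id_comp]
    have key : A.X ◁ ((A.X ◁ b.t ≫ (β_ A.X A.X).hom ≫ μ[A.X]) ▷ A.X) ≫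
        b.comulL ▷ (A.X ⊗ A.X) ≫ b.rhoLL =
      A.X ◁ ((α_ _ _ _).hom ≫ A.X ◁ (b.s.hom ▷ A.X ≫ μ[A.X])) ≫
        b.comulL ▷ (A.X ⊗ A.X) ≫ b.rhoLL := by
      rw [e1, e2]
      simp only [MonoidalCategory.whiskerLeft_comp, Category.assoc]
      rw [← MonoidalCategory.whiskerLeft_comp_assoc A.X (_ ▷ _) μ[A.X ⊗ A.X], lamM_aux, h,
        ← lamM_aux, MonoidalCategory.whiskerLeft_comp_assoc]
    rw [MonoidalCategory.whiskerLeft_comp, Category.assoc] at key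
    exact key)

theorem rhoN_aux [ComonObj b.K] (u : R.X ⟶ A.X ⊗ A.X) :
    ((A.X ⊗ A.X) ◁ u ≫ μ[A.X ⊗ A.X]) ▷ A.X ≫ (A.X ⊗ A.X) ◁ b.comulK ≫ b.lamKK =
      (α_ _ _ _).hom ≫ (A.X ⊗ A.X) ◁ ((u ⊗ₘ b.comulK) ≫ b.lamKK) ≫ b.lamKK := by
  rw [MonoidalCategory.whiskerLeft_comp, Category.assoc, b.lamKK_assoc, ← whisker_exchange_assoc]
  simp [MonoidalCategory.tensorHom_def']

/-- The right action of `A` on `K ⊗_R K`, `(x ⊗ y) · a = x a₁ ⊗ y a₂`; it is well defined by the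
Takeuchi condition. -/
noncomputable def rhoN [ComonObj b.K] (h : b.RightTakeuchi) :
    (b.K ⊗ b.K).X ⊗ A.X ⟶ (b.K ⊗ b.K).X :=
  bdescR (M := b.K) (N := b.K) ((A.X ⊗ A.X) ◁ b.comulK ≫ b.lamKK) (by
    have e1 : (A.X ◁ b.s.hom ≫ μ[A.X]) ▷ A.X =
        (α_ _ _ _).hom ≫ A.X ◁ (β_ R.X A.X).hom ≫ (α_ _ _ _).inv ≫
          (A.X ⊗ A.X) ◁ ((ρ_ R.X).inv ≫ (b.s.hom ⊗ₘ η[A.X])) ≫ μ[A.X ⊗ A.X] := by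
      rw [insert_right_left, Iso.inv_hom_id_assoc, ← MonoidalCategory.whiskerLeft_comp_assoc A.X,
        SymmetricCategory.symmetry, MonoidalCategory.whiskerLeft_id, Category.id_comp,
        Iso.hom_inv_id_assoc]
    have e2 : (α_ _ _ _).hom ≫ A.X ◁ (b.t ▷ A.X ≫ (β_ A.X A.X).hom ≫ μ[A.X]) =
        (α_ _ _ _).hom ≫ A.X ◁ (β_ R.X A.X).hom ≫ (α_ _ _ _).inv ≫
          (A.X ⊗ A.X) ◁ ((λ_ R.X).inv ≫ (η[A.X] ⊗ₘ b.t)) ≫ μ[A.X ⊗ A.X] := by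
      rw [insert_right_right, BraidedCategory.braiding_naturality_left_assoc]
      simp
    have key : ((A.X ◁ b.s.hom ≫ μ[A.X]) ▷ A.X) ▷ A.X ≫
        (A.X ⊗ A.X) ◁ b.comulK ≫ b.lamKK =
      ((α_ _ _ _).hom ≫ A.X ◁ (b.t ▷ A.X ≫ (β_ A.X A.X).hom ≫ μ[A.X])) ▷ A.X ≫
        (A.X ⊗ A.X) ◁ b.comulK ≫ b.lamKK := by
      rw [e1, e2]
      simp only [comp_whiskerRight _ _ A.X, Category.assoc]
      rw [← comp_whiskerRight_assoc (_ ◁ _) μ[A.X ⊗ A.X], rhoN_aux, ← h,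
        ← rhoN_aux, comp_whiskerRight_assoc]
    rw [comp_whiskerRight (α_ A.X R.X A.X).hom, Category.assoc] at key
    exact key)

theorem piKK_rhoN [ComonObj b.K] (h : b.RightTakeuchi) :
    b.piKK ▷ A.X ≫ rhoN h = (A.X ⊗ A.X) ◁ b.comulK ≫ b.lamKK := bπ_bdescR _ _

theorem piLL_lamM [ComonObj b.L] (h : b.LeftTakeuchi) :
    A.X ◁ b.piLL ≫ lamM h = b.comulL ▷ (A.X ⊗ A.X) ≫ b.rhoLL := bπ_bdescL _ _

variable (b)

/-- The axioms of a left bialgebroid, for source and target maps `s`, `t` and a comonoid structure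
on the bimodule `L`. -/
structure IsLeftBialgebroid [ComonObj b.L] : Prop where
  takeuchi : b.LeftTakeuchi
  one_comul : η[A.X] ≫ b.comulL = (λ_ (𝟙_ C)).inv ≫ (η[A.X] ⊗ₘ η[A.X]) ≫ b.piLL
  mul_comul : μ[A.X] ≫ b.comulL = A.X ◁ b.comulL ≫ lamM takeuchi
  one_counit : η[A.X] ≫ b.counitL = η[R.X]
  mul_counit_s : A.X ◁ (b.counitL ≫ b.s.hom) ≫ μ[A.X] ≫ b.counitL = μ[A.X] ≫ b.counitL
  mul_counit_t : A.X ◁ (b.counitL ≫ b.t) ≫ μ[A.X] ≫ b.counitL = μ[A.X] ≫ b.counitL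

/-- The axioms of a right bialgebroid, for source and target maps `s`, `t` and a comonoid structure
on the bimodule `K`. -/
structure IsRightBialgebroid [ComonObj b.K] : Prop where
  takeuchi : b.RightTakeuchi
  one_comul : η[A.X] ≫ b.comulK = (λ_ (𝟙_ C)).inv ≫ (η[A.X] ⊗ₘ η[A.X]) ≫ b.piKK
  mul_comul : μ[A.X] ≫ b.comulK = b.comulK ▷ A.X ≫ rhoN takeuchi
  one_counit : η[A.X] ≫ b.counitK = η[R.X]
  mul_counit_s : (b.counitK ≫ b.s.hom) ▷ A.X ≫ μ[A.X] ≫ b.counitK = μ[A.X] ≫ b.counitK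
  mul_counit_t : (b.counitK ≫ b.t) ▷ A.X ≫ μ[A.X] ≫ b.counitK = μ[A.X] ≫ b.counitK

end BaseMaps
end Axioms

section Entwining

variable {D : Type u} [Category.{v} D] [MonoidalCategory D]

/-- A left entwining structure: a monoid `S`, a comonoid `L` and a compatible `ψ : S ⊗ L ⟶ L ⊗ S`. -/
structure IsLeftEntwining {S L : D} [MonObj S] [ComonObj L] (ψ : S ⊗ L ⟶ L ⊗ S) : Prop where
  one : η[S] ▷ L ≫ ψ = (λ_ L).hom ≫ (ρ_ L).inv ≫ L ◁ η[S]
  counit : ψ ≫ ε[L] ▷ S = S ◁ ε[L] ≫ (ρ_ S).hom ≫ (λ_ S).inv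
  mul : μ[S] ▷ L ≫ ψ = (α_ S S L).hom ≫ S ◁ ψ ≫ (α_ S L S).inv ≫ ψ ▷ S ≫ (α_ L S S).hom ≫ L ◁ μ[S]
  comul : ψ ≫ Δ[L] ▷ S = S ◁ Δ[L] ≫ (α_ S L L).inv ≫ ψ ▷ L ≫ (α_ L S L).hom ≫ L ◁ ψ ≫
    (α_ L L S).inv

/-- A right entwining structure: a monoid `L`, a comonoid `S` and a compatible
`ψ : S ⊗ L ⟶ L ⊗ S`. -/
structure IsRightEntwining {S L : D} [ComonObj S] [MonObj L] (ψ : S ⊗ L ⟶ L ⊗ S) : Prop where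
  one : S ◁ η[L] ≫ ψ = (ρ_ S).hom ≫ (λ_ S).inv ≫ η[L] ▷ S
  counit : ψ ≫ L ◁ ε[S] = ε[S] ▷ L ≫ (λ_ L).hom ≫ (ρ_ L).inv
  mul : S ◁ μ[L] ≫ ψ = (α_ S L L).inv ≫ ψ ▷ L ≫ (α_ L S L).hom ≫ L ◁ ψ ≫ (α_ L L S).inv ≫
    μ[L] ▷ S
  comul : ψ ≫ L ◁ Δ[S] = Δ[S] ▷ L ≫ (α_ S S L).hom ≫ S ◁ ψ ≫ (α_ S L S).inv ≫ ψ ▷ S ≫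
    (α_ L S S).hom

end Entwining

section Dual

variable {D : Type u} [Category.{v} D] [MonoidalCategory D]

/-- The transpose `Y' ⟶ X'` of `f : X ⟶ Y` with respect to evaluations `X ⊗ X' ⟶ 𝟙` and
`Y ⊗ Y' ⟶ 𝟙`. -/
def dualMap {X Y X' Y' : D} [ExactPairing X' X] [ExactPairing Y' Y] (f : X ⟶ Y) : Y' ⟶ X' :=
  @leftAdjointMate D _ _ X Y ⟨X'⟩ ⟨Y'⟩ f

theorem dualMap_evaluation {X Y X' Y' : D} [ExactPairing X' X] [ExactPairing Y' Y] (f : X ⟶ Y) :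
    X ◁ dualMap f ≫ ε_ X' X = f ▷ Y' ≫ ε_ Y' Y :=
  @leftAdjointMate_comp_evaluation D _ _ X Y ⟨X'⟩ ⟨Y'⟩ f

theorem dual_ext {X X' W : D} [ExactPairing X' X] {g h : W ⟶ X'}
    (e : X ◁ g ≫ ε_ X' X = X ◁ h ≫ ε_ X' X) : g = h := by
  have key : ∀ k : W ⟶ X', k = (λ_ W).inv ≫ η_ X' X ▷ W ≫ (α_ _ _ _).hom ≫
      X' ◁ (X ◁ k ≫ ε_ X' X) ≫ (ρ_ X').hom := by
    intro k
    have z := ExactPairing.evaluation_coevaluation X' X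
    simp only [MonoidalCategory.whiskerLeft_comp, Category.assoc]
    rw [← associator_naturality_right_assoc, ← whisker_exchange_assoc,
      ← Category.assoc (α_ X' X X').hom, ← Category.assoc (η_ X' X ▷ X'), z]
    simp
  rw [key g, key h, e]

theorem dualMap_eq {X Y X' Y' : D} [ExactPairing X' X] [ExactPairing Y' Y] {f : X ⟶ Y}
    {g : Y' ⟶ X'} (e : X ◁ g ≫ ε_ X' X = f ▷ Y' ≫ ε_ Y' Y) : dualMap f = g :=
  dual_ext (by rw [dualMap_evaluation, e])

theorem dualMap_comp {X Y Z X' Y' Z' : D} [ExactPairing X' X] [ExactPairing Y' Y]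
    [ExactPairing Z' Z] (f : X ⟶ Y) (g : Y ⟶ Z) :
    dualMap (X' := X') (Y' := Z') (f ≫ g) = dualMap (X' := Y') g ≫ dualMap f := by
  apply dualMap_eq
  rw [MonoidalCategory.whiskerLeft_comp_assoc, dualMap_evaluation, ← Category.assoc,
    whisker_exchange, Category.assoc, dualMap_evaluation, comp_whiskerRight_assoc]

theorem tensor_evaluation {X Y X' Y' : D} [ExactPairing X' X] [ExactPairing Y' Y] :
    ε_ (Y' ⊗ X') (X ⊗ Y) = (α_ _ _ _).hom ≫ X ◁ ((α_ _ _ _).inv ≫ ε_ Y' Y ▷ X' ≫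
      (λ_ _).hom) ≫ ε_ X' X := by
  rw [ExactPairing.tensor_evaluation]
  monoidal

theorem dualMap_whiskerLeft {X Y Z X' Y' Z' : D} [ExactPairing X' X] [ExactPairing Y' Y]
    [ExactPairing Z' Z] (f : Y ⟶ Z) :
    dualMap (X' := Y' ⊗ X') (Y' := Z' ⊗ X') (X ◁ f) = dualMap f ▷ X' := by
  apply dualMap_eq
  have h := dualMap_evaluation (X' := Y') (Y' := Z') f
  have h2 : (X ⊗ Y) ◁ dualMap (X' := Y') (Y' := Z') f ▷ X' ≫ (α_ _ _ _).hom ≫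
      X ◁ ((α_ _ _ _).inv ≫ ε_ Y' Y ▷ X' ≫ (λ_ _).hom) ≫ ε_ X' X =
      (α_ _ _ _).hom ≫ X ◁ ((α_ _ _ _).inv ≫
        (Y ◁ dualMap (X' := Y') (Y' := Z') f ≫ ε_ Y' Y) ▷ X' ≫ (λ_ _).hom) ≫ ε_ X' X := by
    monoidal
  rw [tensor_evaluation, tensor_evaluation, h2, h]
  monoidal

theorem dualMap_whiskerRight {X Y Z X' Y' Z' : D} [ExactPairing X' X] [ExactPairing Y' Y]
    [ExactPairing Z' Z] (f : Y ⟶ Z) :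
    dualMap (X' := X' ⊗ Y') (Y' := X' ⊗ Z') (f ▷ X) = X' ◁ dualMap f := by
  apply dualMap_eq
  have h := dualMap_evaluation (X' := Y') (Y' := Z') f
  have h2 : (Y ⊗ X) ◁ X' ◁ dualMap (X' := Y') (Y' := Z') f ≫ (α_ _ _ _).hom ≫
      Y ◁ ((α_ _ _ _).inv ≫ ε_ X' X ▷ Y' ≫ (λ_ _).hom) ≫ ε_ Y' Y =
      (α_ _ _ _).hom ≫ Y ◁ ((α_ _ _ _).inv ≫ ε_ X' X ▷ Z' ≫ (λ_ _).hom) ≫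
        Y ◁ dualMap (X' := Y') (Y' := Z') f ≫ ε_ Y' Y := by
    have w := whisker_exchange (ε_ X' X) (dualMap (X' := Y') (Y' := Z') f)
    have w2 : X ◁ X' ◁ dualMap (X' := Y') (Y' := Z') f ≫ (α_ _ _ _).inv ≫ ε_ X' X ▷ Y' ≫
        (λ_ _).hom = (α_ _ _ _).inv ≫ ε_ X' X ▷ Z' ≫ (λ_ _).hom ≫ dualMap f := by
      rw [← leftUnitor_naturality, ← whisker_exchange_assoc]
      simp
    rw [← MonoidalCategory.whiskerLeft_comp_assoc Y _ (dualMap f), Category.assoc,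
      Category.assoc, ← w2]
    simp
  rw [tensor_evaluation, tensor_evaluation, h2, h]
  rw [whisker_exchange_assoc, associator_naturality_left_assoc]

theorem dualMap_rightUnitor_inv {X X' : D} [ExactPairing X' X] :
    dualMap (X' := X') (Y' := 𝟙_ D ⊗ X') (ρ_ X).inv = (λ_ X').hom := by
  apply dualMap_eq
  rw [tensor_evaluation]
  change _ = _ ≫ _ ≫ _ ◁ (_ ≫ (ρ_ (𝟙_ D)).hom ▷ _ ≫ _) ≫ _
  monoidal

theorem dualMap_leftUnitor_inv {X X' : D} [ExactPairing X' X] :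
    dualMap (X' := X') (Y' := X' ⊗ 𝟙_ D) (λ_ X).inv = (ρ_ X').hom := by
  apply dualMap_eq
  rw [tensor_evaluation]
  change _ = _ ≫ _ ≫ _ ◁ _ ≫ (ρ_ (𝟙_ D)).hom
  monoidal

theorem dualMap_associator {X Y Z X' Y' Z' : D} [ExactPairing X' X] [ExactPairing Y' Y]
    [ExactPairing Z' Z] :
    dualMap (X' := Z' ⊗ (Y' ⊗ X')) (Y' := (Z' ⊗ Y') ⊗ X') (α_ X Y Z).hom = (α_ Z' Y' X').hom := by
  apply dualMap_eq
  rw [tensor_evaluation, tensor_evaluation, tensor_evaluation, tensor_evaluation]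
  monoidal

/-- The monoid structure on a dual `L'` of a comonoid `L`, given by the transposes of the
comultiplication and the counit. -/
@[reducible]
def dualMonObj (L L' : D) [ExactPairing L' L] [ComonObj L] : MonObj L' where
  one := dualMap (X' := L') (Y' := 𝟙_ D) ε[L]
  mul := dualMap (X' := L') (Y' := L' ⊗ L') Δ[L]
  one_mul := by
    rw [← dualMap_whiskerLeft (X := L), ← dualMap_comp, ComonObj.comul_counit,
      dualMap_rightUnitor_inv]
  mul_one := by
    rw [← dualMap_whiskerRight (X := L), ← dualMap_comp, ComonObj.counit_comul,
      dualMap_leftUnitor_inv]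
  mul_assoc := by
    rw [← dualMap_whiskerLeft (X := L), ← dualMap_comp, ← dualMap_whiskerRight (X := L),
      ← dualMap_comp, ← dualMap_associator (X := L) (Y := L) (Z := L), ← dualMap_comp,
      ComonObj.comul_assoc, Category.assoc]

/-- The comonoid structure on a dual `S'` of a monoid `S`, given by the transposes of the
multiplication and the unit. -/
@[reducible]
def dualComonObj (S S' : D) [ExactPairing S' S] [MonObj S] : ComonObj S' where
  counit := dualMap (X' := 𝟙_ D) (Y' := S') η[S]
  comul := dualMap (X' := S' ⊗ S') (Y' := S') μ[S]
  counit_comul := by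
    rw [← dualMap_whiskerLeft (X := S), ← dualMap_comp, MonObj.mul_one,
      ← cancel_mono (λ_ S').hom, ← dualMap_rightUnitor_inv (X := S) (X' := S'), ← dualMap_comp,
      Iso.inv_hom_id, dualMap_rightUnitor_inv, Iso.inv_hom_id]
    exact dualMap_eq (by simp)
  comul_counit := by
    rw [← dualMap_whiskerRight (X := S), ← dualMap_comp, MonObj.one_mul,
      ← cancel_mono (ρ_ S').hom, ← dualMap_leftUnitor_inv (X := S) (X' := S'), ← dualMap_comp,
      Iso.inv_hom_id, dualMap_leftUnitor_inv, Iso.inv_hom_id]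
    exact dualMap_eq (by simp)
  comul_assoc := by
    rw [← dualMap_whiskerLeft (X := S), ← dualMap_whiskerRight (X := S),
      ← dualMap_associator (X := S) (Y := S) (Z := S), ← dualMap_comp, ← dualMap_comp,
      ← dualMap_comp, MonObj.mul_assoc, Category.assoc]

end Dual

section DualBialgebroid

variable {C : Type u} [Category.{v} C] [MonoidalCategory C]
  [HasCoequalizers C]
  [∀ X : C, PreservesColimitsOfShape WalkingParallelPair (tensorLeft X)]
  [∀ X : C, PreservesColimitsOfShape WalkingParallelPair (tensorRight X)]
  {R : Mon C}

theorem forgetMon_actRight (M : Bimod R R) [MonObj M] :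
    M.actRight = M.X ◁ fromR η[M] ≫ μ[(forgetMon M).X] :=
  (mul_one_fromR M).symm

variable [SymmetricCategory C]

/-- The factorwise left multiplication of `B ⊗ B`, regarded as a morphism into `B ⊗_R K` for a
monoid `B` in the category of bimodules and the bimodule `K` of base maps whose source map is the
unit of `B`. The right actions of `R` on `B` and on `K` coincide, so that the objects of `C`
underlying `K ⊗_R K` and `B ⊗_R K` are coequalizers of the same pair. -/
noncomputable def dualLam {B : Bimod R R} [MonObj B] (d : BaseMaps R (forgetMon B))
    (hs : d.s.hom = fromR η[B]) : (B.X ⊗ B.X) ⊗ (d.K ⊗ d.K).X ⟶ (B ⊗ d.K).X :=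
  tensActL (M := d.K) (N := d.K) (M' := B) (N' := d.K) μ[(forgetMon B).X] μ[(forgetMon B).X]
    (by
      have h : B.actRight = B.X ◁ d.s.hom ≫ μ[(forgetMon B).X] := by
        rw [forgetMon_actRight, hs]
        rfl
      rw [h]
      exact d.S_mul_right')
    d.K_mul_left

end DualBialgebroid

end InternalBialgebroid

open MonObj ComonObj InternalBialgebroid

/-! Write `γ(a) = a₁ ⊗ a₂` and `⟨a, χ⟩` for the evaluation of `L` on `B`. Multiplicativity of `γ`
makes `L ⊗_R L` a left `A`-module by `a • (x ⊗ y) = a₁x ⊗ a₂y` (`mul_lamM`), and this action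
commutes with right multiplications (`rhoLL_lamM`). The entwining map is `ψ(a ⊗ b) = a • (b ⊗ 1)`
(`entw_eq_lamM`), so its balancedness, linearity and multiplication axiom are module identities. The
counit axiom combines the Takeuchi condition with `π(xb) = π(x tπ(b))` (`entw_counitFst`). The
comultiplication axiom is coassociativity, applied to `a₁b ⊗ a₂c ⊗ a₃` (`piLL_entwThree`).

Everything about duals is tested against evaluations. A morphism into a right dual is determined by
its pairing (`pairing_ext`), and every left `R`-linear functional is represented there
(`exists_pairing_eq`). `S` and `L` have the same left action, so their duals share an underlying
object and an evaluation (`exists_iso_dualS`). Since `μ_B` is the transpose of `γ`, one has `⟨a, χθ⟩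
= ⟨a·χ, θ⟩` with `a·χ = t⟨a₂, χ⟩a₁` (`evL_mul`). The map `q` represents `a ↦ π(a s(r))`, and `(a
s(r))·χ = (a·χ) s(r)` yields `⟨a, χ q(r)⟩ = ⟨a s(r), χ⟩` (`evL_dual_target`). Thus right
multiplication by `q(r)` is the left action of `R` on the dual of `S`.

Transposition turns the left entwining axioms into the right ones
(`IsLeftEntwining.isRightEntwining_dualMap`). Contracting `ψ(a ⊗ b)` with `χ` gives `(a·χ)b`
(`entw_contractL`), hence `ψʳ(χ ⊗ φ) = φ₁ ⊗ χφ₂` (`piKL_dualEntw`), where `φ₁ ⊗ φ₂` is the transpose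
of the product of `S`. At `χ = 1` this is the comultiplication. Left linearity, the unit axiom and
the multiplication axiom of `ψʳ` then become the Takeuchi condition, unitality and multiplicativity
of the dual. The counit axioms hold because `⟨1, χθ⟩` depends on `χ` only through `⟨1, χ⟩`
(`mul_counitK`). -/

namespace InternalBialgebroid

set_option linter.unusedSectionVars false

/-! ### Maps acting on one factor of a tensor product over `R`, with a parameter -/

section ParametrizedTensor

variable {C : Type u} [Category.{v} C] [MonoidalCategory C] [SymmetricCategory C]
  [HasCoequalizers C]
  [∀ X : C, PreservesColimitsOfShape WalkingParallelPair (tensorLeft X)]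
  [∀ X : C, PreservesColimitsOfShape WalkingParallelPair (tensorRight X)]
  {R : Mon C}

/-- The morphism `(M ⊗_R N) ⊗ Z ⟶ M ⊗_R N'`, `(m ⊗ n) ⊗ z ↦ m ⊗ k (n ⊗ z)`, induced by a left
`R`-linear morphism `k : N ⊗ Z ⟶ N'`. -/
noncomputable def tensSnd (M : Bimod R R) {N N' : Bimod R R} {Z : C} (k : N.X ⊗ Z ⟶ N'.X)
    (hk : N.actLeft ▷ Z ≫ k = (α_ _ _ _).hom ≫ R.X ◁ k ≫ N'.actLeft) :
    (M ⊗ N).X ⊗ Z ⟶ (M ⊗ N').X :=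
  bdescR ((α_ _ _ _).hom ≫ M.X ◁ k ≫ toTens M N') (by
    have c := toTens_condition M N'
    rw [associator_naturality_left_assoc, ← whisker_exchange_assoc, c,
      associator_naturality_middle_assoc, ← MonoidalCategory.whiskerLeft_comp_assoc, hk]
    simp)

theorem toTens_tensSnd (M : Bimod R R) {N N' : Bimod R R} {Z : C} (k : N.X ⊗ Z ⟶ N'.X)
    (hk : N.actLeft ▷ Z ≫ k = (α_ _ _ _).hom ≫ R.X ◁ k ≫ N'.actLeft) :
    toTens M N ▷ Z ≫ tensSnd M k hk = (α_ _ _ _).hom ≫ M.X ◁ k ≫ toTens M N' :=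
  bπ_bdescR _ _

/-- The morphism `(M ⊗_R N) ⊗ Z ⟶ M' ⊗_R N`, `(m ⊗ n) ⊗ z ↦ k (m ⊗ z) ⊗ n`, induced by a right
`R`-linear morphism `k : M ⊗ Z ⟶ M'`. -/
noncomputable def tensFst {M M' : Bimod R R} (N : Bimod R R) {Z : C} (k : M.X ⊗ Z ⟶ M'.X)
    (hk : M.actRight ▷ Z ≫ k =
      (α_ _ _ _).hom ≫ M.X ◁ (β_ R.X Z).hom ≫ (α_ _ _ _).inv ≫ k ▷ R.X ≫ M'.actRight) :
    (M ⊗ N).X ⊗ Z ⟶ (M' ⊗ N).X :=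
  bdescR ((α_ _ _ _).hom ≫ M.X ◁ (β_ N.X Z).hom ≫ (α_ _ _ _).inv ≫ k ▷ N.X ≫ toTens M' N) (by
    have c := toTens_condition M' N
    rw [associator_naturality_left_assoc, ← whisker_exchange_assoc,
      associator_inv_naturality_left_assoc, ← comp_whiskerRight_assoc, hk,
      associator_naturality_middle_assoc, ← MonoidalCategory.whiskerLeft_comp_assoc,
      BraidedCategory.braiding_naturality_left]
    simp only [comp_whiskerRight, Category.assoc, c, BraidedCategory.braiding_tensor_left_hom,
      MonoidalCategory.whiskerLeft_comp]
    have e : k ▷ R.X ▷ N.X ≫ (α_ _ _ _).hom ≫ M'.X ◁ N.actLeft ≫ toTens M' N =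
      (α_ _ _ _).hom ≫ (M.X ⊗ Z) ◁ N.actLeft ≫ k ▷ N.X ≫ toTens M' N := by
      rw [associator_naturality_left_assoc, whisker_exchange_assoc]
    rw [e]
    monoidal)

theorem toTens_tensFst {M M' : Bimod R R} (N : Bimod R R) {Z : C} (k : M.X ⊗ Z ⟶ M'.X)
    (hk : M.actRight ▷ Z ≫ k =
      (α_ _ _ _).hom ≫ M.X ◁ (β_ R.X Z).hom ≫ (α_ _ _ _).inv ≫ k ▷ R.X ≫ M'.actRight) :
    toTens M N ▷ Z ≫ tensFst N k hk =
      (α_ _ _ _).hom ≫ M.X ◁ (β_ N.X Z).hom ≫ (α_ _ _ _).inv ≫ k ▷ N.X ≫ toTens M' N :=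
  bπ_bdescR _ _

theorem toTens_tensSnd_assoc (M : Bimod R R) {N N' : Bimod R R} {Z W : C} (k : N.X ⊗ Z ⟶ N'.X)
    (hk : N.actLeft ▷ Z ≫ k = (α_ _ _ _).hom ≫ R.X ◁ k ≫ N'.actLeft) (f : (M ⊗ N').X ⟶ W) :
    toTens M N ▷ Z ≫ tensSnd M k hk ≫ f = (α_ _ _ _).hom ≫ M.X ◁ k ≫ toTens M N' ≫ f := by
  rw [← Category.assoc, toTens_tensSnd]; simp

theorem toTens_tensFst_assoc {M M' : Bimod R R} (N : Bimod R R) {Z W : C} (k : M.X ⊗ Z ⟶ M'.X)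
    (hk : M.actRight ▷ Z ≫ k =
      (α_ _ _ _).hom ≫ M.X ◁ (β_ R.X Z).hom ≫ (α_ _ _ _).inv ≫ k ▷ R.X ≫ M'.actRight)
    (f : (M' ⊗ N).X ⟶ W) :
    toTens M N ▷ Z ≫ tensFst N k hk ≫ f =
      (α_ _ _ _).hom ≫ M.X ◁ (β_ N.X Z).hom ≫ (α_ _ _ _).inv ≫ k ▷ N.X ≫ toTens M' N ≫ f := by
  rw [← Category.assoc, toTens_tensFst]; simp

/-- Both sides are `k ⊗ l` on representatives: maps on different factors do not interact, so only
the order of the parameters changes. -/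
theorem tensFst_tensSnd {M M' N N' : Bimod R R} {Y Z : C} (k : M.X ⊗ Y ⟶ M'.X)
    (hk : M.actRight ▷ Y ≫ k =
      (α_ _ _ _).hom ≫ M.X ◁ (β_ R.X Y).hom ≫ (α_ _ _ _).inv ≫ k ▷ R.X ≫ M'.actRight)
    (l : N.X ⊗ Z ⟶ N'.X)
    (hl : N.actLeft ▷ Z ≫ l = (α_ _ _ _).hom ≫ R.X ◁ l ≫ N'.actLeft) :
    tensFst N k hk ▷ Z ≫ tensSnd M' l hl =
      (α_ _ _ _).hom ≫ (M ⊗ N).X ◁ (β_ Y Z).hom ≫ (α_ _ _ _).inv ≫ tensSnd M l hl ▷ Y ≫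
        tensFst N' k hk := by
  rw [← cancel_epi (toTens M N ▷ Y ▷ Z), ← comp_whiskerRight_assoc, toTens_tensFst]
  rw [associator_naturality_left_assoc, ← whisker_exchange_assoc,
    associator_inv_naturality_left_assoc, ← comp_whiskerRight_assoc _ _ Y, toTens_tensSnd]
  simp only [comp_whiskerRight, Category.assoc]
  rw [toTens_tensSnd, toTens_tensFst]
  have e : (M.X ◁ l) ▷ Y ≫ (α_ _ _ _).hom ≫ M.X ◁ (β_ N'.X Y).hom =
      (α_ _ _ _).hom ≫ M.X ◁ (β_ (N.X ⊗ Z) Y).hom ≫ M.X ◁ (Y ◁ l) := by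
    rw [associator_naturality_middle_assoc, ← MonoidalCategory.whiskerLeft_comp,
      BraidedCategory.braiding_naturality_left, MonoidalCategory.whiskerLeft_comp]
  rw [reassoc_of% e]
  simp only [BraidedCategory.braiding_tensor_left_hom, Category.assoc,
    MonoidalCategory.whiskerLeft_comp]
  -- The hexagon for the braiding of `N ⊗ Z` past `Y` leaves a crossing of `Z` with `Y`; symmetry
  -- cancels it against the parameter swap on the right-hand side.
  have s : (M.X ⊗ N.X) ◁ (β_ Y Z).hom ≫ (α_ _ _ _).inv ≫ (α_ _ _ _).hom ▷ Y ≫ (α_ _ _ _).hom ≫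
      M.X ◁ (α_ _ _ _).hom ≫ M.X ◁ N.X ◁ (β_ Z Y).hom = (α_ _ _ _).hom := by
    have s1 : (β_ Y Z).hom ≫ (β_ Z Y).hom = 𝟙 _ := SymmetricCategory.symmetry Y Z
    have : (α_ (M.X ⊗ N.X) Z Y).inv ≫ (α_ _ _ _).hom ▷ Y ≫ (α_ _ _ _).hom ≫
      M.X ◁ (α_ _ _ _).hom ≫ M.X ◁ N.X ◁ (β_ Z Y).hom =
      (M.X ⊗ N.X) ◁ (β_ Z Y).hom ≫ (α_ _ _ _).hom := by monoidal
    rw [this, ← MonoidalCategory.whiskerLeft_comp_assoc, s1]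
    simp
  have s' := (α_ _ _ _).hom ≫= (s =≫ (M.X ◁ (α_ _ _ _).inv ≫ M.X ◁ (β_ N.X Y).hom ▷ Z ≫
    M.X ◁ (α_ _ _ _).hom ≫ M.X ◁ (Y ◁ l) ≫ (α_ _ _ _).inv ≫ k ▷ N'.X ≫ toTens M' N'))
  simp only [Category.assoc] at s'
  rw [s', associator_inv_naturality_right_assoc, whisker_exchange_assoc]
  monoidal

end ParametrizedTensor

/-! ### Further epimorphisms obtained by whiskering the projections -/

section Instances

variable {C : Type u} [Category.{v} C] [MonoidalCategory C]
  [HasCoequalizers C]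
  [∀ X : C, PreservesColimitsOfShape WalkingParallelPair (tensorLeft X)]
  [∀ X : C, PreservesColimitsOfShape WalkingParallelPair (tensorRight X)]
  {R : Mon C}

instance (Z W : C) (M N : Bimod R R) : Epi (Z ◁ (toTens M N ▷ W)) :=
  inferInstanceAs (Epi (Z ◁ (bπ M N ▷ W)))

instance (Z W : C) (M N : Bimod R R) : Epi ((Z ◁ toTens M N) ▷ W) :=
  inferInstanceAs (Epi ((Z ◁ bπ M N) ▷ W))

end Instances

/-! ### Dual pairs of bimodules seen through their evaluation in the base category -/

section Pairing

variable {C : Type u} [Category.{v} C] [MonoidalCategory C] [SymmetricCategory C]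
  [HasCoequalizers C]
  [∀ X : C, PreservesColimitsOfShape WalkingParallelPair (tensorLeft X)]
  [∀ X : C, PreservesColimitsOfShape WalkingParallelPair (tensorRight X)]
  {R : Mon C}

/-- The evaluation of a dual pair of bimodules, as a morphism of `C` out of `X ⊗ X'`. -/
noncomputable def pairing (X X' : Bimod R R) [ExactPairing X' X] : X.X ⊗ X'.X ⟶ R.X :=
  toTens X X' ≫ toR (ε_ X' X)

/-- The element of `X' ⊗_R X` underlying the coevaluation of a dual pair of bimodules. -/
noncomputable def coev (X X' : Bimod R R) [ExactPairing X' X] : 𝟙_ C ⟶ (X' ⊗ X).X :=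
  η[R.X] ≫ fromR (η_ X' X)

section

variable (X X' : Bimod R R) [ExactPairing X' X]

theorem pairing_actLeft :
    X.actLeft ▷ X'.X ≫ pairing X X' = (α_ _ _ _).hom ≫ R.X ◁ pairing X X' ≫ μ[R.X] := by
  have h : (X ⊗ X').actLeft ≫ toR (ε_ X' X) = R.X ◁ toR (ε_ X' X) ≫ μ[R.X] :=
    (ε_ X' X).left_act_hom
  have h2 := toTens_actLeft X X' =≫ toR (ε_ X' X)
  simp only [Category.assoc, h] at h2
  rw [pairing, MonoidalCategory.whiskerLeft_comp_assoc, h2, Iso.hom_inv_id_assoc]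

theorem pairing_actRight :
    X.X ◁ X'.actRight ≫ pairing X X' = (α_ _ _ _).inv ≫ pairing X X' ▷ R.X ≫ μ[R.X] := by
  have h : (X ⊗ X').actRight ≫ toR (ε_ X' X) = toR (ε_ X' X) ▷ R.X ≫ μ[R.X] :=
    (ε_ X' X).right_act_hom
  have h2 := toTens_actRight X X' =≫ toR (ε_ X' X)
  simp only [Category.assoc, h] at h2
  rw [pairing, comp_whiskerRight_assoc, h2, Iso.inv_hom_id_assoc]

theorem pairing_mid :
    X.actRight ▷ X'.X ≫ pairing X X' = (α_ _ _ _).hom ≫ X.X ◁ X'.actLeft ≫ pairing X X' := by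
  rw [pairing, reassoc_of% toTens_condition X X']

/-- The contraction `x ⊗ (x' ⊗ y) ↦ ⟨x, x'⟩ y` descends because evaluation is a bimodule morphism.
Its value at the coevaluation element is a triangle identity at the unit of `R`. -/
theorem exists_coev_left : ∃ F : X.X ⊗ (X' ⊗ X).X ⟶ X.X,
    X.X ◁ toTens X' X ≫ F = (α_ _ _ _).inv ≫ pairing X X' ▷ X.X ≫ X.actLeft ∧
      X.X ◁ coev X X' ≫ F = (ρ_ _).hom := by
  refine ⟨toTens X (X' ⊗ X) ≫ ((α_ X X' X).inv ≫ ε_ X' X ▷ X ≫ (λ_ X).hom).hom, ?_, ?_⟩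
  · have h1 := toTens_associator X X' X =≫ (α_ X X' X).inv.hom
    simp only [Category.assoc, ← hom_comp, Iso.hom_inv_id] at h1
    rw [hom_id] at h1
    have h2 := (α_ _ _ _).inv ≫= h1
    rw [Iso.inv_hom_id_assoc, Category.comp_id] at h2
    rw [hom_comp, hom_comp, ← reassoc_of% h2, reassoc_of% toTens_whiskerRight, toTens_leftUnitor,
      pairing, comp_whiskerRight_assoc]
    rfl
  · have h := toTens_whiskerLeft X (η_ X' X)
    have t := ExactPairing.coevaluation_evaluation X' X
    have e : ((X ◁ η_ X' X) ≫ (α_ X X' X).inv ≫ ε_ X' X ▷ X ≫ (λ_ X).hom) = (ρ_ X).hom := by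
      rw [reassoc_of% t]; simp
    have h3 := h =≫ ((α_ X X' X).inv ≫ ε_ X' X ▷ X ≫ (λ_ X).hom).hom
    rw [Category.assoc, Category.assoc, ← hom_comp, e, toTens_rightUnitor] at h3
    have h4 : X.X ◁ fromR (η_ X' X) ≫ toTens X (X' ⊗ X) ≫
      ((α_ X X' X).inv ≫ ε_ X' X ▷ X ≫ (λ_ X).hom).hom = X.actRight := h3.symm
    rw [coev, MonoidalCategory.whiskerLeft_comp_assoc, h4, X.actRight_one]

/-- The other triangle identity, for the contraction `(x' ⊗ x) ⊗ y' ↦ x' ⟨x, y'⟩`. -/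
theorem exists_coev_right : ∃ G : (X' ⊗ X).X ⊗ X'.X ⟶ X'.X,
    toTens X' X ▷ X'.X ≫ G = (α_ _ _ _).hom ≫ X'.X ◁ pairing X X' ≫ X'.actRight ∧
      coev X X' ▷ X'.X ≫ G = (λ_ _).hom := by
  refine ⟨toTens (X' ⊗ X) X' ≫ ((α_ X' X X').hom ≫ X' ◁ ε_ X' X ≫ (ρ_ X').hom).hom, ?_, ?_⟩
  · rw [hom_comp, hom_comp, reassoc_of% toTens_associator, reassoc_of% toTens_whiskerLeft,
      toTens_rightUnitor, pairing, MonoidalCategory.whiskerLeft_comp_assoc]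
    rfl
  · have h := toTens_whiskerRight (η_ X' X) X'
    have t := ExactPairing.evaluation_coevaluation X' X
    have e : (η_ X' X ▷ X' ≫ (α_ X' X X').hom ≫ X' ◁ ε_ X' X ≫ (ρ_ X').hom) = (λ_ X').hom := by
      rw [reassoc_of% t]; simp
    have h3 := h =≫ ((α_ X' X X').hom ≫ X' ◁ ε_ X' X ≫ (ρ_ X').hom).hom
    rw [Category.assoc, Category.assoc, ← hom_comp, e, toTens_leftUnitor] at h3
    have h4 : fromR (η_ X' X) ▷ X'.X ≫ toTens (X' ⊗ X) X' ≫
      ((α_ X' X X').hom ≫ X' ◁ ε_ X' X ≫ (ρ_ X').hom).hom = X'.actLeft := h3.symm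
    rw [coev, comp_whiskerRight_assoc, h4, X'.one_actLeft]

end

section

variable {X X' : Bimod R R} [ExactPairing X' X] {W : C}

/-- Morphisms into the right dual `X'` of a bimodule `X` are determined by their pairing
with `X`. -/
theorem pairing_ext {g h : W ⟶ X'.X} (e : X.X ◁ g ≫ pairing X X' = X.X ◁ h ≫ pairing X X') :
    g = h := by
  obtain ⟨G, hG, hG'⟩ := exists_coev_right X X'
  -- Dual basis expansion: with coevaluation `∑ xᵢ' ⊗ xᵢ`, one has `k w = ∑ xᵢ' ⟨xᵢ, k w⟩`; `key2`
  -- shows that this sum sees `k` only through the pairing.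
  have key : ∀ k : W ⟶ X'.X, k = (λ_ W).inv ≫ coev X X' ▷ W ≫ (X' ⊗ X).X ◁ k ≫ G := by
    intro k
    rw [← whisker_exchange_assoc, hG']
    simp
  have key2 : ∀ k : W ⟶ X'.X, toTens X' X ▷ W ≫ (X' ⊗ X).X ◁ k ≫ G =
      (α_ _ _ _).hom ≫ X'.X ◁ (X.X ◁ k ≫ pairing X X') ≫ X'.actRight := by
    intro k
    rw [← whisker_exchange_assoc, hG]
    simp
  have : (X' ⊗ X).X ◁ g ≫ G = (X' ⊗ X).X ◁ h ≫ G := by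
    rw [← cancel_epi (toTens X' X ▷ W), key2, key2, e]
  rw [key g, key h, this]

/-- Every left `R`-linear morphism `X ⊗ W ⟶ R` is the pairing with a morphism into the right
dual of `X`. -/
theorem exists_pairing_eq (k : X.X ⊗ W ⟶ R.X)
    (hk : X.actLeft ▷ W ≫ k = (α_ _ _ _).hom ≫ R.X ◁ k ≫ μ[R.X]) :
    ∃ g : W ⟶ X'.X, X.X ◁ g ≫ pairing X X' = k := by
  obtain ⟨F, hF, hF'⟩ := exists_coev_left X X'
  -- Left `R`-linearity of `k` makes `x' ⊗ x ⊗ w ↦ x' · k(x ⊗ w)` balanced.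
  have bal : (X'.actRight ▷ X.X) ▷ W ≫ (α_ _ _ _).hom ≫ X'.X ◁ k ≫ X'.actRight =
      (α_ _ _ _).hom ▷ W ≫ (X'.X ◁ X.actLeft) ▷ W ≫ (α_ _ _ _).hom ≫ X'.X ◁ k ≫
        X'.actRight := by
    rw [associator_naturality_left_assoc, associator_naturality_middle_assoc,
      ← MonoidalCategory.whiskerLeft_comp_assoc _ _ k, hk, ← whisker_exchange_assoc,
      MonoidalCategory.whiskerLeft_comp, MonoidalCategory.whiskerLeft_comp]
    simp only [Category.assoc, X'.right_assoc]
    monoidal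
  let G : (X' ⊗ X).X ⊗ W ⟶ X'.X :=
    bdescR ((α_ _ _ _).hom ≫ X'.X ◁ k ≫ X'.actRight) bal
  have hG : toTens X' X ▷ W ≫ G = (α_ _ _ _).hom ≫ X'.X ◁ k ≫ X'.actRight := bπ_bdescR _ bal
  -- `⟨x, x' · k(y ⊗ w)⟩ = ⟨x, x'⟩ k(y ⊗ w) = k(⟨x, x'⟩ y ⊗ w)`, so the contraction `F` computes the
  -- pairing.
  have key : X.X ◁ G ≫ pairing X X' = (α_ _ _ _).inv ≫ F ▷ W ≫ k := by
    rw [← cancel_epi (X.X ◁ toTens X' X ▷ W), ← MonoidalCategory.whiskerLeft_comp_assoc, hG,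
      associator_inv_naturality_middle_assoc, ← comp_whiskerRight_assoc, hF]
    simp only [Category.assoc, MonoidalCategory.whiskerLeft_comp, comp_whiskerRight,
      pairing_actRight, hk]
    rw [associator_naturality_left_assoc, ← whisker_exchange_assoc]
    monoidal
  -- The witness is `w ↦ ∑ xᵢ' · k(xᵢ ⊗ w)`, summed over the coevaluation.
  refine ⟨(λ_ W).inv ≫ coev X X' ▷ W ≫ G, ?_⟩
  rw [MonoidalCategory.whiskerLeft_comp, MonoidalCategory.whiskerLeft_comp, Category.assoc,
    Category.assoc, key, associator_inv_naturality_middle_assoc, ← comp_whiskerRight_assoc, hF']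
  simp

end

theorem pairing_dualMap {X Y X' Y' : Bimod R R} [ExactPairing X' X] [ExactPairing Y' Y]
    (f : X ⟶ Y) :
    X.X ◁ (dualMap (X' := X') (Y' := Y') f).hom ≫ pairing X X' = f.hom ▷ Y'.X ≫ pairing Y Y' := by
  have h := congrArg Bimod.Hom.hom (dualMap_evaluation (X' := X') (Y' := Y') f)
  have h' := toTens X Y' ≫= h
  rw [hom_comp, hom_comp, reassoc_of% toTens_whiskerLeft, reassoc_of% toTens_whiskerRight] at h'
  exact h'

theorem pairing_unit : pairing (𝟙_ (Bimod R R)) (𝟙_ (Bimod R R)) = μ[R.X] :=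
  toTens_rightUnitor (𝟙_ (Bimod R R))

/-- The contraction `(X ⊗_R Y) ⊗ Y' ⟶ X`, `(x ⊗ y) ⊗ y' ↦ x · ⟨y, y'⟩`. -/
noncomputable def contract (X Y Y' : Bimod R R) [ExactPairing Y' Y] :
    (X ⊗ Y).X ⊗ Y'.X ⟶ X.X :=
  tensSnd X (N' := 𝟙_ (Bimod R R)) (pairing Y Y') (pairing_actLeft Y Y') ≫ (ρ_ X).hom.hom

theorem toTens_contract (X Y Y' : Bimod R R) [ExactPairing Y' Y] :
    toTens X Y ▷ Y'.X ≫ contract X Y Y' =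
      (α_ _ _ _).hom ≫ X.X ◁ pairing Y Y' ≫ X.actRight := by
  refine (toTens_tensSnd_assoc X (N' := 𝟙_ (Bimod R R)) (pairing Y Y') (pairing_actLeft Y Y')
    (ρ_ X).hom.hom).trans ?_
  rw [toTens_rightUnitor]
  rfl

/-- The dual of `X ⊗ Y` is `Y' ⊗ X'`, so the inner pair `y, y'` is evaluated first and the resulting
scalar acts on `x'`. -/
theorem toTens_pairing_tensor (X Y X' Y' : Bimod R R) [ExactPairing X' X] [ExactPairing Y' Y] :
    (toTens X Y ⊗ₘ toTens Y' X') ≫ pairing (X ⊗ Y) (Y' ⊗ X') =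
      (α_ _ _ _).hom ≫ X.X ◁ ((α_ _ _ _).inv ≫ pairing Y Y' ▷ X'.X ≫ X'.actLeft) ≫
        pairing X X' := by
  have a1 : Y.X ◁ toTens Y' X' ≫ toTens Y (Y' ⊗ X') ≫ (α_ Y Y' X').inv.hom =
      (α_ _ _ _).inv ≫ toTens Y Y' ▷ X'.X ≫ toTens (Y ⊗ Y') X' := by
    have h1 := toTens_associator Y Y' X' =≫ (α_ Y Y' X').inv.hom
    simp only [Category.assoc, ← hom_comp, Iso.hom_inv_id] at h1
    rw [hom_id, Category.comp_id] at h1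
    rw [h1, Iso.inv_hom_id_assoc]
  have e : toR (ε_ (Y' ⊗ X') (X ⊗ Y)) = (α_ X Y (Y' ⊗ X')).hom.hom ≫ (X ◁ ((α_ Y Y' X').inv ≫
      ε_ Y' Y ▷ X' ≫ (λ_ _).hom)).hom ≫ toR (ε_ X' X) :=
    congrArg Bimod.Hom.hom (tensor_evaluation (X := X) (Y := Y) (X' := X') (Y' := Y'))
  rw [pairing, e, MonoidalCategory.tensorHom_def', Category.assoc,
    reassoc_of% toTens_associator, reassoc_of% toTens_whiskerLeft, hom_comp, hom_comp,
    associator_naturality_right_assoc, ← MonoidalCategory.whiskerLeft_comp_assoc,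
    ← MonoidalCategory.whiskerLeft_comp_assoc, Category.assoc, reassoc_of% a1,
    reassoc_of% toTens_whiskerRight,
    toTens_leftUnitor, pairing, pairing, comp_whiskerRight_assoc]
  rfl

/-- Balancedness moves the scalar `⟨y, y'⟩` from `x'` onto `x`. In this form the argument in `X ⊗_R
Y` need not come from a representative, so a comultiplication can be inserted. -/
theorem pairing_tensor (X Y X' Y' : Bimod R R) [ExactPairing X' X] [ExactPairing Y' Y] :
    (X ⊗ Y).X ◁ toTens Y' X' ≫ pairing (X ⊗ Y) (Y' ⊗ X') =
      (α_ _ _ _).inv ≫ contract X Y Y' ▷ X'.X ≫ pairing X X' := by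
  rw [← cancel_epi (toTens X Y ▷ (Y'.X ⊗ X'.X)), ← MonoidalCategory.tensorHom_def_assoc,
    toTens_pairing_tensor, associator_inv_naturality_left_assoc, ← comp_whiskerRight_assoc,
    toTens_contract]
  simp only [comp_whiskerRight, Category.assoc, pairing_mid, MonoidalCategory.whiskerLeft_comp]
  monoidal

end Pairing

/-! ### Bimodule morphisms out of a tensor product -/

section Desc

variable {C : Type u} [Category.{v} C] [MonoidalCategory C]
  [HasCoequalizers C]
  [∀ X : C, PreservesColimitsOfShape WalkingParallelPair (tensorLeft X)]
  [∀ X : C, PreservesColimitsOfShape WalkingParallelPair (tensorRight X)]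
  {R : Mon C}

/-- The bimodule morphism out of `M ⊗_R N` induced by an `R`-balanced morphism that is left and
right `R`-linear. -/
noncomputable def bimodDesc {M N P : Bimod R R} (k : M.X ⊗ N.X ⟶ P.X)
    (h : M.actRight ▷ N.X ≫ k = (α_ _ _ _).hom ≫ M.X ◁ N.actLeft ≫ k)
    (hl : (α_ _ _ _).inv ≫ M.actLeft ▷ N.X ≫ k = R.X ◁ k ≫ P.actLeft)
    (hr : (α_ _ _ _).hom ≫ M.X ◁ N.actRight ≫ k = k ▷ R.X ≫ P.actRight) : M ⊗ N ⟶ P where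
  hom := bdesc k h
  left_act_hom := by
    have e : toTens M N ≫ bdesc k h = k := bπ_bdesc k h
    rw [← cancel_epi (R.X ◁ toTens M N), reassoc_of% toTens_actLeft, e, hl,
      ← MonoidalCategory.whiskerLeft_comp_assoc, e]
  right_act_hom := by
    have e : toTens M N ≫ bdesc k h = k := bπ_bdesc k h
    rw [← cancel_epi (toTens M N ▷ R.X), reassoc_of% toTens_actRight, e, hr,
      ← comp_whiskerRight_assoc, e]

theorem toTens_bimodDesc {M N P : Bimod R R} (k : M.X ⊗ N.X ⟶ P.X)
    (h : M.actRight ▷ N.X ≫ k = (α_ _ _ _).hom ≫ M.X ◁ N.actLeft ≫ k)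
    (hl : (α_ _ _ _).inv ≫ M.actLeft ▷ N.X ≫ k = R.X ◁ k ≫ P.actLeft)
    (hr : (α_ _ _ _).hom ≫ M.X ◁ N.actRight ≫ k = k ▷ R.X ≫ P.actRight) :
    toTens M N ≫ (bimodDesc k h hl hr).hom = k :=
  bπ_bdesc k h

end Desc

namespace BaseMaps

/-! ### The action of `A` on `L ⊗_R L` and the entwining map -/

section LeftBialgebroid

variable {C : Type u} [Category.{v} C] [MonoidalCategory C] [SymmetricCategory C]
  [HasCoequalizers C]
  [∀ X : C, PreservesColimitsOfShape WalkingParallelPair (tensorLeft X)]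
  [∀ X : C, PreservesColimitsOfShape WalkingParallelPair (tensorRight X)]
  {R A : Mon C} (b : BaseMaps R A)

instance (Z : C) : Epi (b.piLL ▷ Z) := inferInstanceAs (Epi (toTens _ _ ▷ Z))

instance (Z : C) : Epi (Z ◁ b.piLL) := inferInstanceAs (Epi (Z ◁ toTens _ _))

instance (Z W : C) : Epi (Z ◁ (b.piLL ▷ W)) := inferInstanceAs (Epi (Z ◁ (toTens _ _ ▷ W)))

instance (Z W : C) : Epi ((Z ◁ b.piLL) ▷ W) := inferInstanceAs (Epi ((Z ◁ toTens _ _) ▷ W))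

/-- Right multiplication of the first factor of `L ⊗_R L`. -/
noncomputable def mulFst : (b.L ⊗ b.L).X ⊗ A.X ⟶ (b.L ⊗ b.L).X :=
  tensFst (M := b.L) (M' := b.L) b.L μ[A.X] b.L_mul_right

/-- Right multiplication of the second factor of `L ⊗_R L`. -/
noncomputable def mulSnd : (b.L ⊗ b.L).X ⊗ A.X ⟶ (b.L ⊗ b.L).X :=
  tensSnd b.L (N := b.L) (N' := b.L) μ[A.X] b.S_mul_left'

theorem piLL_mulFst : b.piLL ▷ A.X ≫ b.mulFst =
    (α_ _ _ _).hom ≫ A.X ◁ (β_ A.X A.X).hom ≫ (α_ _ _ _).inv ≫ μ[A.X] ▷ A.X ≫ b.piLL :=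
  toTens_tensFst (M := b.L) (M' := b.L) b.L μ[A.X] b.L_mul_right

theorem piLL_mulSnd : b.piLL ▷ A.X ≫ b.mulSnd = (α_ _ _ _).hom ≫ A.X ◁ μ[A.X] ≫ b.piLL :=
  toTens_tensSnd b.L (N := b.L) (N' := b.L) μ[A.X] b.S_mul_left'

theorem rhoLL_one_right :
    (b.L ⊗ b.L).X ◁ ((ρ_ A.X).inv ≫ A.X ◁ η[A.X]) ≫ b.rhoLL = b.mulFst := by
  have h := insert_right_left (𝟙 A.X)
  rw [MonoidalCategory.id_tensorHom, MonoidalCategory.whiskerLeft_id, Category.id_comp] at h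
  rw [← cancel_epi (b.piLL ▷ A.X), ← whisker_exchange_assoc, piLL_rhoLL, piLL_mulFst,
    reassoc_of% h]

theorem rhoLL_one_left :
    (b.L ⊗ b.L).X ◁ ((λ_ A.X).inv ≫ η[A.X] ▷ A.X) ≫ b.rhoLL = b.mulSnd := by
  have h := insert_right_right (𝟙 A.X)
  rw [MonoidalCategory.tensorHom_id, MonoidalCategory.whiskerLeft_id, Category.id_comp] at h
  rw [← cancel_epi (b.piLL ▷ A.X), ← whisker_exchange_assoc, piLL_rhoLL, piLL_mulSnd,
    reassoc_of% h]

theorem piLL_condition : (A.X ◁ b.t ≫ (β_ A.X A.X).hom ≫ μ[A.X]) ▷ A.X ≫ b.piLL =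
    (α_ _ _ _).hom ≫ A.X ◁ (b.s.hom ▷ A.X ≫ μ[A.X]) ≫ b.piLL :=
  toTens_condition b.L b.L

theorem piLL_actLeft : R.X ◁ b.piLL ≫ (b.L ⊗ b.L).actLeft =
    (α_ _ _ _).inv ≫ (b.s.hom ▷ A.X ≫ μ[A.X]) ▷ A.X ≫ b.piLL :=
  toTens_actLeft b.L b.L

theorem one_s_mul : R.X ◁ η[A.X] ≫ b.s.hom ▷ A.X ≫ μ[A.X] = (ρ_ R.X).hom ≫ b.s.hom := by
  rw [whisker_exchange_assoc, MonObj.mul_one]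
  simp

theorem one_s_mul_whiskerRight :
    (ρ_ R.X).inv ≫ R.X ◁ ((λ_ (𝟙_ C)).inv ≫ (η[A.X] ⊗ₘ η[A.X])) ≫ (α_ _ _ _).inv ≫
      (b.s.hom ▷ A.X ≫ μ[A.X]) ▷ A.X = (ρ_ R.X).inv ≫ (b.s.hom ⊗ₘ η[A.X]) := by
  rw [MonoidalCategory.tensorHom_def, MonoidalCategory.tensorHom_def,
    MonoidalCategory.whiskerLeft_comp, MonoidalCategory.whiskerLeft_comp, Category.assoc,
    Category.assoc, associator_inv_naturality_right_assoc, whisker_exchange,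
    associator_inv_naturality_middle_assoc, ← comp_whiskerRight_assoc, one_s_mul]
  simp only [comp_whiskerRight, Category.assoc]
  monoidal

/-- `L` and `S` have the same left action, so `L ⊗_R S` and `L ⊗_R L` are definitionally the same
coequalizer. Only the right `R`-actions differ, and that of `S` is right multiplication by `s`. -/
theorem LS_actRight : (b.L ⊗ b.S).actRight = (b.L ⊗ b.L).X ◁ b.s.hom ≫ b.mulSnd := by
  have h : b.piLL ▷ R.X ≫ (b.L ⊗ b.L).X ◁ b.s.hom ≫ b.mulSnd =
      (α_ _ _ _).hom ≫ A.X ◁ (A.X ◁ b.s.hom ≫ μ[A.X]) ≫ b.piLL := by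
    rw [← whisker_exchange_assoc, piLL_mulSnd]
    simp
  exact (cancel_epi (toTens b.L b.S ▷ R.X)).1 ((toTens_actRight b.L b.S).trans h.symm)

theorem piLL_actRight : b.piLL ▷ R.X ≫ (b.L ⊗ b.L).actRight =
    (α_ _ _ _).hom ≫ A.X ◁ (A.X ◁ b.t ≫ (β_ A.X A.X).hom ≫ μ[A.X]) ≫ b.piLL :=
  toTens_actRight b.L b.L

theorem one_t_mul : η[A.X] ▷ R.X ≫ A.X ◁ b.t ≫ (β_ A.X A.X).hom ≫ μ[A.X] =
    (λ_ R.X).hom ≫ b.t := by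
  rw [← whisker_exchange_assoc, BraidedCategory.braiding_naturality_left_assoc, MonObj.mul_one]
  simp

variable [ComonObj b.L]

theorem actLeft_comulL : (b.s.hom ▷ A.X ≫ μ[A.X]) ≫ b.comulL =
    R.X ◁ b.comulL ≫ (b.L ⊗ b.L).actLeft :=
  Δ[b.L].left_act_hom

variable {b}

section Takeuchi

variable (h : b.LeftTakeuchi)

/-- Associativity of the `A ⊗ A`-action: left multiplication by `γ(a)` commutes with right
multiplication. -/
theorem rhoLL_lamM : A.X ◁ b.rhoLL ≫ lamM h =
    (α_ _ _ _).inv ≫ lamM h ▷ (A.X ⊗ A.X) ≫ b.rhoLL := by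
  rw [← cancel_epi (A.X ◁ (b.piLL ▷ (A.X ⊗ A.X))), ← MonoidalCategory.whiskerLeft_comp_assoc,
    piLL_rhoLL, MonoidalCategory.whiskerLeft_comp_assoc, piLL_lamM,
    associator_inv_naturality_middle_assoc, ← comp_whiskerRight_assoc, piLL_lamM,
    comp_whiskerRight_assoc, rhoLL_assoc, associator_naturality_left_assoc,
    ← whisker_exchange_assoc, Iso.inv_hom_id_assoc]

theorem mulSnd_lamM : A.X ◁ b.mulSnd ≫ lamM h =
    (α_ _ _ _).inv ≫ lamM h ▷ A.X ≫ b.mulSnd := by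
  rw [← rhoLL_one_left, MonoidalCategory.whiskerLeft_comp_assoc, rhoLL_lamM,
    ← whisker_exchange_assoc]
  simp

end Takeuchi

/-- Multiplicativity reads `γ(aa') = a • γ(a')`; with `rhoLL_lamM` this makes `L ⊗_R L` a module
over `A`. -/
theorem mul_lamM (hb : b.IsLeftBialgebroid) : μ[A.X] ▷ (b.L ⊗ b.L).X ≫ lamM hb.takeuchi =
    (α_ _ _ _).hom ≫ A.X ◁ lamM hb.takeuchi ≫ lamM hb.takeuchi := by
  rw [← cancel_epi ((A.X ⊗ A.X) ◁ b.piLL), whisker_exchange_assoc, piLL_lamM,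
    ← comp_whiskerRight_assoc, hb.mul_comul, associator_naturality_right_assoc,
    ← MonoidalCategory.whiskerLeft_comp_assoc _ (_ ◁ _), piLL_lamM,
    MonoidalCategory.whiskerLeft_comp_assoc, rhoLL_lamM]
  simp

/-- `s(r)` is `r · 1` in `L`, and `γ` is left `R`-linear with `γ(1) = 1 ⊗ 1`. -/
theorem s_comulL (hb : b.IsLeftBialgebroid) :
    b.s.hom ≫ b.comulL = (ρ_ R.X).inv ≫ (b.s.hom ⊗ₘ η[A.X]) ≫ b.piLL := by
  rw [← cancel_epi (ρ_ R.X).hom, ← reassoc_of% b.one_s_mul]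
  have h := b.actLeft_comulL
  rw [Category.assoc] at h
  rw [h, ← MonoidalCategory.whiskerLeft_comp_assoc, hb.one_comul,
    ← Category.assoc (λ_ (𝟙_ C)).inv, MonoidalCategory.whiskerLeft_comp_assoc, piLL_actLeft,
    ← reassoc_of% b.one_s_mul_whiskerRight, Iso.hom_inv_id_assoc]

theorem s_lamM (hb : b.IsLeftBialgebroid) :
    b.s.hom ▷ (b.L ⊗ b.L).X ≫ lamM hb.takeuchi = (b.L ⊗ b.L).actLeft := by
  rw [← cancel_epi (R.X ◁ b.piLL), whisker_exchange_assoc, piLL_lamM, ← comp_whiskerRight_assoc,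
    s_comulL hb, ← Category.assoc, comp_whiskerRight_assoc, piLL_rhoLL,
    reassoc_of% insert_left_left b.s.hom, piLL_actLeft]

variable (b) in
/-- The morphism `b ↦ b ⊗ 1` from `A` to `L ⊗_R L`. -/
noncomputable def inclFst : A.X ⟶ (b.L ⊗ b.L).X := (ρ_ A.X).inv ≫ A.X ◁ η[A.X] ≫ b.piLL

variable (b) in
/-- The morphism `a ⊗ b ↦ a₁ b ⊗ a₂`, underlying the entwining map. -/
noncomputable def entw : A.X ⊗ A.X ⟶ (b.L ⊗ b.L).X := b.comulL ▷ A.X ≫ b.mulFst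

/-- Acting by `a` on `b ⊗ 1` gives `a₁b ⊗ a₂`. Balancedness, linearity and multiplicativity of the
entwining map all follow from this form. -/
theorem entw_eq_lamM (hb : b.IsLeftBialgebroid) : b.entw = A.X ◁ b.inclFst ≫ lamM hb.takeuchi := by
  rw [entw, inclFst, ← Category.assoc (ρ_ A.X).inv, MonoidalCategory.whiskerLeft_comp_assoc,
    piLL_lamM, whisker_exchange_assoc, rhoLL_one_right]

theorem mul_entw (hb : b.IsLeftBialgebroid) : μ[A.X] ▷ A.X ≫ b.entw =
    (α_ _ _ _).hom ≫ A.X ◁ b.entw ≫ lamM hb.takeuchi := by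
  rw [entw_eq_lamM hb, ← whisker_exchange_assoc, mul_lamM hb]
  simp

theorem inclFst_actLeft : R.X ◁ b.inclFst ≫ (b.L ⊗ b.L).actLeft =
    b.s.hom ▷ A.X ≫ μ[A.X] ≫ b.inclFst := by
  rw [inclFst, ← Category.assoc (ρ_ A.X).inv, MonoidalCategory.whiskerLeft_comp_assoc,
    piLL_actLeft]
  simp only [MonoidalCategory.whiskerLeft_comp, Category.assoc]
  rw [associator_inv_naturality_right_assoc, whisker_exchange_assoc]
  simp

theorem s_entw (hb : b.IsLeftBialgebroid) :
    b.s.hom ▷ A.X ≫ b.entw = b.s.hom ▷ A.X ≫ μ[A.X] ≫ b.inclFst := by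
  rw [entw_eq_lamM hb, ← whisker_exchange_assoc, s_lamM hb, inclFst_actLeft]

/-- `a s(r) ⊗ b` and `a ⊗ s(r)b` both give `a • (s(r)b ⊗ 1)`, by associativity of the action and
because `s(r)` acts as the scalar `r`. -/
theorem entw_balanced (hb : b.IsLeftBialgebroid) : (A.X ◁ b.s.hom ≫ μ[A.X]) ▷ A.X ≫ b.entw =
    (α_ _ _ _).hom ≫ A.X ◁ (b.s.hom ▷ A.X ≫ μ[A.X]) ≫ b.entw := by
  rw [comp_whiskerRight, Category.assoc, mul_entw hb, associator_naturality_middle_assoc,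
    ← MonoidalCategory.whiskerLeft_comp_assoc, s_entw hb]
  conv_rhs => rw [entw_eq_lamM hb]
  simp

theorem entw_actLeft (hb : b.IsLeftBialgebroid) :
    (α_ _ _ _).inv ≫ (b.s.hom ▷ A.X ≫ μ[A.X]) ▷ A.X ≫ b.entw =
    R.X ◁ b.entw ≫ (b.L ⊗ b.L).actLeft := by
  rw [comp_whiskerRight, Category.assoc, mul_entw hb, associator_naturality_left_assoc,
    Iso.inv_hom_id_assoc, ← whisker_exchange_assoc, s_lamM hb]

/-- Balancedness turns `t(r)b ⊗ 1` into `b ⊗ s(r)`, which exchanges the right action of `R` on `L`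
for that on `S`. -/
theorem inclFst_actRight : (A.X ◁ b.t ≫ (β_ A.X A.X).hom ≫ μ[A.X]) ≫ b.inclFst =
    b.inclFst ▷ R.X ≫ (b.L ⊗ b.L).X ◁ b.s.hom ≫ b.mulSnd := by
  have h := b.piLL_condition
  rw [inclFst, rightUnitor_inv_naturality_assoc, ← whisker_exchange_assoc, h]
  simp only [comp_whiskerRight, Category.assoc]
  rw [← whisker_exchange_assoc, piLL_mulSnd, associator_naturality_right_assoc,
    associator_naturality_right_assoc, associator_naturality_middle_assoc,
    ← MonoidalCategory.whiskerLeft_comp_assoc A.X, ← MonoidalCategory.whiskerLeft_comp_assoc A.X,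
    ← MonoidalCategory.whiskerLeft_comp_assoc A.X, Category.assoc, b.one_s_mul,
    ← whisker_exchange_assoc, MonObj.one_mul]
  simp

theorem entw_actRight (hb : b.IsLeftBialgebroid) :
    (α_ _ _ _).hom ≫ A.X ◁ (A.X ◁ b.t ≫ (β_ A.X A.X).hom ≫ μ[A.X]) ≫ b.entw =
    b.entw ▷ R.X ≫ (b.L ⊗ b.L).X ◁ b.s.hom ≫ b.mulSnd := by
  rw [entw_eq_lamM hb, ← MonoidalCategory.whiskerLeft_comp_assoc, inclFst_actRight,
    MonoidalCategory.whiskerLeft_comp_assoc, MonoidalCategory.whiskerLeft_comp_assoc, mulSnd_lamM,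
    associator_inv_naturality_right_assoc, whisker_exchange_assoc]
  simp

/-- The entwining map `S ⊗_R L ⟶ L ⊗_R S`, `a ⊗ b ↦ a₁ b ⊗ a₂`. -/
noncomputable def entwHom (hb : b.IsLeftBialgebroid) : b.S ⊗ b.L ⟶ b.L ⊗ b.S :=
  bimodDesc (M := b.S) (N := b.L) (P := b.L ⊗ b.S) b.entw (entw_balanced hb) (entw_actLeft hb)
    ((entw_actRight hb).trans (congrArg (b.entw ▷ R.X ≫ ·) b.LS_actRight.symm))

theorem toTens_entwHom (hb : b.IsLeftBialgebroid) :
    toTens b.S b.L ≫ (entwHom hb).hom = b.entw :=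
  toTens_bimodDesc _ _ _ _

theorem toTens_entwHom_rhoLS (hb : b.IsLeftBialgebroid) : toTens b.S b.L ≫ (entwHom hb).hom =
    (b.comulL ⊗ₘ ((ρ_ A.X).inv ≫ A.X ◁ η[A.X])) ≫ b.rhoLS := by
  rw [toTens_entwHom, entw, ← rhoLL_one_right, MonoidalCategory.tensorHom_def, Category.assoc]
  -- `rhoLL` and `rhoLS` agree definitionally, since `L ⊗_R L` and `L ⊗_R S` are the same
  -- coequalizer.
  rfl

end LeftBialgebroid

end BaseMaps

/-! ### The left entwining axioms tested on representatives -/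

section EntwiningCriteria

variable {C : Type u} [Category.{v} C] [MonoidalCategory C]
  [HasCoequalizers C]
  [∀ X : C, PreservesColimitsOfShape WalkingParallelPair (tensorLeft X)]
  [∀ X : C, PreservesColimitsOfShape WalkingParallelPair (tensorRight X)]
  {R : Mon C}

theorem toTens_associator_inv (M N P : Bimod R R) :
    M.X ◁ toTens N P ≫ toTens M (N ⊗ P) ≫ (α_ M N P).inv.hom =
      (α_ _ _ _).inv ≫ toTens M N ▷ P.X ≫ toTens (M ⊗ N) P := by
  have h := toTens_associator M N P =≫ (α_ M N P).inv.hom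
  simp only [Category.assoc, ← hom_comp, Iso.hom_inv_id] at h
  rw [hom_id, Category.comp_id] at h
  rw [h, Iso.inv_hom_id_assoc]

theorem rightUnitor_inv_hom (M : Bimod R R) :
    (ρ_ M).inv.hom = (ρ_ M.X).inv ≫ M.X ◁ η[R.X] ≫ toTens M (𝟙_ (Bimod R R)) := rfl

variable {S L : Bimod R R}

/-- The projection is an epimorphism, so the axiom is an identity in the base category; `he` is that
identity, with the inverse right unitor written out as `m ↦ m ⊗ 1`. -/
theorem entwining_one [MonObj S] (ψ : S ⊗ L ⟶ L ⊗ S) {e : S.X ⊗ L.X ⟶ (L ⊗ S).X}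
    (hψ : toTens S L ≫ ψ.hom = e)
    (he : fromR η[S] ▷ L.X ≫ e = L.actLeft ≫ (ρ_ L.X).inv ≫
      L.X ◁ (η[R.X] ≫ fromR η[S]) ≫ toTens L S) :
    η[S] ▷ L ≫ ψ = (λ_ L).hom ≫ (ρ_ L).inv ≫ L ◁ η[S] := by
  apply Bimod.hom_ext
  rw [← cancel_epi (toTens (𝟙_ (Bimod R R)) L), hom_comp, hom_comp, hom_comp,
    reassoc_of% toTens_whiskerRight, hψ, reassoc_of% toTens_leftUnitor, rightUnitor_inv_hom,
    Category.assoc]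
  have h : L.X ◁ (η[R.X] ≫ fromR η[S]) ≫ toTens L S =
      (L.X ◁ η[R.X] ≫ toTens L (𝟙_ (Bimod R R))) ≫ (L ◁ η[S]).hom := by
    rw [MonoidalCategory.whiskerLeft_comp_assoc]
    exact (congrArg (L.X ◁ η[R.X] ≫ ·) (toTens_whiskerLeft L η[S]).symm).trans
      (Category.assoc _ _ _).symm
  rw [h] at he
  exact he

theorem entwining_counit [ComonObj L] (ψ : S ⊗ L ⟶ L ⊗ S) {e : S.X ⊗ L.X ⟶ (L ⊗ S).X}
    (hψ : toTens S L ≫ ψ.hom = e) {k : (L ⊗ S).X ⟶ S.X}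
    (hk : toTens L S ≫ k = toR ε[L] ▷ S.X ≫ S.actLeft)
    (he : e ≫ k = S.X ◁ toR ε[L] ≫ S.actRight) :
    ψ ≫ ε[L] ▷ S = S ◁ ε[L] ≫ (ρ_ S).hom ≫ (λ_ S).inv := by
  rw [← cancel_mono (λ_ S).hom]
  apply Bimod.hom_ext
  have hk' : k = (ε[L] ▷ S ≫ (λ_ S).hom).hom := by
    rw [← cancel_epi (toTens L S), hk, hom_comp, reassoc_of% toTens_whiskerRight,
      toTens_leftUnitor]
    rfl
  rw [← cancel_epi (toTens S L), Category.assoc, hom_comp, ← hk', reassoc_of% hψ, he,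
    Category.assoc, Category.assoc, Iso.inv_hom_id, Category.comp_id, hom_comp,
    reassoc_of% toTens_whiskerLeft, toTens_rightUnitor]
  rfl

/-- The auxiliary `r` and `l` stand for `L ⊗ μ` and `(L ⊗ μ)(ψ ⊗ S)`, up to associators. Each is
pinned down by its value on representatives, so any morphism with that value may be supplied. -/
theorem entwining_mul [MonObj S] (ψ : S ⊗ L ⟶ L ⊗ S) {e : S.X ⊗ L.X ⟶ (L ⊗ S).X}
    (hψ : toTens S L ≫ ψ.hom = e) {m : S.X ⊗ S.X ⟶ S.X} (hm : toTens S S ≫ μ[S].hom = m)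
    {r : (L ⊗ S).X ⊗ S.X ⟶ (L ⊗ S).X}
    (hr : toTens L S ▷ S.X ≫ r = (α_ _ _ _).hom ≫ L.X ◁ m ≫ toTens L S)
    {l : S.X ⊗ (L ⊗ S).X ⟶ (L ⊗ S).X}
    (hl : S.X ◁ toTens L S ≫ l = (α_ _ _ _).inv ≫ e ▷ S.X ≫ r)
    (he : m ▷ L.X ≫ e = (α_ _ _ _).hom ≫ S.X ◁ e ≫ l) :
    μ[S] ▷ L ≫ ψ =
      (α_ S S L).hom ≫ S ◁ ψ ≫ (α_ S L S).inv ≫ ψ ▷ S ≫ (α_ L S S).hom ≫ L ◁ μ[S] := by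
  have hr' : toTens (L ⊗ S) S ≫ ((α_ L S S).hom ≫ L ◁ μ[S]).hom = r := by
    rw [← cancel_epi (toTens L S ▷ S.X), hr, hom_comp, reassoc_of% toTens_associator,
      toTens_whiskerLeft, ← MonoidalCategory.whiskerLeft_comp_assoc, hm]
  have hl' : toTens S (L ⊗ S) ≫ ((α_ S L S).inv ≫ ψ ▷ S ≫ (α_ L S S).hom ≫ L ◁ μ[S]).hom = l := by
    rw [← cancel_epi (S.X ◁ toTens L S), hl, hom_comp, reassoc_of% toTens_associator_inv,
      hom_comp, reassoc_of% toTens_whiskerRight, hr', ← comp_whiskerRight_assoc, hψ]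
  apply Bimod.hom_ext
  rw [← cancel_epi (toTens (S ⊗ S) L), ← cancel_epi (toTens S S ▷ L.X), hom_comp, hom_comp,
    hom_comp, reassoc_of% toTens_whiskerRight, hψ, ← comp_whiskerRight_assoc, hm, he,
    reassoc_of% toTens_associator, reassoc_of% toTens_whiskerLeft, hl',
    ← MonoidalCategory.whiskerLeft_comp_assoc, hψ]

/-- Here `k` stands for `γ ⊗ S`, `l` for `L ⊗ ψ` and `H` for `(L ⊗ ψ)(ψ ⊗ L)`, reassociated so as to
land in `L ⊗ (L ⊗ S)` and recognised on representatives. -/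
theorem entwining_comul [ComonObj L] (ψ : S ⊗ L ⟶ L ⊗ S) {e : S.X ⊗ L.X ⟶ (L ⊗ S).X}
    (hψ : toTens S L ≫ ψ.hom = e) {k : (L ⊗ S).X ⟶ (L ⊗ (L ⊗ S)).X}
    (hk : toTens L S ≫ k = Δ[L].hom ▷ S.X ≫ toTens (L ⊗ L) S ≫ (α_ L L S).hom.hom)
    {l : (L ⊗ S).X ⊗ L.X ⟶ (L ⊗ (L ⊗ S)).X}
    (hl : toTens L S ▷ L.X ≫ l = (α_ _ _ _).hom ≫ L.X ◁ e ≫ toTens L (L ⊗ S))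
    {H : S.X ⊗ (L ⊗ L).X ⟶ (L ⊗ (L ⊗ S)).X}
    (hH : S.X ◁ toTens L L ≫ H = (α_ _ _ _).inv ≫ e ▷ L.X ≫ l)
    (he : e ≫ k = S.X ◁ Δ[L].hom ≫ H) :
    ψ ≫ Δ[L] ▷ S = S ◁ Δ[L] ≫ (α_ S L L).inv ≫ ψ ▷ L ≫ (α_ L S L).hom ≫ L ◁ ψ ≫
      (α_ L L S).inv := by
  have hl' : toTens (L ⊗ S) L ≫ ((α_ L S L).hom ≫ L ◁ ψ).hom = l := by
    rw [← cancel_epi (toTens L S ▷ L.X), hl, hom_comp, reassoc_of% toTens_associator,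
      toTens_whiskerLeft, ← MonoidalCategory.whiskerLeft_comp_assoc, hψ]
  have hH' : toTens S (L ⊗ L) ≫ ((α_ S L L).inv ≫ ψ ▷ L ≫ (α_ L S L).hom ≫ L ◁ ψ).hom = H := by
    rw [← cancel_epi (S.X ◁ toTens L L), hH, hom_comp, reassoc_of% toTens_associator_inv,
      hom_comp, reassoc_of% toTens_whiskerRight, hl', ← comp_whiskerRight_assoc, hψ]
  have hk' : k = (Δ[L] ▷ S ≫ (α_ L L S).hom).hom := by
    rw [← cancel_epi (toTens L S), hk, hom_comp, reassoc_of% toTens_whiskerRight]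
  rw [← cancel_mono (α_ L L S).hom]
  apply Bimod.hom_ext
  simp only [Category.assoc, Iso.inv_hom_id, Category.comp_id]
  rw [← cancel_epi (toTens S L), hom_comp, ← hk', reassoc_of% hψ, he, hom_comp,
    reassoc_of% toTens_whiskerLeft, hH']

end EntwiningCriteria

namespace BaseMaps

/-! ### Unit, counit and multiplication axioms of the entwining map -/

section LeftEntwining

variable {C : Type u} [Category.{v} C] [MonoidalCategory C] [SymmetricCategory C]
  [HasCoequalizers C]
  [∀ X : C, PreservesColimitsOfShape WalkingParallelPair (tensorLeft X)]
  [∀ X : C, PreservesColimitsOfShape WalkingParallelPair (tensorRight X)]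
  {R A : Mon C} {b : BaseMaps R A} [ComonObj b.L]

/-- Multiplying by `t(r) ⊗ 1` or by `1 ⊗ s(r)` touches a single factor, so the Takeuchi axiom can be
read with one-factor multiplications alone. -/
theorem takeuchi_mul (h : b.LeftTakeuchi) :
    b.comulL ▷ R.X ≫ (b.L ⊗ b.L).X ◁ b.t ≫ b.mulFst =
      b.comulL ▷ R.X ≫ (b.L ⊗ b.L).X ◁ b.s.hom ≫ b.mulSnd := by
  have e1 : (ρ_ R.X).inv ≫ (b.t ⊗ₘ η[A.X]) = b.t ≫ (ρ_ A.X).inv ≫ A.X ◁ η[A.X] := by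
    rw [MonoidalCategory.tensorHom_def, rightUnitor_inv_naturality_assoc]
  have e2 : (λ_ R.X).inv ≫ (η[A.X] ⊗ₘ b.s.hom) = b.s.hom ≫ (λ_ A.X).inv ≫ η[A.X] ▷ A.X := by
    rw [MonoidalCategory.tensorHom_def', leftUnitor_inv_naturality_assoc]
  rw [← rhoLL_one_right, ← rhoLL_one_left, ← MonoidalCategory.whiskerLeft_comp_assoc,
    ← MonoidalCategory.whiskerLeft_comp_assoc, ← e1, ← e2]
  have h' := h
  rw [LeftTakeuchi, MonoidalCategory.tensorHom_def b.comulL,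
    MonoidalCategory.tensorHom_def b.comulL,
    Category.assoc, Category.assoc] at h'
  exact h'

variable (b) in
/-- The morphism `L ⊗_R L ⟶ L`, `x ⊗ y ↦ s (π x) y`. -/
noncomputable def counitFst : (b.L ⊗ b.L).X ⟶ A.X := (ε[b.L] ▷ b.L ≫ (λ_ b.L).hom).hom

theorem piLL_counitFst :
    b.piLL ≫ b.counitFst = b.counitL ▷ A.X ≫ b.s.hom ▷ A.X ≫ μ[A.X] := by
  have h : toTens b.L b.L ≫ (ε[b.L] ▷ b.L ≫ (λ_ b.L).hom).hom =
      ε[b.L].hom ▷ b.L.X ≫ b.L.actLeft := by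
    rw [hom_comp, reassoc_of% toTens_whiskerRight, toTens_leftUnitor]
  exact h

theorem comulL_counitFst : b.comulL ≫ b.counitFst = 𝟙 A.X := by
  have h : Δ[b.L] ≫ ε[b.L] ▷ b.L ≫ (λ_ b.L).hom = 𝟙 b.L := by simp
  exact congrArg Bimod.Hom.hom h

theorem mulSnd_counitFst : b.mulSnd ≫ b.counitFst = b.counitFst ▷ A.X ≫ μ[A.X] := by
  rw [← cancel_epi (b.piLL ▷ A.X), reassoc_of% piLL_mulSnd, ← comp_whiskerRight_assoc,
    piLL_counitFst, whisker_exchange_assoc, whisker_exchange_assoc]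
  simp

/-- By the axiom `π(xb) = π(x tπ(b))`, the multiplier `b` may be replaced by `tπ(b)` whenever `π` is
then applied to the first factor. -/
theorem mulFst_counitFst (hb : b.IsLeftBialgebroid) : b.mulFst ≫ b.counitFst =
    (b.L ⊗ b.L).X ◁ (b.counitL ≫ b.t) ≫ b.mulFst ≫ b.counitFst := by
  have h : (β_ A.X A.X).hom ≫ (b.counitL ≫ b.t) ▷ A.X =
      A.X ◁ (b.counitL ≫ b.t) ≫ (β_ A.X A.X).hom := by
    rw [BraidedCategory.braiding_naturality_right]
  rw [← cancel_epi (b.piLL ▷ A.X), ← whisker_exchange_assoc, reassoc_of% piLL_mulFst,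
    piLL_counitFst, associator_naturality_right_assoc,
    ← MonoidalCategory.whiskerLeft_comp_assoc, ← h, MonoidalCategory.whiskerLeft_comp_assoc,
    associator_inv_naturality_middle_assoc, ← comp_whiskerRight_assoc,
    ← comp_whiskerRight_assoc, ← comp_whiskerRight_assoc, Category.assoc]
  have m := hb.mul_counit_t =≫ b.s.hom
  simp only [Category.assoc] at m
  simp only [m]

/-- `s(π(a₁b))a₂ = s(π(a₁ tπ(b)))a₂ = s(π(a₁))a₂ sπ(b) = a sπ(b)`; the middle equality is the
Takeuchi axiom at `r = π(b)`, the last is counitality. -/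
theorem entw_counitFst (hb : b.IsLeftBialgebroid) :
    b.entw ≫ b.counitFst = A.X ◁ b.counitL ≫ A.X ◁ b.s.hom ≫ μ[A.X] := by
  rw [entw, Category.assoc, mulFst_counitFst hb, ← whisker_exchange_assoc,
    MonoidalCategory.whiskerLeft_comp_assoc, whisker_exchange_assoc,
    reassoc_of% takeuchi_mul hb.takeuchi, mulSnd_counitFst,
    whisker_exchange_assoc b.counitFst b.s.hom, ← comp_whiskerRight_assoc, comulL_counitFst]
  simp

theorem entwHom_one (hb : b.IsLeftBialgebroid) : η[b.S] ▷ b.L ≫ entwHom hb =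
    (λ_ b.L).hom ≫ (ρ_ b.L).inv ≫ b.L ◁ η[b.S] := by
  refine entwining_one _ (toTens_entwHom hb) ?_
  have h := s_entw hb
  rw [inclFst, ← IsMonHom.one_hom b.s.hom, ← Category.assoc] at h
  exact h

theorem entwHom_counit (hb : b.IsLeftBialgebroid) : entwHom hb ≫ ε[b.L] ▷ b.S =
    b.S ◁ ε[b.L] ≫ (ρ_ b.S).hom ≫ (λ_ b.S).inv :=
  entwining_counit _ (toTens_entwHom hb) (k := b.counitFst) piLL_counitFst (entw_counitFst hb)

theorem inclFst_mulSnd : b.inclFst ▷ A.X ≫ b.mulSnd = b.piLL := by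
  rw [inclFst, ← Category.assoc, comp_whiskerRight_assoc, piLL_mulSnd, comp_whiskerRight_assoc,
    associator_naturality_middle_assoc, ← MonoidalCategory.whiskerLeft_comp_assoc,
    MonObj.one_mul]
  simp

/-- As `b ⊗ c` is `b ⊗ 1` multiplied by `c` in the second factor, `a • (b ⊗ c)` is `ψ(a ⊗ b)`
multiplied by `c` there. The action thus plays the role of `(L ⊗ μ)(ψ ⊗ S)`, and the multiplication
axiom becomes its associativity. -/
theorem entw_mulSnd (hb : b.IsLeftBialgebroid) : A.X ◁ b.piLL ≫ lamM hb.takeuchi =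
    (α_ _ _ _).inv ≫ b.entw ▷ A.X ≫ b.mulSnd := by
  rw [entw_eq_lamM hb, comp_whiskerRight_assoc]
  have h := mulSnd_lamM hb.takeuchi
  rw [← cancel_epi (α_ _ _ _).hom, Iso.hom_inv_id_assoc] at h
  rw [← h, associator_naturality_middle_assoc, Iso.inv_hom_id_assoc,
    ← MonoidalCategory.whiskerLeft_comp_assoc, inclFst_mulSnd]

theorem entwHom_mul (hb : b.IsLeftBialgebroid) : μ[b.S] ▷ b.L ≫ entwHom hb =
    (α_ b.S b.S b.L).hom ≫ b.S ◁ entwHom hb ≫ (α_ b.S b.L b.S).inv ≫ entwHom hb ▷ b.S ≫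
      (α_ b.L b.S b.S).hom ≫ b.L ◁ μ[b.S] :=
  entwining_mul _ (toTens_entwHom hb) b.toTens_mulS (r := b.mulSnd) b.piLL_mulSnd
    (l := lamM hb.takeuchi) (entw_mulSnd hb) (mul_entw hb)

theorem actRight_comulL : (A.X ◁ b.t ≫ (β_ A.X A.X).hom ≫ μ[A.X]) ≫ b.comulL =
    b.comulL ▷ R.X ≫ (b.L ⊗ b.L).actRight :=
  Δ[b.L].right_act_hom

/-- `t(r)` is `1 · r` in `L`, and `γ` is right `R`-linear with `γ(1) = 1 ⊗ 1`. -/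
theorem t_comulL (hb : b.IsLeftBialgebroid) :
    b.t ≫ b.comulL = (λ_ R.X).inv ≫ (η[A.X] ⊗ₘ b.t) ≫ b.piLL := by
  have h := b.actRight_comulL
  simp only [Category.assoc] at h
  rw [← cancel_epi (λ_ R.X).hom, ← reassoc_of% b.one_t_mul, h, ← comp_whiskerRight_assoc,
    hb.one_comul, MonoidalCategory.tensorHom_def]
  simp only [comp_whiskerRight, Category.assoc]
  rw [piLL_actRight, associator_naturality_middle_assoc,
    ← MonoidalCategory.whiskerLeft_comp_assoc, one_t_mul, associator_naturality_left_assoc,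
    ← whisker_exchange_assoc, MonoidalCategory.tensorHom_def']
  simp only [Category.assoc, MonoidalCategory.whiskerLeft_comp]
  monoidal

theorem t_lamM (hb : b.IsLeftBialgebroid) : b.t ▷ (b.L ⊗ b.L).X ≫ lamM hb.takeuchi =
    (β_ _ _).hom ≫ (b.L ⊗ b.L).actRight := by
  rw [← cancel_epi (R.X ◁ b.piLL), whisker_exchange_assoc, piLL_lamM, ← comp_whiskerRight_assoc,
    t_comulL hb, ← Category.assoc, comp_whiskerRight_assoc, piLL_rhoLL,
    reassoc_of% insert_left_right b.t, BraidedCategory.braiding_naturality_right_assoc,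
    piLL_actRight, BraidedCategory.braiding_tensor_right_hom]
  simp only [Category.assoc, Iso.inv_hom_id_assoc]
  rw [← MonoidalCategory.whiskerLeft_comp_assoc A.X (β_ R.X A.X).hom,
    ← BraidedCategory.braiding_naturality_left_assoc, SymmetricCategory.symmetry_assoc]

/-- Since `t(r)` acts through the right `R`-action of `L ⊗_R L`, associativity of the action
suffices. This allows the action to be applied to the first factor of a further tensor product. -/
theorem lamM_actRight (hb : b.IsLeftBialgebroid) :
    (A.X ◁ b.t ≫ (β_ A.X A.X).hom ≫ μ[A.X]) ▷ (b.L ⊗ b.L).X ≫ lamM hb.takeuchi =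
      (α_ _ _ _).hom ≫ A.X ◁ (β_ R.X (b.L ⊗ b.L).X).hom ≫ (α_ _ _ _).inv ≫
        lamM hb.takeuchi ▷ R.X ≫ (b.L ⊗ b.L).actRight := by
  rw [BraidedCategory.braiding_naturality_right_assoc, comp_whiskerRight_assoc,
    comp_whiskerRight_assoc, mul_lamM hb, associator_naturality_left_assoc,
    ← whisker_exchange_assoc, t_lamM hb, BraidedCategory.braiding_naturality_right_assoc,
    BraidedCategory.braiding_tensor_right_hom]
  simp only [Category.assoc, Iso.hom_inv_id_assoc]
  rw [← comp_whiskerRight_assoc, SymmetricCategory.symmetry, id_whiskerRight, Category.id_comp]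

end LeftEntwining

end BaseMaps

namespace BaseMaps

/-! ### Comultiplication axiom of the entwining map -/

section LeftEntwiningComul

variable {C : Type u} [Category.{v} C] [MonoidalCategory C] [SymmetricCategory C]
  [HasCoequalizers C]
  [∀ X : C, PreservesColimitsOfShape WalkingParallelPair (tensorLeft X)]
  [∀ X : C, PreservesColimitsOfShape WalkingParallelPair (tensorRight X)]
  {R A : Mon C} (b : BaseMaps R A)

/-- `x ⊗ y = (1 ⊗ y)(x ⊗ 1)` in `A ⊗ A`, so acting by it is a multiplication of the second factor
followed by one of the first. -/
theorem rhoLL_eq : b.rhoLL =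
    (b.L ⊗ b.L).X ◁ (β_ A.X A.X).hom ≫ (α_ _ _ _).inv ≫ b.mulSnd ▷ A.X ≫ b.mulFst := by
  have e : ((λ_ A.X).inv ≫ η[A.X] ▷ A.X) ▷ A.X ≫ (A.X ⊗ A.X) ◁ ((ρ_ A.X).inv ≫ A.X ◁ η[A.X]) ≫
      μ[A.X ⊗ A.X] = (β_ A.X A.X).hom := by
    have h := insert_left_right (𝟙 A.X)
    rw [MonoidalCategory.tensorHom_id] at h
    rw [← whisker_exchange_assoc, h, id_whiskerRight, Category.id_comp,
      MonoidalCategory.whiskerLeft_comp_assoc, associator_inv_naturality_right_assoc,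
      whisker_exchange_assoc, associator_naturality_right_assoc,
      ← MonoidalCategory.whiskerLeft_comp, MonObj.mul_one]
    monoidal
  have h2 : b.mulSnd ▷ A.X ≫ b.mulFst =
      (α_ _ _ _).hom ≫ (b.L ⊗ b.L).X ◁ (β_ A.X A.X).hom ≫ b.rhoLL := by
    rw [← e, ← rhoLL_one_left, ← rhoLL_one_right, comp_whiskerRight_assoc,
      ← whisker_exchange_assoc, rhoLL_assoc]
    monoidal
  rw [h2, Iso.inv_hom_id_assoc, ← MonoidalCategory.whiskerLeft_comp_assoc,
    SymmetricCategory.symmetry, MonoidalCategory.whiskerLeft_id, Category.id_comp]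

theorem mulFst_actLeft : (b.L ⊗ b.L).actLeft ▷ A.X ≫ b.mulFst =
    (α_ _ _ _).hom ≫ R.X ◁ b.mulFst ≫ (b.L ⊗ b.L).actLeft := by
  have h := b.S_mul_left
  generalize hk : b.s.hom ▷ A.X ≫ μ[A.X] = k at h
  rw [← cancel_epi ((R.X ◁ b.piLL) ▷ A.X), ← comp_whiskerRight_assoc, piLL_actLeft,
    associator_naturality_middle_assoc, ← MonoidalCategory.whiskerLeft_comp_assoc, piLL_mulFst, hk]
  simp only [MonoidalCategory.whiskerLeft_comp, comp_whiskerRight, Category.assoc]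
  rw [piLL_mulFst, piLL_actLeft, hk, associator_naturality_left_assoc, ← whisker_exchange_assoc,
    associator_inv_naturality_left_assoc, associator_inv_naturality_middle_assoc,
    ← comp_whiskerRight_assoc (R.X ◁ μ[A.X]), h]
  monoidal

/-- Right multiplication of the second factor of `L ⊗_R L ⊗_R L`. -/
noncomputable def mulSndThree : (b.L ⊗ (b.L ⊗ b.L)).X ⊗ A.X ⟶ (b.L ⊗ (b.L ⊗ b.L)).X :=
  tensSnd b.L (N := b.L ⊗ b.L) (N' := b.L ⊗ b.L) b.mulFst b.mulFst_actLeft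

/-- Right multiplication of the first factor of `L ⊗_R L ⊗_R L`. -/
noncomputable def mulFstThree : (b.L ⊗ (b.L ⊗ b.L)).X ⊗ A.X ⟶ (b.L ⊗ (b.L ⊗ b.L)).X :=
  tensFst (M := b.L) (M' := b.L) (b.L ⊗ b.L) μ[A.X] b.L_mul_right

/-- The projection `(L ⊗_R L) ⊗ L ⟶ L ⊗_R (L ⊗_R L)`. -/
noncomputable def projThree : (b.L ⊗ b.L).X ⊗ A.X ⟶ (b.L ⊗ (b.L ⊗ b.L)).X :=
  toTens (b.L ⊗ b.L) b.L ≫ (α_ b.L b.L b.L).hom.hom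

/-- The projection `L ⊗ (L ⊗_R L) ⟶ L ⊗_R (L ⊗_R L)`. -/
noncomputable def projThree' : A.X ⊗ (b.L ⊗ b.L).X ⟶ (b.L ⊗ (b.L ⊗ b.L)).X :=
  toTens b.L (b.L ⊗ b.L)

theorem piLL_projThree : b.piLL ▷ A.X ≫ b.projThree =
    (α_ _ _ _).hom ≫ A.X ◁ b.piLL ≫ b.projThree' :=
  toTens_associator b.L b.L b.L

theorem projThree'_mulSndThree : b.projThree' ▷ A.X ≫ b.mulSndThree =
    (α_ _ _ _).hom ≫ A.X ◁ b.mulFst ≫ b.projThree' :=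
  toTens_tensSnd b.L (N := b.L ⊗ b.L) (N' := b.L ⊗ b.L) b.mulFst b.mulFst_actLeft

theorem projThree'_mulFstThree : b.projThree' ▷ A.X ≫ b.mulFstThree =
    (α_ _ _ _).hom ≫ A.X ◁ (β_ (b.L ⊗ b.L).X A.X).hom ≫ (α_ _ _ _).inv ≫
      μ[A.X] ▷ (b.L ⊗ b.L).X ≫ b.projThree' :=
  toTens_tensFst (M := b.L) (M' := b.L) (b.L ⊗ b.L) μ[A.X] b.L_mul_right

theorem mulFst_projThree : (α_ _ _ _).hom ≫ (b.L ⊗ b.L).X ◁ (β_ A.X A.X).hom ≫ (α_ _ _ _).inv ≫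
    b.mulFst ▷ A.X ≫ b.projThree = b.projThree ▷ A.X ≫ b.mulFstThree := by
  rw [← cancel_epi (b.piLL ▷ A.X ▷ A.X), ← comp_whiskerRight_assoc _ b.projThree, piLL_projThree,
    associator_naturality_left_assoc, ← whisker_exchange_assoc,
    associator_inv_naturality_left_assoc, ← comp_whiskerRight_assoc, piLL_mulFst]
  simp only [comp_whiskerRight, Category.assoc]
  rw [piLL_projThree, projThree'_mulFstThree, associator_naturality_middle_assoc,
    ← MonoidalCategory.whiskerLeft_comp_assoc A.X (b.piLL ▷ A.X),
    BraidedCategory.braiding_naturality_left, MonoidalCategory.whiskerLeft_comp_assoc,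
    associator_inv_naturality_right_assoc, whisker_exchange_assoc,
    associator_naturality_left_assoc, BraidedCategory.braiding_tensor_left_hom]
  simp only [MonoidalCategory.whiskerLeft_comp, Category.assoc]
  monoidal

theorem mulSnd_projThree : (α_ _ _ _).hom ≫ (b.L ⊗ b.L).X ◁ (β_ A.X A.X).hom ≫ (α_ _ _ _).inv ≫
    b.mulSnd ▷ A.X ≫ b.projThree = b.projThree ▷ A.X ≫ b.mulSndThree := by
  rw [← cancel_epi (b.piLL ▷ A.X ▷ A.X), ← comp_whiskerRight_assoc _ b.projThree, piLL_projThree,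
    associator_naturality_left_assoc, ← whisker_exchange_assoc,
    associator_inv_naturality_left_assoc, ← comp_whiskerRight_assoc, piLL_mulSnd]
  simp only [comp_whiskerRight, Category.assoc]
  rw [piLL_projThree, projThree'_mulSndThree, associator_naturality_middle_assoc A.X b.piLL A.X,
    ← MonoidalCategory.whiskerLeft_comp_assoc A.X (b.piLL ▷ A.X), piLL_mulFst]
  simp only [MonoidalCategory.whiskerLeft_comp, Category.assoc]
  monoidal

/-- By `rhoLL_eq`, it is enough that each one-factor multiplication commutes with adjoining a third
factor. -/
theorem rhoLL_projThree : (α_ _ _ _).hom ≫ (b.L ⊗ b.L).X ◁ (β_ A.X (A.X ⊗ A.X)).hom ≫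
    (α_ _ _ _).inv ≫ b.rhoLL ▷ A.X ≫ b.projThree =
    b.projThree ▷ (A.X ⊗ A.X) ≫ (b.L ⊗ (b.L ⊗ b.L)).X ◁ (β_ A.X A.X).hom ≫ (α_ _ _ _).inv ≫
      b.mulSndThree ▷ A.X ≫ b.mulFstThree := by
  rw [← whisker_exchange_assoc, associator_inv_naturality_left_assoc,
    ← comp_whiskerRight_assoc, ← mulSnd_projThree]
  simp only [comp_whiskerRight, Category.assoc]
  rw [← mulFst_projThree, rhoLL_eq, associator_naturality_left_assoc, ← whisker_exchange_assoc,
    associator_inv_naturality_left_assoc]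
  have e : (b.L ⊗ b.L).X ◁ (β_ A.X (A.X ⊗ A.X)).hom ≫ (α_ _ _ _).inv ≫
      ((b.L ⊗ b.L).X ◁ (β_ A.X A.X).hom) ▷ A.X =
      (b.L ⊗ b.L).X ◁ A.X ◁ (β_ A.X A.X).hom ≫ (b.L ⊗ b.L).X ◁ (β_ A.X (A.X ⊗ A.X)).hom ≫
        (α_ _ _ _).inv := by
    rw [← associator_inv_naturality_middle, ← MonoidalCategory.whiskerLeft_comp_assoc,
      ← MonoidalCategory.whiskerLeft_comp_assoc, BraidedCategory.braiding_naturality_right]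
  simp only [comp_whiskerRight, Category.assoc]
  rw [reassoc_of% e, BraidedCategory.braiding_tensor_right_hom]
  simp only [MonoidalCategory.whiskerLeft_comp, Category.assoc]
  monoidal

variable [ComonObj b.L]
variable {b}

variable (b) in
/-- The comultiplication of the first factor of `L ⊗_R L`. -/
noncomputable def comulFst : (b.L ⊗ b.L).X ⟶ (b.L ⊗ (b.L ⊗ b.L)).X :=
  (Δ[b.L] ▷ b.L ≫ (α_ b.L b.L b.L).hom).hom

variable (b) in
/-- The comultiplication of the second factor of `L ⊗_R L`. -/
noncomputable def comulSnd : (b.L ⊗ b.L).X ⟶ (b.L ⊗ (b.L ⊗ b.L)).X := (b.L ◁ Δ[b.L]).hom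

theorem piLL_comulFst : b.piLL ≫ b.comulFst = b.comulL ▷ A.X ≫ b.projThree := by
  have h : toTens b.L b.L ≫ (Δ[b.L] ▷ b.L ≫ (α_ b.L b.L b.L).hom).hom =
      Δ[b.L].hom ▷ b.L.X ≫ toTens (b.L ⊗ b.L) b.L ≫ (α_ b.L b.L b.L).hom.hom := by
    rw [hom_comp, reassoc_of% toTens_whiskerRight]
  exact h

theorem piLL_comulSnd : b.piLL ≫ b.comulSnd = A.X ◁ b.comulL ≫ b.projThree' :=
  toTens_whiskerLeft b.L Δ[b.L]

theorem comulL_coassoc : b.comulL ≫ b.comulFst = b.comulL ≫ b.comulSnd :=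
  congrArg Bimod.Hom.hom (ComonObj.comul_assoc b.L).symm

/-- The action `a ⊗ z ↦ a₁ z ⊗ a₂` applied to the first factor of `L ⊗_R L`. -/
noncomputable def lamFst (hb : b.IsLeftBialgebroid) :
    (b.L ⊗ b.L).X ⊗ (b.L ⊗ b.L).X ⟶ (b.L ⊗ (b.L ⊗ b.L)).X :=
  tensFst (M := b.L) (M' := b.L ⊗ b.L) b.L (lamM hb.takeuchi) (lamM_actRight hb) ≫
    (α_ b.L b.L b.L).hom.hom

theorem piLL_lamFst (hb : b.IsLeftBialgebroid) : b.piLL ▷ (b.L ⊗ b.L).X ≫ lamFst hb =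
    (α_ _ _ _).hom ≫ A.X ◁ (β_ _ _).hom ≫ (α_ _ _ _).inv ≫ lamM hb.takeuchi ▷ A.X ≫
      b.projThree :=
  toTens_tensFst_assoc (M := b.L) (M' := b.L ⊗ b.L) b.L (lamM hb.takeuchi) (lamM_actRight hb) _

theorem mulFst_comulFst (hb : b.IsLeftBialgebroid) :
    b.mulFst ≫ b.comulFst = (b.L ⊗ b.L).X ◁ b.comulL ≫ lamFst hb := by
  rw [← cancel_epi (b.piLL ▷ A.X), reassoc_of% piLL_mulFst, piLL_comulFst,
    ← comp_whiskerRight_assoc, hb.mul_comul, ← whisker_exchange_assoc, piLL_lamFst,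
    associator_naturality_right_assoc, ← MonoidalCategory.whiskerLeft_comp_assoc A.X (A.X ◁ _),
    BraidedCategory.braiding_naturality_right]
  simp

/-- Acting on a representative `b ⊗ c` by the first factor of `x ⊗ y` gives `x₁b ⊗ x₂c ⊗ y`.
Separating `γ` from the multiplications by `b` and `c` prepares for coassociativity. -/
theorem piLL_lamFst_eq (hb : b.IsLeftBialgebroid) :
    (b.L ⊗ b.L).X ◁ b.piLL ≫ lamFst hb = b.comulFst ▷ (A.X ⊗ A.X) ≫
      (b.L ⊗ (b.L ⊗ b.L)).X ◁ (β_ A.X A.X).hom ≫ (α_ _ _ _).inv ≫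
        b.mulSndThree ▷ A.X ≫ b.mulFstThree := by
  rw [← cancel_epi (b.piLL ▷ (A.X ⊗ A.X)), ← comp_whiskerRight_assoc, piLL_comulFst,
    comp_whiskerRight_assoc, ← rhoLL_projThree, ← whisker_exchange_assoc, piLL_lamFst,
    associator_naturality_right_assoc, ← MonoidalCategory.whiskerLeft_comp_assoc A.X (A.X ◁ _),
    BraidedCategory.braiding_naturality_right, MonoidalCategory.whiskerLeft_comp_assoc,
    associator_inv_naturality_middle_assoc, ← comp_whiskerRight_assoc, piLL_lamM,
    associator_naturality_left_assoc, ← whisker_exchange_assoc,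
    associator_inv_naturality_left_assoc, comp_whiskerRight_assoc]

/-- The morphism `(x ⊗ y) ⊗ c ↦ x ⊗ y₁ c ⊗ y₂`. -/
noncomputable def entwSnd (hb : b.IsLeftBialgebroid) :
    (b.L ⊗ b.L).X ⊗ A.X ⟶ (b.L ⊗ (b.L ⊗ b.L)).X :=
  tensSnd b.L (N := b.L) (N' := b.L ⊗ b.L) b.entw (by
    have h := entw_actLeft hb
    rw [← cancel_epi (α_ _ _ _).hom, Iso.hom_inv_id_assoc] at h
    exact h)

theorem piLL_entwSnd (hb : b.IsLeftBialgebroid) :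
    b.piLL ▷ A.X ≫ entwSnd hb = (α_ _ _ _).hom ≫ A.X ◁ b.entw ≫ b.projThree' :=
  toTens_tensSnd b.L (N := b.L) (N' := b.L ⊗ b.L) b.entw _

theorem comulSnd_mulSndThree (hb : b.IsLeftBialgebroid) :
    b.comulSnd ▷ A.X ≫ b.mulSndThree = entwSnd hb := by
  rw [← cancel_epi (b.piLL ▷ A.X), ← comp_whiskerRight_assoc, piLL_comulSnd,
    comp_whiskerRight_assoc, projThree'_mulSndThree, piLL_entwSnd, entw]
  simp

theorem mulFst_entwSnd (hb : b.IsLeftBialgebroid) : b.mulFst ▷ A.X ≫ entwSnd hb =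
    (α_ _ _ _).hom ≫ (b.L ⊗ b.L).X ◁ (β_ _ _).hom ≫ (α_ _ _ _).inv ≫ entwSnd hb ▷ A.X ≫
      b.mulFstThree :=
  tensFst_tensSnd (M := b.L) (M' := b.L) (N := b.L) (N' := b.L ⊗ b.L) μ[A.X] b.L_mul_right
    b.entw _

/-- The morphism `a ⊗ (b ⊗ c) ↦ a₁ b ⊗ a₂ c ⊗ a₃`. -/
noncomputable def entwThree (hb : b.IsLeftBialgebroid) :
    A.X ⊗ (b.L ⊗ b.L).X ⟶ (b.L ⊗ (b.L ⊗ b.L)).X :=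
  b.comulL ▷ (b.L ⊗ b.L).X ≫ lamFst hb

/-- Both sides are `a₁b ⊗ a₂c ⊗ a₃`. Coassociativity replaces `(γ ⊗ L)γ(a)` by `(L ⊗ γ)γ(a)`;
multiplying the middle factor by `c` then entwines the second leg with `c`, and multiplying the
first by `b` completes `ψ(a ⊗ b)`. -/
theorem piLL_entwThree (hb : b.IsLeftBialgebroid) : A.X ◁ b.piLL ≫ entwThree hb =
    (α_ _ _ _).inv ≫ b.entw ▷ A.X ≫ entwSnd hb := by
  rw [entwThree, whisker_exchange_assoc, piLL_lamFst_eq, ← comp_whiskerRight_assoc,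
    comulL_coassoc, comp_whiskerRight_assoc, ← whisker_exchange_assoc,
    associator_inv_naturality_left_assoc, ← comp_whiskerRight_assoc (b.comulSnd ▷ A.X),
    comulSnd_mulSndThree hb, entw, comp_whiskerRight_assoc, mulFst_entwSnd]
  simp

theorem entw_comulFst (hb : b.IsLeftBialgebroid) :
    b.entw ≫ b.comulFst = A.X ◁ b.comulL ≫ entwThree hb := by
  rw [entw, Category.assoc, mulFst_comulFst hb, entwThree, whisker_exchange_assoc]

theorem entwHom_comul (hb : b.IsLeftBialgebroid) : entwHom hb ≫ Δ[b.L] ▷ b.S =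
    b.S ◁ Δ[b.L] ≫ (α_ b.S b.L b.L).inv ≫ entwHom hb ▷ b.L ≫ (α_ b.L b.S b.L).hom ≫
      b.L ◁ entwHom hb ≫ (α_ b.L b.L b.S).inv :=
  entwining_comul _ (toTens_entwHom hb) (k := b.comulFst) piLL_comulFst (l := entwSnd hb)
    (piLL_entwSnd hb) (H := entwThree hb) (piLL_entwThree hb) (entw_comulFst hb)

theorem isLeftEntwining_entwHom (hb : b.IsLeftBialgebroid) : IsLeftEntwining (entwHom hb) where
  one := entwHom_one hb
  counit := entwHom_counit hb
  mul := entwHom_mul hb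
  comul := entwHom_comul hb

end LeftEntwiningComul

end BaseMaps

/-! ### Transposing a left entwining structure -/

section DualEntwining

variable {D : Type u} [Category.{v} D] [MonoidalCategory D]

theorem dualMap_id {X X' : D} [ExactPairing X' X] : dualMap (X' := X') (Y' := X') (𝟙 X) = 𝟙 X' :=
  dualMap_eq (by simp)

theorem dualMap_rightUnitor_hom {X X' : D} [ExactPairing X' X] :
    dualMap (X' := 𝟙_ D ⊗ X') (Y' := X') (ρ_ X).hom = (λ_ X').inv := by
  rw [← cancel_mono (λ_ X').hom, ← dualMap_rightUnitor_inv (X := X) (X' := X'), ← dualMap_comp,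
    Iso.inv_hom_id, dualMap_id, dualMap_rightUnitor_inv, Iso.inv_hom_id]

theorem dualMap_leftUnitor_hom {X X' : D} [ExactPairing X' X] :
    dualMap (X' := X' ⊗ 𝟙_ D) (Y' := X') (λ_ X).hom = (ρ_ X').inv := by
  rw [← cancel_mono (ρ_ X').hom, ← dualMap_leftUnitor_inv (X := X) (X' := X'), ← dualMap_comp,
    Iso.inv_hom_id, dualMap_id, dualMap_leftUnitor_inv, Iso.inv_hom_id]

theorem dualMap_associator_inv {X Y Z X' Y' Z' : D} [ExactPairing X' X] [ExactPairing Y' Y]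
    [ExactPairing Z' Z] :
    dualMap (X' := (Z' ⊗ Y') ⊗ X') (Y' := Z' ⊗ (Y' ⊗ X')) (α_ X Y Z).inv =
      (α_ Z' Y' X').inv := by
  rw [← cancel_mono (α_ Z' Y' X').hom, ← dualMap_associator (X := X) (Y := Y) (Z := Z),
    ← dualMap_comp, Iso.hom_inv_id, dualMap_id, dualMap_associator, Iso.inv_hom_id]

/-- The dual of a left entwining structure is a right entwining structure. -/
theorem IsLeftEntwining.isRightEntwining_dualMap {S L S' L' : D} [ExactPairing S' S]
    [ExactPairing L' L] [MonObj S] [ComonObj L] [ComonObj S'] [MonObj L']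
    (hε : ε[S'] = dualMap (X' := 𝟙_ D) (Y' := S') η[S])
    (hΔ : Δ[S'] = dualMap (X' := S' ⊗ S') (Y' := S') μ[S])
    (hη : η[L'] = dualMap (X' := L') (Y' := 𝟙_ D) ε[L])
    (hμ : μ[L'] = dualMap (X' := L') (Y' := L' ⊗ L') Δ[L])
    {ψ : S ⊗ L ⟶ L ⊗ S} (h : IsLeftEntwining ψ) :
    IsRightEntwining (dualMap (X' := L' ⊗ S') (Y' := S' ⊗ L') ψ) where
  one := by
    -- Transposition reverses composites and exchanges the two whiskerings, so the counit axiom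
    -- becomes the unit axiom, and similarly below. The chosen dual of each intermediate object is
    -- supplied explicitly.
    rw [hη, ← dualMap_whiskerRight (X := S), ← dualMap_comp, h.counit,
      dualMap_comp (Y' := 𝟙_ D ⊗ S'), dualMap_comp (Y' := S'),
      dualMap_whiskerLeft, dualMap_rightUnitor_hom, dualMap_leftUnitor_inv, Category.assoc]
  counit := by
    rw [hε, ← dualMap_whiskerRight (X := L), ← dualMap_comp, h.one,
      dualMap_comp (Y' := L'), dualMap_comp (Y' := 𝟙_ D ⊗ L'),
      dualMap_whiskerLeft, dualMap_leftUnitor_hom, dualMap_rightUnitor_inv, Category.assoc]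
  mul := by
    rw [hμ, ← dualMap_whiskerRight (X := S), ← dualMap_comp, h.comul,
      dualMap_comp (Y' := (L' ⊗ L') ⊗ S'), dualMap_comp (Y' := L' ⊗ (L' ⊗ S')),
      dualMap_comp (Y' := L' ⊗ (S' ⊗ L')), dualMap_comp (Y' := (L' ⊗ S') ⊗ L'),
      dualMap_comp (Y' := (S' ⊗ L') ⊗ L'), dualMap_associator_inv, dualMap_associator_inv,
      dualMap_associator, dualMap_whiskerLeft, dualMap_whiskerLeft, dualMap_whiskerRight]
    simp only [Category.assoc]
  comul := by
    rw [hΔ, ← dualMap_whiskerRight (X := L), ← dualMap_comp, h.mul,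
      dualMap_comp (Y' := (L' ⊗ S') ⊗ S'), dualMap_comp (Y' := (S' ⊗ L') ⊗ S'),
      dualMap_comp (Y' := S' ⊗ (L' ⊗ S')), dualMap_comp (Y' := S' ⊗ (S' ⊗ L')),
      dualMap_comp (Y' := (S' ⊗ S') ⊗ L'), dualMap_associator_inv, dualMap_associator,
      dualMap_associator, dualMap_whiskerLeft, dualMap_whiskerLeft, dualMap_whiskerRight]
    simp only [Category.assoc]

end DualEntwining

/-! ### The unit of a monoid of bimodules as a monoid morphism -/

section DualBase

variable {C : Type u} [Category.{v} C] [MonoidalCategory C] [SymmetricCategory C]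
  [HasCoequalizers C]
  [∀ X : C, PreservesColimitsOfShape WalkingParallelPair (tensorLeft X)]
  [∀ X : C, PreservesColimitsOfShape WalkingParallelPair (tensorRight X)]
  {R : Mon C}

/-- Left linearity gives `η(rr') = r · η(r')`, and in a monoid of bimodules scalars act through the
unit. -/
theorem mul_fromR_one (M : Bimod R R) [MonObj M] :
    μ[R.X] ≫ fromR η[M] = (fromR η[M] ⊗ₘ fromR η[M]) ≫ μ[(forgetMon M).X] := by
  have h : μ[R.X] ≫ fromR η[M] = R.X ◁ fromR η[M] ≫ M.actLeft := η[M].left_act_hom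
  rw [h, ← one_mul_fromR, MonoidalCategory.tensorHom_def']
  exact (Category.assoc _ _ _).symm

/-- The unit of a monoid in the category of bimodules, as a monoid morphism. -/
noncomputable def unitMon (M : Bimod R R) [MonObj M] : R ⟶ forgetMon M where
  hom := fromR η[M]
  isMonHom_hom :=
    { one_hom := rfl
      mul_hom := mul_fromR_one M }

end DualBase

/-! ### The action `a ⊗ χ ↦ a·χ` of the dual of `L` on `A` -/

section DualAction

variable {C : Type u} [Category.{v} C] [MonoidalCategory C] [SymmetricCategory C]
  [HasCoequalizers C]
  [∀ X : C, PreservesColimitsOfShape WalkingParallelPair (tensorLeft X)]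
  [∀ X : C, PreservesColimitsOfShape WalkingParallelPair (tensorRight X)]
  {R A : Mon C}

namespace BaseMaps

variable (b : BaseMaps R A) (Lr : Bimod R R) [MonObj Lr] [ExactPairing Lr b.L]

/-- The evaluation of `L` on its right dual, as a morphism of `C`. -/
noncomputable def evL : A.X ⊗ (forgetMon Lr).X ⟶ R.X := pairing b.L Lr

section

variable {b Lr}

theorem evL_ext {W : C} {g h : W ⟶ (forgetMon Lr).X}
    (e : A.X ◁ g ≫ b.evL Lr = A.X ◁ h ≫ b.evL Lr) : g = h :=
  pairing_ext (X := b.L) (X' := Lr) e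

theorem exists_evL_eq {W : C} (k : A.X ⊗ W ⟶ R.X)
    (hk : (b.s.hom ▷ A.X ≫ μ[A.X]) ▷ W ≫ k = (α_ _ _ _).hom ≫ R.X ◁ k ≫ μ[R.X]) :
    ∃ g : W ⟶ (forgetMon Lr).X, A.X ◁ g ≫ b.evL Lr = k :=
  exists_pairing_eq (X := b.L) (X' := Lr) k hk

end

theorem evL_actLeft : (b.s.hom ▷ A.X ≫ μ[A.X]) ▷ (forgetMon Lr).X ≫ b.evL Lr =
    (α_ _ _ _).hom ≫ R.X ◁ b.evL Lr ≫ μ[R.X] :=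
  pairing_actLeft b.L Lr

theorem evL_actRight :
    A.X ◁ ((forgetMon Lr).X ◁ (unitMon Lr).hom ≫ μ[(forgetMon Lr).X]) ≫ b.evL Lr =
      (α_ _ _ _).inv ≫ b.evL Lr ▷ R.X ≫ μ[R.X] := by
  have h := pairing_actRight b.L Lr
  rw [forgetMon_actRight] at h
  exact h

theorem evL_mid : (A.X ◁ b.t ≫ (β_ A.X A.X).hom ≫ μ[A.X]) ▷ (forgetMon Lr).X ≫ b.evL Lr =
    (α_ _ _ _).hom ≫
      A.X ◁ ((unitMon Lr).hom ▷ (forgetMon Lr).X ≫ μ[(forgetMon Lr).X]) ≫ b.evL Lr := by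
  have h := pairing_mid b.L Lr
  rw [← one_mul_fromR] at h
  exact h

/-- The contraction `(x ⊗ y) ⊗ χ ↦ t ⟨y, χ⟩ x`. -/
noncomputable def contractL : (b.L ⊗ b.L).X ⊗ (forgetMon Lr).X ⟶ A.X := contract b.L b.L Lr

theorem piLL_contractL : b.piLL ▷ (forgetMon Lr).X ≫ b.contractL Lr =
    (α_ _ _ _).hom ≫ A.X ◁ b.evL Lr ≫ A.X ◁ b.t ≫ (β_ A.X A.X).hom ≫ μ[A.X] :=
  toTens_contract b.L b.L Lr

/-- The contraction multiplies the first factor on the left by `t⟨y, χ⟩`, which commutes with right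
multiplication by associativity of `A`. -/
theorem mulFst_contractL : b.mulFst ▷ (forgetMon Lr).X ≫ b.contractL Lr =
    (α_ _ _ _).hom ≫ (b.L ⊗ b.L).X ◁ (β_ _ _).hom ≫ (α_ _ _ _).inv ≫
      b.contractL Lr ▷ A.X ≫ μ[A.X] := by
  have h := b.L_mul_right
  have p := b.piLL_contractL Lr
  generalize A.X ◁ b.t ≫ (β_ A.X A.X).hom ≫ μ[A.X] = k at h p
  rw [← cancel_epi ((b.piLL ▷ A.X) ▷ (forgetMon Lr).X), ← comp_whiskerRight_assoc, piLL_mulFst,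
    associator_naturality_left_assoc, ← whisker_exchange_assoc,
    associator_inv_naturality_left_assoc, ← comp_whiskerRight_assoc, p]
  simp only [comp_whiskerRight, Category.assoc, p]
  generalize b.evL Lr = e
  have h2 : (A.X ◁ e) ▷ A.X ≫ k ▷ A.X ≫ μ[A.X] = (α_ _ _ _).hom ≫ A.X ◁ (β_ _ _).hom ≫
      (α_ _ _ _).inv ≫ μ[A.X] ▷ (A.X ⊗ (forgetMon Lr).X) ≫ A.X ◁ e ≫ k := by
    rw [h, associator_naturality_middle_assoc, ← MonoidalCategory.whiskerLeft_comp_assoc,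
      BraidedCategory.braiding_naturality_left, MonoidalCategory.whiskerLeft_comp_assoc,
      associator_inv_naturality_right_assoc, whisker_exchange_assoc]
  rw [h2, BraidedCategory.braiding_tensor_left_hom]
  -- The multiplier and `χ` cross twice, which symmetry makes trivial; the rest is coherence.
  have h3 : (α_ (A.X ⊗ A.X) A.X (forgetMon Lr).X).hom ≫ (α_ _ _ _).hom ≫
      A.X ◁ A.X ◁ ((β_ A.X (forgetMon Lr).X).hom ≫ (β_ (forgetMon Lr).X A.X).hom) ≫
        A.X ◁ ((α_ _ _ _).inv ≫ (β_ A.X A.X).hom ▷ (forgetMon Lr).X ≫ (α_ _ _ _).hom) ≫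
          (α_ _ _ _).inv ≫ μ[A.X] ▷ (A.X ⊗ (forgetMon Lr).X) ≫ A.X ◁ e ≫ k =
      (α_ A.X A.X A.X).hom ▷ (forgetMon Lr).X ≫ (A.X ◁ (β_ A.X A.X).hom) ▷ (forgetMon Lr).X ≫
        (α_ A.X A.X A.X).inv ▷ (forgetMon Lr).X ≫ μ[A.X] ▷ A.X ▷ (forgetMon Lr).X ≫
          (α_ A.X A.X (forgetMon Lr).X).hom ≫ A.X ◁ e ≫ k := by
    rw [SymmetricCategory.symmetry]
    monoidal
  rw [← h3]
  monoidal

variable [ComonObj b.L]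

/-- The action of the dual of `L` on `A`, `a ⊗ χ ↦ t ⟨a₂, χ⟩ a₁`. -/
noncomputable def act : A.X ⊗ (forgetMon Lr).X ⟶ A.X :=
  b.comulL ▷ (forgetMon Lr).X ≫ b.contractL Lr

/-- In `a₁b ⊗ a₂` the element `b` is a right factor of the first leg, so it passes through the
contraction and leaves `(a·χ)b`. The explicit form of `ψʳ` rests on this. -/
theorem entw_contractL : b.entw ▷ (forgetMon Lr).X ≫ b.contractL Lr =
    (α_ _ _ _).hom ≫ A.X ◁ (β_ _ _).hom ≫ (α_ _ _ _).inv ≫ b.act Lr ▷ A.X ≫ μ[A.X] := by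
  rw [entw, comp_whiskerRight_assoc, mulFst_contractL, associator_naturality_left_assoc,
    ← whisker_exchange_assoc, associator_inv_naturality_left_assoc, ← comp_whiskerRight_assoc]
  rfl

variable {b Lr}

/-- `μ_B` is the transpose of `γ`, so `⟨a, χθ⟩` is `γ(a)` paired with `χ ⊗ θ`; contracting the
second leg with `χ` first leaves `⟨a·χ, θ⟩`. -/
theorem evL_mul (hμ : μ[Lr] = dualMap (X' := Lr) (Y' := Lr ⊗ Lr) Δ[b.L]) :
    A.X ◁ μ[(forgetMon Lr).X] ≫ b.evL Lr =
      (α_ _ _ _).inv ≫ b.act Lr ▷ (forgetMon Lr).X ≫ b.evL Lr := by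
  have h := pairing_dualMap (X' := Lr) (Y' := Lr ⊗ Lr) Δ[b.L]
  rw [← hμ] at h
  have h2 := b.L.X ◁ toTens Lr Lr ≫= h
  rw [whisker_exchange_assoc, pairing_tensor, associator_inv_naturality_left_assoc,
    ← comp_whiskerRight_assoc, ← MonoidalCategory.whiskerLeft_comp_assoc] at h2
  exact h2

theorem evL_unit (hη : η[Lr] = dualMap (X' := Lr) (Y' := 𝟙_ (Bimod R R)) ε[b.L]) :
    A.X ◁ (unitMon Lr).hom ≫ b.evL Lr = b.counitL ▷ R.X ≫ μ[R.X] := by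
  have h := pairing_dualMap (X' := Lr) (Y' := 𝟙_ (Bimod R R)) ε[b.L]
  rw [← hη, pairing_unit] at h
  exact h

/-- Compute `⟨a, χ πʳ(r)⟩` twice: right linearity of the evaluation gives `⟨a, χ⟩ r`, while
`evL_mul` and `evL_unit` give `π(a·χ) r`. Then take `r = 1`. -/
theorem act_counitL (hη : η[Lr] = dualMap (X' := Lr) (Y' := 𝟙_ (Bimod R R)) ε[b.L])
    (hμ : μ[Lr] = dualMap (X' := Lr) (Y' := Lr ⊗ Lr) Δ[b.L]) :
    b.act Lr ≫ b.counitL = b.evL Lr := by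
  have h := b.evL_actRight Lr
  rw [MonoidalCategory.whiskerLeft_comp_assoc, evL_mul hμ,
    associator_inv_naturality_right_assoc, whisker_exchange_assoc, evL_unit hη,
    cancel_epi, ← comp_whiskerRight_assoc] at h
  have h2 := (ρ_ _).inv ≫= (A.X ⊗ (forgetMon Lr).X) ◁ η[R.X] ≫= h
  simpa only [whisker_exchange_assoc, MonObj.mul_one, rightUnitor_naturality,
    Iso.inv_hom_id_assoc] using h2

/-- `γ(a s(r)) = a • γ(s(r))` and `γ(s(r)) = s(r) ⊗ 1`, so right multiplication by `s(r)` reaches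
the first leg only. -/
theorem mul_s_comulL (hb : b.IsLeftBialgebroid) :
    (A.X ◁ b.s.hom ≫ μ[A.X]) ≫ b.comulL = A.X ◁ b.s.hom ≫ b.entw := by
  have h : b.s.hom ≫ b.comulL = b.s.hom ≫ b.inclFst := by
    rw [s_comulL hb, inclFst, MonoidalCategory.tensorHom_def_assoc,
      rightUnitor_inv_naturality_assoc]
  rw [Category.assoc, hb.mul_comul, ← MonoidalCategory.whiskerLeft_comp_assoc, h, entw_eq_lamM hb,
    MonoidalCategory.whiskerLeft_comp_assoc]

/-- By `mul_s_comulL` the leg contracted with `χ` does not see `s(r)`, which survives as a right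
factor. -/
theorem act_s (hb : b.IsLeftBialgebroid) :
    (A.X ◁ b.s.hom ≫ μ[A.X]) ▷ (forgetMon Lr).X ≫ b.act Lr =
      (α_ _ _ _).hom ≫ A.X ◁ (β_ _ _).hom ≫ (α_ _ _ _).inv ≫ b.act Lr ▷ R.X ≫
        A.X ◁ b.s.hom ≫ μ[A.X] := by
  rw [act, ← comp_whiskerRight_assoc, mul_s_comulL hb, comp_whiskerRight_assoc, entw_contractL,
    associator_naturality_middle_assoc, ← MonoidalCategory.whiskerLeft_comp_assoc,
    BraidedCategory.braiding_naturality_left, MonoidalCategory.whiskerLeft_comp_assoc,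
    associator_inv_naturality_right_assoc, whisker_exchange_assoc]
  rfl

/-- Since `γ(1) = 1 ⊗ 1`, the contraction only multiplies `1` by `t⟨1, χ⟩`. -/
theorem act_one (hb : b.IsLeftBialgebroid) :
    (λ_ _).inv ≫ η[A.X] ▷ (forgetMon Lr).X ≫ b.act Lr =
      (λ_ _).inv ≫ η[A.X] ▷ (forgetMon Lr).X ≫ b.evL Lr ≫ b.t := by
  rw [act, ← comp_whiskerRight_assoc, hb.one_comul, comp_whiskerRight, comp_whiskerRight]
  simp only [Category.assoc]
  rw [piLL_contractL, MonoidalCategory.tensorHom_def']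
  have h := b.one_t_mul
  rw [comp_whiskerRight_assoc, associator_naturality_left_assoc, ← whisker_exchange_assoc, h]
  monoidal

end BaseMaps

end DualAction

/-! ### The target map `q` and the identification of the dual of `S` -/

section DualBaseMaps

variable {C : Type u} [Category.{v} C] [MonoidalCategory C] [SymmetricCategory C]
  [HasCoequalizers C]
  [∀ X : C, PreservesColimitsOfShape WalkingParallelPair (tensorLeft X)]
  [∀ X : C, PreservesColimitsOfShape WalkingParallelPair (tensorRight X)]
  {R A : Mon C}

namespace BaseMaps

variable {b : BaseMaps R A} [ComonObj b.L] {Lr : Bimod R R} [MonObj Lr] [ExactPairing Lr b.L]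

theorem actLeft_counitL :
    (b.s.hom ▷ A.X ≫ μ[A.X]) ≫ b.counitL = R.X ◁ b.counitL ≫ μ[R.X] :=
  ε[b.L].left_act_hom

theorem actRight_counitL :
    (A.X ◁ b.t ≫ (β_ A.X A.X).hom ≫ μ[A.X]) ≫ b.counitL = b.counitL ▷ R.X ≫ μ[R.X] :=
  ε[b.L].right_act_hom

variable (b Lr) in
-- `a ↦ π(a s(r))` is left `R`-linear because `π` is, hence represented by an element `q(r)` of the
-- dual of `L`.
theorem exists_dual_target : ∃ q : R.X ⟶ (forgetMon Lr).X,
    A.X ◁ q ≫ b.evL Lr = A.X ◁ b.s.hom ≫ μ[A.X] ≫ b.counitL := by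
  apply exists_evL_eq
  have h := b.S_mul_left'
  rw [← whisker_exchange_assoc, reassoc_of% h, associator_naturality_right_assoc,
    ← Category.assoc (b.s.hom ▷ A.X), actLeft_counitL]
  simp

section

variable {q : R.X ⟶ (forgetMon Lr).X}

/-- `⟨a, χ q(r)⟩ = ⟨a·χ, q(r)⟩ = π((a·χ) s(r)) = π((a s(r))·χ) = ⟨a s(r), χ⟩`. Right multiplication
by `q(r)` is therefore transpose to the right action of `R` on `S`. -/
theorem evL_dual_target (hq : A.X ◁ q ≫ b.evL Lr = A.X ◁ b.s.hom ≫ μ[A.X] ≫ b.counitL)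
    (hb : b.IsLeftBialgebroid)
    (hη : η[Lr] = dualMap (X' := Lr) (Y' := 𝟙_ (Bimod R R)) ε[b.L])
    (hμ : μ[Lr] = dualMap (X' := Lr) (Y' := Lr ⊗ Lr) Δ[b.L]) :
    A.X ◁ (q ▷ (forgetMon Lr).X ≫ (β_ _ _).hom ≫ μ[(forgetMon Lr).X]) ≫ b.evL Lr =
      (α_ _ _ _).inv ≫ (A.X ◁ b.s.hom ≫ μ[A.X]) ▷ (forgetMon Lr).X ≫ b.evL Lr := by
  have h := act_s (Lr := Lr) hb =≫ b.counitL
  simp only [Category.assoc, act_counitL hη hμ] at h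
  rw [BraidedCategory.braiding_naturality_left_assoc, MonoidalCategory.whiskerLeft_comp_assoc,
    MonoidalCategory.whiskerLeft_comp_assoc, evL_mul hμ, associator_inv_naturality_right_assoc,
    whisker_exchange_assoc, hq, h, Iso.inv_hom_id_assoc]

theorem one_dual_target (hq : A.X ◁ q ≫ b.evL Lr = A.X ◁ b.s.hom ≫ μ[A.X] ≫ b.counitL)
    (hη : η[Lr] = dualMap (X' := Lr) (Y' := 𝟙_ (Bimod R R)) ε[b.L]) :
    η[R.X] ≫ q = η[(forgetMon Lr).X] := by
  apply evL_ext (b := b)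
  have h1 : η[(forgetMon Lr).X] = η[R.X] ≫ (unitMon Lr).hom := rfl
  rw [MonoidalCategory.whiskerLeft_comp_assoc, hq, h1, MonoidalCategory.whiskerLeft_comp_assoc,
    evL_unit hη, ← MonoidalCategory.whiskerLeft_comp_assoc, IsMonHom.one_hom, MonObj.mul_one_assoc,
    whisker_exchange_assoc, MonObj.mul_one, rightUnitor_naturality]

/-- By `evL_dual_target` at `χ = q(r')`, `⟨a, q(r')q(r)⟩ = ⟨a s(r), q(r')⟩ = π(a s(r)s(r'))`, and
`s` is multiplicative. -/
theorem mul_dual_target (hq : A.X ◁ q ≫ b.evL Lr = A.X ◁ b.s.hom ≫ μ[A.X] ≫ b.counitL)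
    (hb : b.IsLeftBialgebroid)
    (hη : η[Lr] = dualMap (X' := Lr) (Y' := 𝟙_ (Bimod R R)) ε[b.L])
    (hμ : μ[Lr] = dualMap (X' := Lr) (Y' := Lr ⊗ Lr) Δ[b.L]) :
    (β_ R.X R.X).hom ≫ μ[R.X] ≫ q = (q ⊗ₘ q) ≫ μ[(forgetMon Lr).X] := by
  have h : μ[R.X] ≫ q = (q ⊗ₘ q) ≫ (β_ _ _).hom ≫ μ[(forgetMon Lr).X] := by
    apply evL_ext (b := b)
    have h2 : A.X ◁ μ[R.X] ≫ A.X ◁ b.s.hom ≫ μ[A.X] = (α_ _ _ _).inv ≫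
        (A.X ◁ b.s.hom ≫ μ[A.X]) ▷ R.X ≫ A.X ◁ b.s.hom ≫ μ[A.X] := b.S.right_assoc
    rw [MonoidalCategory.whiskerLeft_comp_assoc, hq, reassoc_of% h2,
      MonoidalCategory.tensorHom_def', Category.assoc, MonoidalCategory.whiskerLeft_comp_assoc,
      evL_dual_target hq hb hη hμ, associator_inv_naturality_right_assoc, whisker_exchange_assoc,
      hq]
  rw [h, ← BraidedCategory.braiding_naturality_assoc, SymmetricCategory.symmetry_assoc]

/-- `⟨a, πʳ(r)q(r')⟩ = ⟨t(r)a, q(r')⟩ = π(t(r)a s(r')) = π(a s(r')) r = ⟨a, q(r')πʳ(r)⟩`, by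
balancedness of the evaluation and right linearity of `π` and of the evaluation. -/
theorem comm_dual_target (hq : A.X ◁ q ≫ b.evL Lr = A.X ◁ b.s.hom ≫ μ[A.X] ≫ b.counitL) :
    ((unitMon Lr).hom ⊗ₘ q) ≫ μ[(forgetMon Lr).X] =
      ((unitMon Lr).hom ⊗ₘ q) ≫ (β_ _ _).hom ≫ μ[(forgetMon Lr).X] := by
  apply evL_ext (b := b)
  have h1 := b.evL_mid Lr
  have h2 := b.evL_actRight Lr
  have h3 := b.L_mul_right
  have r := actRight_counitL (b := b)
  simp only [Category.assoc] at r
  rw [← Iso.inv_comp_eq] at h1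
  rw [MonoidalCategory.tensorHom_def', Category.assoc, MonoidalCategory.whiskerLeft_comp_assoc,
    ← h1, associator_inv_naturality_right_assoc, whisker_exchange_assoc, hq,
    ← whisker_exchange_assoc, reassoc_of% h3, r,
    associator_naturality_right_assoc, Iso.inv_hom_id_assoc,
    ← MonoidalCategory.whiskerLeft_comp_assoc, BraidedCategory.braiding_naturality_right,
    Category.assoc, BraidedCategory.braiding_naturality_left_assoc,
    BraidedCategory.braiding_naturality_right_assoc,
    MonoidalCategory.whiskerLeft_comp_assoc, MonoidalCategory.whiskerLeft_comp_assoc,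
    MonoidalCategory.whiskerLeft_comp_assoc, h2, associator_inv_naturality_middle_assoc,
    associator_inv_naturality_middle_assoc, ← comp_whiskerRight_assoc (A.X ◁ q), hq]
  simp only [comp_whiskerRight, Category.assoc]

end

/-- The base maps of the dual of a left bialgebroid. -/
noncomputable def dualBaseMaps (hb : b.IsLeftBialgebroid)
    (hη : η[Lr] = dualMap (X' := Lr) (Y' := 𝟙_ (Bimod R R)) ε[b.L])
    (hμ : μ[Lr] = dualMap (X' := Lr) (Y' := Lr ⊗ Lr) Δ[b.L]) : BaseMaps R (forgetMon Lr) where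
  s := unitMon Lr
  t := (b.exists_dual_target Lr).choose
  one_t := one_dual_target (b.exists_dual_target Lr).choose_spec hη
  mul_t := mul_dual_target (b.exists_dual_target Lr).choose_spec hb hη hμ
  comm := comm_dual_target (b.exists_dual_target Lr).choose_spec

theorem evL_dualBaseMaps (hb : b.IsLeftBialgebroid)
    (hη : η[Lr] = dualMap (X' := Lr) (Y' := 𝟙_ (Bimod R R)) ε[b.L])
    (hμ : μ[Lr] = dualMap (X' := Lr) (Y' := Lr ⊗ Lr) Δ[b.L]) :
    A.X ◁ (dualBaseMaps hb hη hμ).t ≫ b.evL Lr = A.X ◁ b.s.hom ≫ μ[A.X] ≫ b.counitL :=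
  (b.exists_dual_target Lr).choose_spec

variable (b) in
/-- The evaluation of `S` on its right dual, as a morphism of `C`. -/
noncomputable def evS (Sr : Bimod R R) [ExactPairing Sr b.S] : A.X ⊗ Sr.X ⟶ R.X :=
  pairing b.S Sr

theorem evS_ext {Sr : Bimod R R} [ExactPairing Sr b.S] {W : C} {g h : W ⟶ Sr.X}
    (e : A.X ◁ g ≫ b.evS Sr = A.X ◁ h ≫ b.evS Sr) : g = h :=
  pairing_ext (X := b.S) (X' := Sr) e

variable (b Lr) in
-- A right dual represents left `R`-linear functionals, and `S` and `L` have the same left action.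
-- Each evaluation is thus represented over the other dual, and uniqueness makes the two comparison
-- maps inverse.
theorem exists_iso_dualS (Sr : Bimod R R) [ExactPairing Sr b.S] :
    ∃ i : (forgetMon Lr).X ≅ Sr.X, A.X ◁ i.hom ≫ b.evS Sr = b.evL Lr := by
  obtain ⟨i, hi⟩ := exists_pairing_eq (X := b.S) (X' := Sr) (b.evL Lr) (b.evL_actLeft Lr)
  obtain ⟨j, hj⟩ := exists_evL_eq (b := b) (Lr := Lr) (b.evS Sr) (pairing_actLeft b.S Sr)
  have hi' : A.X ◁ i ≫ b.evS Sr = b.evL Lr := hi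
  refine ⟨⟨i, j, ?_, ?_⟩, hi'⟩
  · apply evL_ext (b := b)
    rw [MonoidalCategory.whiskerLeft_comp_assoc, hj, hi', MonoidalCategory.whiskerLeft_id,
      Category.id_comp]
  · apply evS_ext (b := b)
    have h : A.X ◁ (j ≫ i) ≫ b.evS Sr = A.X ◁ 𝟙 _ ≫ b.evS Sr := by
      rw [MonoidalCategory.whiskerLeft_comp_assoc, hi', hj, MonoidalCategory.whiskerLeft_id,
        Category.id_comp]
    exact h

/-- Linearity of the comparison map is checked after pairing. Both left actions are transposes of
right multiplication by `s`, by `evL_dual_target` and by balancedness; for the right actions, both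
evaluations are right linear. -/
theorem exists_dual_iso (hb : b.IsLeftBialgebroid)
    (hη : η[Lr] = dualMap (X' := Lr) (Y' := 𝟙_ (Bimod R R)) ε[b.L])
    (hμ : μ[Lr] = dualMap (X' := Lr) (Y' := Lr ⊗ Lr) Δ[b.L])
    (Sr : Bimod R R) [ExactPairing Sr b.S] :
    ∃ e : (dualBaseMaps hb hη hμ).K ≅ Sr, A.X ◁ e.hom.hom ≫ b.evS Sr = b.evL Lr := by
  obtain ⟨i, hi⟩ := b.exists_iso_dualS Lr Sr
  refine ⟨Bimod.isoOfIso i ?_ ?_, hi⟩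
  · apply evS_ext (b := b)
    have h := evL_dual_target (evL_dualBaseMaps hb hη hμ) hb hη hμ
    have h1 : (A.X ◁ b.s.hom ≫ μ[A.X]) ▷ Sr.X ≫ b.evS Sr =
      (α_ _ _ _).hom ≫ A.X ◁ Sr.actLeft ≫ b.evS Sr := pairing_mid b.S Sr
    rw [← Iso.inv_comp_eq] at h1
    have h2 : A.X ◁ (((dualBaseMaps hb hη hμ).t ▷ (forgetMon Lr).X ≫ (β_ _ _).hom ≫
        μ[(forgetMon Lr).X]) ≫ i.hom) ≫ b.evS Sr =
        A.X ◁ (R.X ◁ i.hom ≫ Sr.actLeft) ≫ b.evS Sr := by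
      rw [MonoidalCategory.whiskerLeft_comp_assoc, hi, h, MonoidalCategory.whiskerLeft_comp_assoc,
        ← h1, associator_inv_naturality_right_assoc, whisker_exchange_assoc, hi]
    exact h2
  · apply evS_ext (b := b)
    have h := b.evL_actRight Lr
    have h1 : A.X ◁ Sr.actRight ≫ b.evS Sr =
      (α_ _ _ _).inv ≫ b.evS Sr ▷ R.X ≫ μ[R.X] := pairing_actRight b.S Sr
    have h2 : A.X ◁ (((forgetMon Lr).X ◁ (unitMon Lr).hom ≫ μ[(forgetMon Lr).X]) ≫ i.hom) ≫
        b.evS Sr = A.X ◁ (i.hom ▷ R.X ≫ Sr.actRight) ≫ b.evS Sr := by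
      rw [MonoidalCategory.whiskerLeft_comp_assoc, hi, h, MonoidalCategory.whiskerLeft_comp_assoc,
        h1, associator_inv_naturality_middle_assoc, ← comp_whiskerRight_assoc, hi]
    exact h2

end BaseMaps

end DualBaseMaps

/-! ### Duality data and the counit axioms of the dual -/

section DualCounit

variable {C : Type u} [Category.{v} C] [MonoidalCategory C] [SymmetricCategory C]
  [HasCoequalizers C]
  [∀ X : C, PreservesColimitsOfShape WalkingParallelPair (tensorLeft X)]
  [∀ X : C, PreservesColimitsOfShape WalkingParallelPair (tensorRight X)]
  {R A : Mon C}

/-- The data `(Lr, d)` are dual to the base maps `b` and the comonoid `L`: the monoid `Lr` is dual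
to `L`, and the comonoid `K` of `d` is dual to the monoid `S`, with the same evaluation. -/
structure IsDual (b : BaseMaps R A) [ComonObj b.L] (Lr : Bimod R R) [ExactPairing Lr b.L]
    [MonObj Lr] (d : BaseMaps R (forgetMon Lr)) [ExactPairing d.K b.S] [ComonObj d.K] : Prop where
  one : η[Lr] = dualMap (X' := Lr) (Y' := 𝟙_ (Bimod R R)) ε[b.L]
  mul : μ[Lr] = dualMap (X' := Lr) (Y' := Lr ⊗ Lr) Δ[b.L]
  counit : ε[d.K] = dualMap (X' := 𝟙_ (Bimod R R)) (Y' := d.K) η[b.S]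
  comul : Δ[d.K] = dualMap (X' := d.K ⊗ d.K) (Y' := d.K) μ[b.S]
  source : d.s.hom = (unitMon Lr).hom
  target : A.X ◁ d.t ≫ b.evL Lr = A.X ◁ b.s.hom ≫ μ[A.X] ≫ b.counitL
  evaluation : pairing b.S d.K = b.evL Lr

namespace IsDual

variable {b : BaseMaps R A} [ComonObj b.L] {Lr : Bimod R R} [ExactPairing Lr b.L]
    [MonObj Lr] {d : BaseMaps R (forgetMon Lr)} [ExactPairing d.K b.S] [ComonObj d.K]

/-- The counit `ε` is the transpose of the unit `s` of `S`, so `r ε(χ) = ⟨s(r), χ⟩`; evaluate at `r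
= 1`. -/
theorem counitK_eq (hd : IsDual b Lr d)
    : d.counitK = (λ_ _).inv ≫ η[A.X] ▷ (forgetMon Lr).X ≫ b.evL Lr := by
  have h := pairing_dualMap (X' := 𝟙_ (Bimod R R)) (Y' := d.K) η[b.S]
  rw [← hd.counit, pairing_unit, hd.evaluation] at h
  have h' : R.X ◁ d.counitK ≫ μ[R.X] = b.s.hom ▷ (forgetMon Lr).X ≫ b.evL Lr := h
  have h2 := (λ_ _).inv ≫= η[R.X] ▷ _ ≫= h'
  rw [← whisker_exchange_assoc, MonObj.one_mul, leftUnitor_naturality, Iso.inv_hom_id_assoc,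
    ← comp_whiskerRight_assoc, IsMonHom.one_hom] at h2
  exact h2

/-- `⟨1, πʳ(r)⟩ = π(1) r = r`. This splitting also makes the counit an epimorphism. -/
theorem source_counitK (hd : IsDual b Lr d)
    (hb : b.IsLeftBialgebroid) : d.s.hom ≫ d.counitK = 𝟙 R.X := by
  rw [hd.source, hd.counitK_eq, leftUnitor_inv_naturality_assoc, whisker_exchange_assoc,
    BaseMaps.evL_unit hd.one, ← comp_whiskerRight_assoc, hb.one_counit, MonObj.one_mul,
    Iso.inv_hom_id]

/-- `⟨1, q(r)⟩ = π(s(r))`, and `π(s(r)) = r π(1) = r` by left linearity. -/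
theorem target_counitK (hd : IsDual b Lr d)
    (hb : b.IsLeftBialgebroid) : d.t ≫ d.counitK = 𝟙 R.X := by
  have h : b.s.hom ≫ b.counitL = 𝟙 R.X := by
    have h1 := (ρ_ _).inv ≫= R.X ◁ η[A.X] ≫= BaseMaps.actLeft_counitL (b := b)
    rw [← MonoidalCategory.whiskerLeft_comp_assoc, hb.one_counit, MonObj.mul_one, Category.assoc,
      reassoc_of% b.one_s_mul, Iso.inv_hom_id, Iso.inv_hom_id_assoc] at h1
    exact h1
  rw [hd.counitK_eq, leftUnitor_inv_naturality_assoc, whisker_exchange_assoc, hd.target,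
    ← whisker_exchange_assoc, MonObj.one_mul_assoc, leftUnitor_naturality_assoc, h,
    Category.comp_id, Iso.inv_hom_id]

theorem epi_counitK (hd : IsDual b Lr d) (hb : b.IsLeftBialgebroid) : Epi d.counitK :=
  (SplitEpi.mk _ (hd.source_counitK hb)).epi

theorem one_counitK (hd : IsDual b Lr d)
    (hb : b.IsLeftBialgebroid) : η[(forgetMon Lr).X] ≫ d.counitK = η[R.X] := by
  rw [← IsMonHom.one_hom d.s.hom, Category.assoc, hd.source_counitK hb, Category.comp_id]

/-- `⟨1, χθ⟩ = ⟨1·χ, θ⟩ = ⟨t⟨1, χ⟩, θ⟩` depends on `χ` only through its counit. The counit is a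
retraction of both `πʳ` and `q`, so both counit axioms follow. -/
theorem mul_counitK (hd : IsDual b Lr d)
    (hb : b.IsLeftBialgebroid) : μ[(forgetMon Lr).X] ≫ d.counitK =
    (d.counitK ≫ b.t) ▷ (forgetMon Lr).X ≫ b.evL Lr := by
  have h := BaseMaps.act_one (Lr := Lr) hb
  rw [hd.counitK_eq, leftUnitor_inv_naturality_assoc, whisker_exchange_assoc,
    BaseMaps.evL_mul hd.mul, associator_inv_naturality_left_assoc, Category.assoc, Category.assoc,
    ← h]
  simp only [comp_whiskerRight, Category.assoc]
  monoidal

theorem mul_counitK_source (hd : IsDual b Lr d) (hb : b.IsLeftBialgebroid) :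
    (d.counitK ≫ d.s.hom) ▷ (forgetMon Lr).X ≫ μ[(forgetMon Lr).X] ≫ d.counitK =
      μ[(forgetMon Lr).X] ≫ d.counitK := by
  rw [hd.mul_counitK hb, ← comp_whiskerRight_assoc, Category.assoc,
    reassoc_of% hd.source_counitK hb]

theorem mul_counitK_target (hd : IsDual b Lr d) (hb : b.IsLeftBialgebroid) :
    (d.counitK ≫ d.t) ▷ (forgetMon Lr).X ≫ μ[(forgetMon Lr).X] ≫ d.counitK =
      μ[(forgetMon Lr).X] ≫ d.counitK := by
  rw [hd.mul_counitK hb, ← comp_whiskerRight_assoc, Category.assoc,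
    reassoc_of% hd.target_counitK hb]

end IsDual

end DualCounit

/-! ### Tensor products of duals and their evaluations -/

section DualTensor

variable {C : Type u} [Category.{v} C] [MonoidalCategory C] [SymmetricCategory C]
  [HasCoequalizers C]
  [∀ X : C, PreservesColimitsOfShape WalkingParallelPair (tensorLeft X)]
  [∀ X : C, PreservesColimitsOfShape WalkingParallelPair (tensorRight X)]
  {R A : Mon C}

namespace BaseMaps

section

variable {Lr : Bimod R R} [MonObj Lr] (d : BaseMaps R (forgetMon Lr))

/-- The projection `B ⊗ B ⟶ L' ⊗_R K`. -/
noncomputable def piLK : (forgetMon Lr).X ⊗ (forgetMon Lr).X ⟶ (Lr ⊗ d.K).X := toTens Lr d.K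

/-- The projection `B ⊗ B ⟶ K ⊗_R L'`. -/
noncomputable def piKL : (forgetMon Lr).X ⊗ (forgetMon Lr).X ⟶ (d.K ⊗ Lr).X := toTens d.K Lr

instance : Epi d.piKK := inferInstanceAs (Epi (toTens _ _))

instance (Z : C) : Epi (Z ◁ d.piKK) := inferInstanceAs (Epi (Z ◁ toTens _ _))

instance (Z : C) : Epi (d.piKK ▷ Z) := inferInstanceAs (Epi (toTens _ _ ▷ Z))

variable {d}
variable (hs : d.s.hom = (unitMon Lr).hom)

theorem piLK_condition (hs : d.s.hom = (unitMon Lr).hom)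
    : ((forgetMon Lr).X ◁ d.s.hom ≫ μ[(forgetMon Lr).X]) ▷ (forgetMon Lr).X ≫
    d.piLK = (α_ _ _ _).hom ≫
      (forgetMon Lr).X ◁ (d.t ▷ (forgetMon Lr).X ≫ (β_ _ _).hom ≫ μ[(forgetMon Lr).X]) ≫
        d.piLK := by
  have h := toTens_condition Lr d.K
  rw [forgetMon_actRight] at h
  rw [hs]
  exact h

/-- The canonical identification of `K ⊗_R K` and `L' ⊗_R K`, which are coequalizers of the same
pair. -/
noncomputable def idKL : (d.K ⊗ d.K).X ⟶ (Lr ⊗ d.K).X :=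
  bdesc (M := d.K) (N := d.K) d.piLK (piLK_condition hs)

theorem piKK_idKL : d.piKK ≫ idKL hs = d.piLK := bπ_bdesc _ _

/-- The retraction is the other projection descended along the same pair. Being a split monomorphism
suffices, as the identification is only cancelled on the right. -/
instance : IsSplitMono (idKL hs) := by
  have h : Lr.actRight ▷ d.K.X ≫ d.piKK = (α_ _ _ _).hom ≫ Lr.X ◁ d.K.actLeft ≫ d.piKK := by
    have h2 : Lr.actRight = (forgetMon Lr).X ◁ d.s.hom ≫ μ[(forgetMon Lr).X] := by
      rw [forgetMon_actRight, hs]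
      rfl
    rw [h2]
    exact toTens_condition d.K d.K
  have h2 : d.piLK ≫ bdesc (M := Lr) (N := d.K) d.piKK h = d.piKK := bπ_bdesc _ _
  refine IsSplitMono.mk' ⟨bdesc (M := Lr) (N := d.K) d.piKK h, ?_⟩
  rw [← cancel_epi d.piKK, reassoc_of% piKK_idKL hs, h2, Category.comp_id]

/-- The factorwise left multiplication of `B ⊗ B`, as a morphism into `L' ⊗_R K`. -/
noncomputable def lamLK : ((forgetMon Lr).X ⊗ (forgetMon Lr).X) ⊗ (d.K ⊗ d.K).X ⟶ (Lr ⊗ d.K).X :=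
  dualLam d hs

theorem lamKK_idKL : d.lamKK ≫ idKL hs = lamLK hs := by
  have h : ((forgetMon Lr).X ⊗ (forgetMon Lr).X) ◁ d.piKK ≫ lamLK hs =
      tensorμ _ _ _ _ ≫ (μ[(forgetMon Lr).X] ⊗ₘ μ[(forgetMon Lr).X]) ≫ d.piLK := by
    unfold lamLK dualLam
    exact toTens_tensActL (M := d.K) (N := d.K) (M' := Lr) (N' := d.K) _ _ _ _
  rw [← cancel_epi (((forgetMon Lr).X ⊗ (forgetMon Lr).X) ◁ d.piKK), h,
    reassoc_of% d.piKK_lamKK, piKK_idKL, MonObj.tensorObj.mul_def, Category.assoc]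

/-- The morphism `χ ⊗ (φ ⊗ θ) ↦ φ ⊗ χ θ`. -/
noncomputable def lamSnd : (forgetMon Lr).X ⊗ (d.K ⊗ d.K).X ⟶ (Lr ⊗ d.K).X :=
  ((λ_ _).inv ≫ η[(forgetMon Lr).X] ▷ _) ▷ _ ≫ lamLK hs

theorem tensorHom_lamLK {W : C} (f : W ⟶ (d.K ⊗ d.K).X) :
    (((λ_ _).inv ≫ η[(forgetMon Lr).X] ▷ (forgetMon Lr).X) ⊗ₘ f) ≫ lamLK hs =
      (forgetMon Lr).X ◁ f ≫ lamSnd hs := by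
  rw [MonoidalCategory.tensorHom_def', Category.assoc, lamSnd]

theorem piKK_lamSnd : (forgetMon Lr).X ◁ d.piKK ≫ lamSnd hs =
    (α_ _ _ _).inv ≫ (β_ _ _).hom ▷ _ ≫ (α_ _ _ _).hom ≫
      (forgetMon Lr).X ◁ μ[(forgetMon Lr).X] ≫ d.piLK := by
  have h := insert_left_right (𝟙 (forgetMon Lr).X)
  rw [lamSnd, ← lamKK_idKL, whisker_exchange_assoc, reassoc_of% d.piKK_lamKK, piKK_idKL]
  rw [MonoidalCategory.tensorHom_id, id_whiskerRight, Category.id_comp] at h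
  rw [reassoc_of% h]

end

section

variable (b : BaseMaps R A) (Lr Sr : Bimod R R) [ExactPairing Lr b.L] [ExactPairing Sr b.S]

/-- The evaluation of `S ⊗_R L` on its dual, on elements of `A ⊗ A`. -/
noncomputable def evSL : (A.X ⊗ A.X) ⊗ (Lr ⊗ Sr).X ⟶ R.X :=
  toTens b.S b.L ▷ (Lr ⊗ Sr).X ≫ pairing (b.S ⊗ b.L) (Lr ⊗ Sr)

/-- The evaluation of `S ⊗_R S` on its dual, on elements of `A ⊗ A`. -/
noncomputable def evSS : (A.X ⊗ A.X) ⊗ (Sr ⊗ Sr).X ⟶ R.X :=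
  toTens b.S b.S ▷ (Sr ⊗ Sr).X ≫ pairing (b.S ⊗ b.S) (Sr ⊗ Sr)

variable {b Lr Sr}

theorem evSL_ext {W : C} {g h : W ⟶ (Lr ⊗ Sr).X}
    (e : (A.X ⊗ A.X) ◁ g ≫ b.evSL Lr Sr = (A.X ⊗ A.X) ◁ h ≫ b.evSL Lr Sr) : g = h := by
  apply pairing_ext (X := b.S ⊗ b.L)
  rw [← cancel_epi (toTens b.S b.L ▷ W), ← whisker_exchange_assoc, ← whisker_exchange_assoc]
  exact e

end

end BaseMaps

namespace IsDual

variable {b : BaseMaps R A} [ComonObj b.L] {Lr : Bimod R R} [ExactPairing Lr b.L]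
    [MonObj Lr] {d : BaseMaps R (forgetMon Lr)} [ExactPairing d.K b.S] [ComonObj d.K]

/-- The inner value `⟨b, χ⟩` acts on `φ` through the left action of `K`, which is right
multiplication by `q⟨b, χ⟩`. -/
theorem piLK_evSL (hd : IsDual b Lr d) : (A.X ⊗ A.X) ◁ d.piLK ≫ b.evSL Lr d.K =
    (α_ _ _ _).hom ≫ A.X ◁ ((α_ _ _ _).inv ≫ b.evL Lr ▷ (forgetMon Lr).X ≫
      d.t ▷ (forgetMon Lr).X ≫ (β_ _ _).hom ≫ μ[(forgetMon Lr).X]) ≫ b.evL Lr := by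
  have h := toTens_pairing_tensor b.S b.L d.K Lr
  rw [MonoidalCategory.tensorHom_def', Category.assoc, hd.evaluation] at h
  exact h

theorem piKK_evSS (hd : IsDual b Lr d) : (A.X ⊗ A.X) ◁ d.piKK ≫ b.evSS d.K =
    (α_ _ _ _).hom ≫ A.X ◁ ((α_ _ _ _).inv ≫ b.evL Lr ▷ (forgetMon Lr).X ≫
      d.t ▷ (forgetMon Lr).X ≫ (β_ _ _).hom ≫ μ[(forgetMon Lr).X]) ≫ b.evL Lr := by
  have h := toTens_pairing_tensor b.S b.S d.K d.K
  rw [MonoidalCategory.tensorHom_def', Category.assoc, hd.evaluation] at h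
  exact h

/-- The comultiplication of `K` is the transpose of the product of `S`, which is `μ_A` on
representatives. -/
theorem comulK_evSS (hd : IsDual b Lr d) : (A.X ⊗ A.X) ◁ d.comulK ≫ b.evSS d.K =
    μ[A.X] ▷ (forgetMon Lr).X ≫ b.evL Lr := by
  have h := toTens b.S b.S ▷ _ ≫= pairing_dualMap (X' := d.K ⊗ d.K) (Y' := d.K) μ[b.S]
  have h2 : toTens b.S b.S ≫ μ[b.S].hom = μ[A.X] := b.toTens_mulS
  rw [← hd.comul, ← whisker_exchange_assoc, ← comp_whiskerRight_assoc, h2, hd.evaluation] at h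
  exact h

end IsDual

end DualTensor

/-! ### A braiding identity -/

section Braiding

variable {C : Type u} [Category.{v} C] [MonoidalCategory C] [SymmetricCategory C]

/-- A morphism `l : X ⊗ B ⟶ B` commuting with left multiplications of `B` also does so after
replacing `X` by the source of a morphism `A ⊗ B ⟶ X`. -/
theorem mul_braiding_swap {A B X : C} [MonObj B] (e : A ⊗ B ⟶ X) (l : X ⊗ B ⟶ B)
    (hl : B ◁ l ≫ μ[B] = (α_ _ _ _).inv ≫ (β_ B X).hom ▷ B ≫ (α_ _ _ _).hom ≫ X ◁ μ[B] ≫ l) :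
    A ◁ ((α_ B B B).inv ≫ (β_ B B).hom ▷ B ≫ (α_ _ _ _).hom ≫ B ◁ μ[B]) ≫ (α_ _ _ _).inv ≫
        e ▷ B ≫ l =
      (α_ _ _ _).inv ≫ (β_ A B).hom ▷ (B ⊗ B) ≫ (α_ _ _ _).hom ≫
        B ◁ ((α_ _ _ _).inv ≫ e ▷ B ≫ l) ≫ μ[B] := by
  rw [MonoidalCategory.whiskerLeft_comp B, MonoidalCategory.whiskerLeft_comp B, Category.assoc,
    Category.assoc, hl, associator_inv_naturality_middle_assoc, ← comp_whiskerRight_assoc (B ◁ e),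
    BraidedCategory.braiding_naturality_right, comp_whiskerRight_assoc,
    associator_naturality_left_assoc, ← whisker_exchange_assoc,
    BraidedCategory.braiding_tensor_right_hom]
  -- Crossing `A` with the first factor and back is trivial by symmetry; with this pair inserted,
  -- the two sides agree by coherence.
  have h : (α_ A B (B ⊗ B)).inv ≫ ((β_ A B).hom ≫ (β_ B A).hom) ▷ (B ⊗ B) ≫
      (α_ A B (B ⊗ B)).hom ≫ A ◁ ((α_ B B B).inv ≫ (β_ B B).hom ▷ B ≫ (α_ _ _ _).hom ≫ B ◁ μ[B]) ≫
        (α_ _ _ _).inv ≫ e ▷ B ≫ l =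
      A ◁ ((α_ B B B).inv ≫ (β_ B B).hom ▷ B ≫ (α_ _ _ _).hom ≫ B ◁ μ[B]) ≫ (α_ _ _ _).inv ≫
        e ▷ B ≫ l := by
    rw [SymmetricCategory.symmetry]
    simp
  rw [← h]
  monoidal

end Braiding

/-! ### Explicit formula for the transposed entwining map -/

section DualEntwiningFormula

variable {C : Type u} [Category.{v} C] [MonoidalCategory C] [SymmetricCategory C]
  [HasCoequalizers C]
  [∀ X : C, PreservesColimitsOfShape WalkingParallelPair (tensorLeft X)]
  [∀ X : C, PreservesColimitsOfShape WalkingParallelPair (tensorRight X)]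
  {R A : Mon C}

namespace BaseMaps

/-- The transpose of the entwining map, as a morphism of `C`. -/
noncomputable def dualEntw {b : BaseMaps R A} [ComonObj b.L] (hb : b.IsLeftBialgebroid)
    (Lr Sr : Bimod R R) [ExactPairing Lr b.L] [ExactPairing Sr b.S] :
    (Sr ⊗ Lr).X ⟶ (Lr ⊗ Sr).X :=
  (dualMap (X' := Lr ⊗ Sr) (Y' := Sr ⊗ Lr) (entwHom hb)).hom

theorem dualEntw_evSL {b : BaseMaps R A} [ComonObj b.L] (hb : b.IsLeftBialgebroid)
    (Lr Sr : Bimod R R) [ExactPairing Lr b.L] [ExactPairing Sr b.S] :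
    (A.X ⊗ A.X) ◁ dualEntw hb Lr Sr ≫ b.evSL Lr Sr =
      b.entw ▷ (Sr ⊗ Lr).X ≫ pairing (b.L ⊗ b.S) (Sr ⊗ Lr) := by
  have h := toTens b.S b.L ▷ _ ≫=
    pairing_dualMap (X' := Lr ⊗ Sr) (Y' := Sr ⊗ Lr) (entwHom hb)
  rw [← whisker_exchange_assoc, ← comp_whiskerRight_assoc, toTens_entwHom] at h
  exact h

end BaseMaps

namespace IsDual

variable {b : BaseMaps R A} [ComonObj b.L] {Lr : Bimod R R} [ExactPairing Lr b.L]
    [MonObj Lr] {d : BaseMaps R (forgetMon Lr)} [ExactPairing d.K b.S] [ComonObj d.K]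

/-- `S` and `L` share a left action and `K` carries the evaluation of the dual of `L`, so the two
contractions agree on representatives. -/
theorem contract_eq (hd : IsDual b Lr d) : contract b.L b.S d.K = b.contractL Lr := by
  have h1 : b.piLL ▷ (forgetMon Lr).X ≫ contract b.L b.S d.K = (α_ _ _ _).hom ≫
      A.X ◁ b.evL Lr ≫ A.X ◁ b.t ≫ (β_ A.X A.X).hom ≫ μ[A.X] := by
    have h := toTens_contract b.L b.S d.K
    rw [hd.evaluation] at h
    exact h
  have e : Epi (b.piLL ▷ (forgetMon Lr).X) :=
    inferInstanceAs (Epi (toTens b.L b.L ▷ (forgetMon Lr).X))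
  exact (cancel_epi (b.piLL ▷ (forgetMon Lr).X)).1 (h1.trans (b.piLL_contractL Lr).symm)

/-- Transposition moves `ψʳ` onto `a ⊗ b`, and `entw_contractL` contracts `ψ(a ⊗ b)` with `χ` to
`(a·χ)b`. -/
theorem piKL_dualEntw_evSL (hd : IsDual b Lr d) (hb : b.IsLeftBialgebroid) :
    (A.X ⊗ A.X) ◁ (d.piKL ≫ BaseMaps.dualEntw hb Lr d.K) ≫ b.evSL Lr d.K =
      (α_ _ _ _).inv ≫ ((α_ _ _ _).hom ≫ A.X ◁ (β_ _ _).hom ≫ (α_ _ _ _).inv ≫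
        b.act Lr ▷ A.X ≫ μ[A.X]) ▷ (forgetMon Lr).X ≫ b.evL Lr := by
  have h : (b.L ⊗ b.S).X ◁ d.piKL ≫ pairing (b.L ⊗ b.S) (d.K ⊗ Lr) =
      (α_ _ _ _).inv ≫ b.contractL Lr ▷ (forgetMon Lr).X ≫ b.evL Lr := by
    rw [← hd.contract_eq]
    exact pairing_tensor b.L b.S Lr d.K
  have h2 : b.entw ▷ ((forgetMon Lr).X ⊗ (forgetMon Lr).X) ≫ (b.L ⊗ b.S).X ◁ d.piKL ≫
      pairing (b.L ⊗ b.S) (d.K ⊗ Lr) = (α_ _ _ _).inv ≫ (b.entw ▷ (forgetMon Lr).X ≫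
        b.contractL Lr) ▷ (forgetMon Lr).X ≫ b.evL Lr := by
    refine (congrArg (b.entw ▷ ((forgetMon Lr).X ⊗ (forgetMon Lr).X) ≫ ·) h).trans ?_
    simp only [comp_whiskerRight, Category.assoc]
    rw [associator_inv_naturality_left_assoc]
  rw [BaseMaps.entw_contractL] at h2
  rw [MonoidalCategory.whiskerLeft_comp_assoc, BaseMaps.dualEntw_evSL, ← h2]
  exact whisker_exchange_assoc _ _ _

/-- On representatives, `⟨a ⊗ b, φ ⊗ χθ⟩ = ⟨a, χθ q⟨b, φ⟩⟩ = ⟨a·χ, θ q⟨b, φ⟩⟩ = ⟨(a·χ) ⊗ b, φ ⊗ θ⟩`.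
-/
theorem lamSnd_evSL (hd : IsDual b Lr d) : (A.X ⊗ A.X) ◁ BaseMaps.lamSnd hd.source ≫ b.evSL Lr d.K =
    (α_ _ _ _).inv ≫ ((α_ _ _ _).hom ≫ A.X ◁ (β_ _ _).hom ≫ (α_ _ _ _).inv ≫
      b.act Lr ▷ A.X) ▷ (d.K ⊗ d.K).X ≫ b.evSS d.K := by
  have m := BaseMaps.evL_mul hd.mul
  have p := hd.piLK_evSL
  have p2 := hd.piKK_evSS
  have k := d.K_mul_left
  rw [← cancel_epi ((A.X ⊗ A.X) ◁ (forgetMon Lr).X ◁ d.piKK),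
    ← MonoidalCategory.whiskerLeft_comp_assoc, BaseMaps.piKK_lamSnd,
    associator_inv_naturality_right_assoc, whisker_exchange_assoc, p2]
  simp only [MonoidalCategory.whiskerLeft_comp (A.X ⊗ A.X), Category.assoc, p]
  -- From here on, only `⟨a, χθ⟩ = ⟨a·χ, θ⟩` and the commutation of `l` with left multiplications
  -- matter.
  generalize b.evL Lr = e at m ⊢
  generalize d.t ▷ (forgetMon Lr).X ≫ (β_ _ _).hom ≫ μ[(forgetMon Lr).X] = l at k ⊢
  have h := mul_braiding_swap e l k
  have h2 : ∀ x : A.X ⊗ ((forgetMon Lr).X ⊗ (forgetMon Lr).X) ⟶ (forgetMon Lr).X,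
      A.X ◁ ((forgetMon Lr).X ◁ x ≫ μ[(forgetMon Lr).X]) ≫ e =
        (α_ _ _ _).inv ≫ b.act Lr ▷ _ ≫ A.X ◁ x ≫ e := by
    intro x
    rw [MonoidalCategory.whiskerLeft_comp_assoc, m, associator_inv_naturality_right_assoc,
      whisker_exchange_assoc]
  have h3 := h2 ((α_ _ _ _).inv ≫ e ▷ (forgetMon Lr).X ≫ l)
  have h4 := (α_ _ _ _).hom ≫= congrArg (A.X ◁ · ≫ e) h
  simp only [MonoidalCategory.whiskerLeft_comp A.X, Category.assoc] at h3 h4 ⊢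
  rw [h3] at h4
  refine Eq.trans ?_ (h4.trans ?_)
  · monoidal
  · monoidal

/-- Pair both sides with `a ⊗ b`: one gives `⟨(a·χ)b, φ⟩`, the other `(a·χ) ⊗ b` paired with `φ₁ ⊗
φ₂`. They agree because the comultiplication is transpose to the product of `A`. -/
theorem piKL_dualEntw (hd : IsDual b Lr d) (hb : b.IsLeftBialgebroid) :
    d.piKL ≫ BaseMaps.dualEntw hb Lr d.K =
      (forgetMon Lr).X ◁ d.comulK ≫ BaseMaps.lamSnd hd.source := by
  apply BaseMaps.evSL_ext (b := b)
  rw [hd.piKL_dualEntw_evSL, MonoidalCategory.whiskerLeft_comp_assoc, hd.lamSnd_evSL,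
    associator_inv_naturality_right_assoc, whisker_exchange_assoc, hd.comulK_evSS,
    ← comp_whiskerRight_assoc]
  simp only [Category.assoc]

end IsDual

end DualEntwiningFormula

/-! ### The right bialgebroid axioms from the right entwining axioms -/

section DualRightBialgebroid

variable {C : Type u} [Category.{v} C] [MonoidalCategory C] [SymmetricCategory C]
  [HasCoequalizers C]
  [∀ X : C, PreservesColimitsOfShape WalkingParallelPair (tensorLeft X)]
  [∀ X : C, PreservesColimitsOfShape WalkingParallelPair (tensorRight X)]
  {R A : Mon C}

namespace BaseMaps

section

variable {Lr : Bimod R R} [MonObj Lr] {d : BaseMaps R (forgetMon Lr)}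
  (hs : d.s.hom = (unitMon Lr).hom)

theorem one_lamSnd : (λ_ _).inv ≫ η[(forgetMon Lr).X] ▷ _ ≫ lamSnd hs = idKL hs := by
  rw [← cancel_epi d.piKK, leftUnitor_inv_naturality_assoc, whisker_exchange_assoc,
    piKK_lamSnd, associator_inv_naturality_left_assoc, ← comp_whiskerRight_assoc,
    BraidedCategory.braiding_naturality_left, comp_whiskerRight_assoc,
    associator_naturality_middle_assoc, ← MonoidalCategory.whiskerLeft_comp_assoc,
    MonObj.one_mul, piKK_idKL, braiding_tensorUnit_left]
  monoidal

theorem target_lamSnd {W : C} (f : W ⟶ (d.K ⊗ d.K).X) :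
    (((λ_ R.X).inv ≫ (η[(forgetMon Lr).X] ⊗ₘ d.t)) ⊗ₘ f) ≫ d.lamKK ≫ idKL hs =
      d.t ▷ W ≫ (forgetMon Lr).X ◁ f ≫ lamSnd hs := by
  rw [lamKK_idKL, lamSnd, MonoidalCategory.tensorHom_def', Category.assoc,
    MonoidalCategory.tensorHom_def', ← leftUnitor_inv_naturality_assoc,
    comp_whiskerRight_assoc, whisker_exchange_assoc]

theorem source_lamKK :
    ((ρ_ R.X).inv ≫ (d.s.hom ⊗ₘ η[(forgetMon Lr).X])) ▷ (d.K ⊗ d.K).X ≫ d.lamKK ≫ idKL hs =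
      R.X ◁ idKL hs ≫ (Lr ⊗ d.K).actLeft := by
  have h : R.X ◁ d.piLK ≫ (Lr ⊗ d.K).actLeft = (α_ _ _ _).inv ≫
      (d.s.hom ▷ (forgetMon Lr).X ≫ μ[(forgetMon Lr).X]) ▷ (forgetMon Lr).X ≫ d.piLK := by
    have h := toTens_actLeft Lr d.K
    rw [← one_mul_fromR Lr] at h
    rw [hs]
    exact h
  rw [← cancel_epi (R.X ◁ d.piKK), whisker_exchange_assoc, reassoc_of% d.piKK_lamKK,
    piKK_idKL, reassoc_of% insert_left_left d.s.hom, ← MonoidalCategory.whiskerLeft_comp_assoc,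
    piKK_idKL, h]

theorem one_target : (ρ_ R.X).inv ≫ R.X ◁ η[(forgetMon Lr).X] ≫
    d.t ▷ (forgetMon Lr).X ≫ (β_ _ _).hom ≫ μ[(forgetMon Lr).X] = d.t := by
  rw [whisker_exchange_assoc, BraidedCategory.braiding_naturality_right_assoc, MonObj.one_mul,
    ← rightUnitor_inv_naturality_assoc, braiding_leftUnitor, Iso.inv_hom_id, Category.comp_id]

variable (d) in
/-- The action of the first factor of `L' ⊗_R K` by left multiplication. -/
noncomputable def mulLK : (forgetMon Lr).X ⊗ (Lr ⊗ d.K).X ⟶ (Lr ⊗ d.K).X :=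
  toTens Lr (Lr ⊗ d.K) ≫ ((α_ Lr Lr d.K).inv ≫ μ[Lr] ▷ d.K).hom

theorem piLK_mulLK : (forgetMon Lr).X ◁ d.piLK ≫ d.mulLK =
    (α_ _ _ _).inv ≫ μ[(forgetMon Lr).X] ▷ (forgetMon Lr).X ≫ d.piLK := by
  have h := toTens_associator_inv Lr Lr d.K =≫ (μ[Lr] ▷ d.K).hom
  simp only [Category.assoc] at h
  rw [toTens_whiskerRight, ← comp_whiskerRight_assoc] at h
  exact h

theorem lamSnd_mulLK :
    (forgetMon Lr).X ◁ lamSnd hs ≫ d.mulLK = (α_ _ _ _).inv ≫ d.lamKK ≫ idKL hs := by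
  have e : Epi ((forgetMon Lr).X ◁ (forgetMon Lr).X ◁ d.piKK) :=
    inferInstanceAs (Epi (_ ◁ (_ ◁ toTens _ _)))
  rw [← cancel_epi ((forgetMon Lr).X ◁ (forgetMon Lr).X ◁ d.piKK),
    ← MonoidalCategory.whiskerLeft_comp_assoc, piKK_lamSnd,
    associator_inv_naturality_right_assoc, reassoc_of% d.piKK_lamKK, piKK_idKL,
    MonObj.tensorObj.mul_def]
  simp only [MonoidalCategory.whiskerLeft_comp, Category.assoc, piLK_mulLK, tensorμ,
    MonoidalCategory.tensorHom_def']
  monoidal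

end

end BaseMaps

namespace IsDual

variable {b : BaseMaps R A} [ComonObj b.L] {Lr : Bimod R R} [ExactPairing Lr b.L]
    [MonObj Lr] {d : BaseMaps R (forgetMon Lr)} [ExactPairing d.K b.S] [ComonObj d.K]

/-- Setting `χ = 1` in `φ₁ ⊗ χφ₂` recovers the comultiplication; this is how properties of `ψʳ`
become bialgebroid axioms. -/
theorem one_dualEntw (hd : IsDual b Lr d) (hb : b.IsLeftBialgebroid) :
    (λ_ _).inv ≫ η[(forgetMon Lr).X] ▷ (forgetMon Lr).X ≫ d.piKL ≫
      BaseMaps.dualEntw hb Lr d.K = d.comulK ≫ BaseMaps.idKL hd.source := by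
  rw [hd.piKL_dualEntw, ← whisker_exchange_assoc, ← leftUnitor_inv_naturality_assoc,
    BaseMaps.one_lamSnd]

/-- `q(r)` is `r · 1` in `K` and `ψʳ` is left `R`-linear, so `φ₁ ⊗ q(r)φ₂ = ψʳ(q(r) ⊗ φ) = r · ψʳ(1
⊗ φ) = πʳ(r)φ₁ ⊗ φ₂`. -/
theorem rightTakeuchi (hd : IsDual b Lr d) (hb : b.IsLeftBialgebroid) : d.RightTakeuchi := by
  have h1 : R.X ◁ d.piKL ≫ (d.K ⊗ Lr).actLeft = (α_ _ _ _).inv ≫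
      (d.t ▷ (forgetMon Lr).X ≫ (β_ _ _).hom ≫ μ[(forgetMon Lr).X]) ▷ (forgetMon Lr).X ≫
        d.piKL := toTens_actLeft d.K Lr
  have h2 : (d.K ⊗ Lr).actLeft ≫ BaseMaps.dualEntw hb Lr d.K =
      R.X ◁ BaseMaps.dualEntw hb Lr d.K ≫ (Lr ⊗ d.K).actLeft :=
    (dualMap (X' := Lr ⊗ d.K) (Y' := d.K ⊗ Lr) (BaseMaps.entwHom hb)).left_act_hom
  have h3 : d.t ▷ (forgetMon Lr).X ≫ d.piKL =
      R.X ◁ ((λ_ _).inv ≫ η[(forgetMon Lr).X] ▷ (forgetMon Lr).X ≫ d.piKL) ≫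
        (d.K ⊗ Lr).actLeft := by
    rw [MonoidalCategory.whiskerLeft_comp, MonoidalCategory.whiskerLeft_comp, Category.assoc,
      Category.assoc, h1, associator_inv_naturality_middle_assoc, ← comp_whiskerRight_assoc]
    nth_rw 1 [← d.one_target]
    simp only [comp_whiskerRight, Category.assoc]
    monoidal
  rw [BaseMaps.RightTakeuchi, ← cancel_mono (BaseMaps.idKL hd.source), Category.assoc,
    Category.assoc, BaseMaps.target_lamSnd, ← hd.piKL_dualEntw hb, reassoc_of% h3, h2,
    ← MonoidalCategory.whiskerLeft_comp_assoc, MonoidalCategory.tensorHom_def' _ d.comulK,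
    Category.assoc,
    Category.assoc _ _ (d.lamKK ≫ _), BaseMaps.source_lamKK,
    ← MonoidalCategory.whiskerLeft_comp_assoc, ← hd.one_dualEntw hb]
  simp only [Category.assoc]

theorem isRightEntwining (hd : IsDual b Lr d) (hb : b.IsLeftBialgebroid) :
    IsRightEntwining (dualMap (X' := Lr ⊗ d.K) (Y' := d.K ⊗ Lr) (BaseMaps.entwHom hb)) :=
  (BaseMaps.isLeftEntwining_entwHom hb).isRightEntwining_dualMap hd.counit hd.comul hd.one hd.mul

/-- The unit axiom gives `ψʳ(χ ⊗ 1) = 1 ⊗ χ`; at `χ = 1` the left side is the comultiplication of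
`1`. -/
theorem one_comulK (hd : IsDual b Lr d)
    (hb : b.IsLeftBialgebroid) : η[(forgetMon Lr).X] ≫ d.comulK =
    (λ_ (𝟙_ C)).inv ≫ (η[(forgetMon Lr).X] ⊗ₘ η[(forgetMon Lr).X]) ≫ d.piKK := by
  -- The unit axiom on representatives carries a scalar: `ψʳ(χ ⊗ πʳ(r)) = 1 ⊗ χ πʳ(r)`. Both `r` and
  -- `χ` are set to `1` in `h2`.
  have h : (forgetMon Lr).X ◁ (unitMon Lr).hom ≫ d.piKL ≫ BaseMaps.dualEntw hb Lr d.K =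
      ((forgetMon Lr).X ◁ d.s.hom ≫ μ[(forgetMon Lr).X]) ≫ (λ_ _).inv ≫
        η[(forgetMon Lr).X] ▷ (forgetMon Lr).X ≫ d.piLK := by
    have h := toTens d.K (𝟙_ _) ≫= congrArg Bimod.Hom.hom (hd.isRightEntwining hb).one
    rw [hom_comp, hom_comp, hom_comp, reassoc_of% toTens_whiskerLeft,
      reassoc_of% toTens_rightUnitor] at h
    have h2 : (λ_ d.K).inv.hom ≫ (η[Lr] ▷ d.K).hom =
        (λ_ _).inv ≫ η[(forgetMon Lr).X] ▷ (forgetMon Lr).X ≫ d.piLK := by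
      have e := congrArg ((λ_ d.K.X).inv ≫ η[R.X] ▷ d.K.X ≫ ·) (toTens_whiskerRight η[Lr] d.K)
      have e2 : (λ_ _).inv ≫ η[(forgetMon Lr).X] ▷ (forgetMon Lr).X ≫ d.piLK =
          (λ_ _).inv ≫ η[R.X] ▷ _ ≫ (unitMon Lr).hom ▷ (forgetMon Lr).X ≫ d.piLK := by
        rw [← comp_whiskerRight_assoc, IsMonHom.one_hom]
      refine Eq.trans ?_ (e.trans e2.symm)
      exact (Category.assoc _ _ _).trans (congrArg ((λ_ d.K.X).inv ≫ ·) (Category.assoc _ _ _))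
    rw [h2] at h
    exact h
  have h2 := η[(forgetMon Lr).X] ≫= (ρ_ _).inv ≫= (forgetMon Lr).X ◁ η[R.X] ≫= h
  rw [← MonoidalCategory.whiskerLeft_comp_assoc, IsMonHom.one_hom (unitMon Lr).hom,
    Category.assoc, ← MonoidalCategory.whiskerLeft_comp_assoc, IsMonHom.one_hom d.s.hom,
    MonObj.mul_one_assoc, Iso.inv_hom_id_assoc] at h2
  have e : η[(forgetMon Lr).X] ≫ (λ_ _).inv ≫ η[(forgetMon Lr).X] ▷ _ =
      η[(forgetMon Lr).X] ≫ (ρ_ _).inv ≫ _ ◁ η[(forgetMon Lr).X] := by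
    rw [leftUnitor_inv_naturality_assoc, rightUnitor_inv_naturality_assoc, whisker_exchange,
      unitors_inv_equal]
  rw [← cancel_mono (BaseMaps.idKL hd.source), Category.assoc, ← hd.one_dualEntw hb,
    reassoc_of% e, h2, leftUnitor_inv_naturality_assoc, Category.assoc, Category.assoc,
    BaseMaps.piKK_idKL, MonoidalCategory.tensorHom_def', Category.assoc]

/-- The multiplication axiom evaluates `ψʳ(1 ⊗ χθ)` by first forming `ψʳ(1 ⊗ χ) = χ₁ ⊗ χ₂` and then
passing `χ₂` through `θ`, which gives `χ₁θ₁ ⊗ χ₂θ₂`. -/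
theorem mul_comulK (hd : IsDual b Lr d)
    (hb : b.IsLeftBialgebroid) : μ[(forgetMon Lr).X] ≫ d.comulK =
    d.comulK ▷ (forgetMon Lr).X ≫ BaseMaps.rhoN (hd.rightTakeuchi hb) := by
  -- `G` is the part `(μ ⊗ K)(L' ⊗ ψʳ)` of the multiplication axiom that follows the first
  -- entwining.
  obtain ⟨G, hG, hG'⟩ : ∃ G : (Lr ⊗ d.K).X ⊗ (forgetMon Lr).X ⟶ (Lr ⊗ d.K).X,
      d.piLK ▷ (forgetMon Lr).X ≫ G = (α_ _ _ _).hom ≫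
        (forgetMon Lr).X ◁ (d.piKL ≫ BaseMaps.dualEntw hb Lr d.K) ≫ d.mulLK ∧
      (forgetMon Lr).X ◁ μ[(forgetMon Lr).X] ≫ d.piKL ≫ BaseMaps.dualEntw hb Lr d.K =
        (α_ _ _ _).inv ≫ (d.piKL ≫ BaseMaps.dualEntw hb Lr d.K) ▷ (forgetMon Lr).X ≫ G := by
    let ψ : d.K ⊗ Lr ⟶ Lr ⊗ d.K := dualMap (BaseMaps.entwHom hb)
    refine ⟨toTens (Lr ⊗ d.K) Lr ≫ ((α_ Lr d.K Lr).hom ≫ Lr ◁ ψ ≫ (α_ Lr Lr d.K).inv ≫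
      μ[Lr] ▷ d.K).hom, ?_, ?_⟩
    · have h := toTens_associator Lr d.K Lr =≫ (Lr ◁ ψ ≫ (α_ Lr Lr d.K).inv ≫ μ[Lr] ▷ d.K).hom
      simp only [Category.assoc] at h
      rw [← hom_comp, hom_comp (Lr ◁ ψ), reassoc_of% toTens_whiskerLeft,
        ← MonoidalCategory.whiskerLeft_comp_assoc] at h
      exact h
    · have h := d.K.X ◁ toTens Lr Lr ≫= toTens d.K (Lr ⊗ Lr) ≫=
        congrArg Bimod.Hom.hom (hd.isRightEntwining hb).mul
      rw [hom_comp, hom_comp (α_ d.K Lr Lr).inv, hom_comp (_ ▷ Lr),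
        reassoc_of% toTens_whiskerLeft, ← MonoidalCategory.whiskerLeft_comp_assoc,
        reassoc_of% toTens_associator_inv, reassoc_of% toTens_whiskerRight,
        ← comp_whiskerRight_assoc] at h
      exact h
  -- On representatives `G` sends `χ ⊗ φ ⊗ θ` to `χθ₁ ⊗ φθ₂`, as does the right action of `B`.
  have h1 : BaseMaps.idKL hd.source ▷ (forgetMon Lr).X ≫ G =
      BaseMaps.rhoN (hd.rightTakeuchi hb) ≫ BaseMaps.idKL hd.source := by
    rw [← cancel_epi (d.piKK ▷ (forgetMon Lr).X), ← comp_whiskerRight_assoc, BaseMaps.piKK_idKL,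
      hG, hd.piKL_dualEntw, MonoidalCategory.whiskerLeft_comp_assoc, BaseMaps.lamSnd_mulLK,
      reassoc_of% BaseMaps.piKK_rhoN, ← associator_naturality_right_assoc, Iso.hom_inv_id_assoc]
  rw [← cancel_mono (BaseMaps.idKL hd.source), Category.assoc, Category.assoc, ← h1,
    ← comp_whiskerRight_assoc, ← hd.one_dualEntw hb, leftUnitor_inv_naturality_assoc,
    whisker_exchange_assoc, hG', associator_inv_naturality_left_assoc]
  simp only [comp_whiskerRight, Category.assoc]
  monoidal

theorem isRightBialgebroid (hd : IsDual b Lr d)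
    (hb : b.IsLeftBialgebroid) : d.IsRightBialgebroid where
  takeuchi := hd.rightTakeuchi hb
  one_comul := hd.one_comulK hb
  mul_comul := hd.mul_comulK hb
  one_counit := hd.one_counitK hb
  mul_counit_s := hd.mul_counitK_source hb
  mul_counit_t := hd.mul_counitK_target hb

end IsDual

end DualRightBialgebroid

end InternalBialgebroid

/-! ### Assembly of the duality theorem -/

theorem mainTheorem3 {C : Type u} [Category.{v} C] [MonoidalCategory C] [SymmetricCategory C]
    [HasCoequalizers C]
    [∀ X : C, PreservesColimitsOfShape WalkingParallelPair (tensorLeft X)]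
    [∀ X : C, PreservesColimitsOfShape WalkingParallelPair (tensorRight X)]
    (R A : Mon C) (b : BaseMaps R A) [ComonObj b.L] (hb : b.IsLeftBialgebroid)
    (Lr Sr : Bimod R R) [ExactPairing Lr b.L] [ExactPairing Sr b.S] :
    letI : MonObj Lr := dualMonObj b.L Lr
    let B : Mon C := forgetMon Lr
    let πr : R.X ⟶ B.X := fromR η[Lr]
    Lr.actLeft = πr ▷ B.X ≫ μ[B.X] ∧
    Lr.actRight = B.X ◁ πr ≫ μ[B.X] ∧
    ∃ ψ : b.S ⊗ b.L ⟶ b.L ⊗ b.S,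
      toTens b.S b.L ≫ ψ.hom = (b.comulL ⊗ₘ ((ρ_ A.X).inv ≫ A.X ◁ η[A.X])) ≫ b.rhoLS ∧
      IsLeftEntwining ψ ∧
      ∃ (d : BaseMaps R B) (hs : d.s.hom = πr) (e : d.K ≅ Sr),
        letI : ExactPairing d.K b.S := exactPairingCongrLeft e
        letI : ComonObj d.K := dualComonObj b.S d.K
        let ψr : d.K ⊗ Lr ⟶ Lr ⊗ d.K := dualMap ψ
        toTens b.L Lr ≫ toR (ε_ Lr b.L) = toTens b.S d.K ≫ toR (ε_ d.K b.S) ∧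
        IsRightEntwining ψr ∧
        Epi d.counitK ∧
        toTens d.K Lr ≫ ψr.hom =
          (((λ_ B.X).inv ≫ η[B.X] ▷ B.X) ⊗ₘ d.comulK) ≫ dualLam d hs ∧
        d.IsRightBialgebroid := by
  let : MonObj Lr := dualMonObj b.L Lr
  -- The structure on `Lr` is the transposed one by definition, so both compatibility hypotheses
  -- hold by `rfl`.
  obtain ⟨e, he⟩ := BaseMaps.exists_dual_iso (Lr := Lr) hb rfl rfl Sr
  -- The duality of `S` with `Sr` is transported along `e`, so that the dual comonoid lives on `K`
  -- itself.
  let : ExactPairing (BaseMaps.dualBaseMaps (Lr := Lr) hb rfl rfl).K b.S := exactPairingCongrLeft e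
  let : ComonObj (BaseMaps.dualBaseMaps (Lr := Lr) hb rfl rfl).K := dualComonObj b.S _
  -- The transported evaluation is that of `Sr` precomposed with `e`, which `he` identifies with the
  -- evaluation of `L`.
  have hP : pairing b.S (BaseMaps.dualBaseMaps (Lr := Lr) hb rfl rfl).K = b.evL Lr := by
    have h : toTens b.S (BaseMaps.dualBaseMaps (Lr := Lr) hb rfl rfl).K ≫
        (b.S ◁ e.hom).hom ≫ toR (ε_ Sr b.S) = b.evL Lr := by
      rw [reassoc_of% toTens_whiskerLeft]
      exact he
    exact h
  have hd : IsDual b Lr (BaseMaps.dualBaseMaps (Lr := Lr) hb rfl rfl) :=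
    { one := rfl
      mul := rfl
      counit := rfl
      comul := rfl
      source := rfl
      target := BaseMaps.evL_dualBaseMaps hb rfl rfl
      evaluation := hP }
  exact ⟨(one_mul_fromR Lr).symm, forgetMon_actRight Lr, BaseMaps.entwHom hb,
    BaseMaps.toTens_entwHom_rhoLS hb, BaseMaps.isLeftEntwining_entwHom hb,
    BaseMaps.dualBaseMaps (Lr := Lr) hb rfl rfl, rfl, e, hP.symm, hd.isRightEntwining hb,
    hd.epi_counitK hb,
    (hd.piKL_dualEntw hb).trans (BaseMaps.tensorHom_lamLK hd.source _).symm,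
    hd.isRightBialgebroid hb⟩
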